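/- **Theorem 1.1.** Let $n\ge 1$, let $0\le r<R\le\infty$, and let $Ann(r,R)=\{z\in\mathbb C^n: r<|z|<R\}$. For $s>0$ let $\mu_s$ be the normalized surface measure on $\{w\in\mathbb C^n:|w|=s\}$. Let $Z(Ann(r,R))$ be the class of continuous functions $f$ on $Ann(r,R)$ such that $$f\times\mu_s(z)=\int_{|w|=s}f(z-w)\,e^{\frac i2\operatorname{Im}(z\cdot\bar w)}\,d\mu_s(w)=0$$ for all $z\in\mathbb C^n$ and $s>0$ for which the sphere $S_s(z)=\{\zeta:|\zeta-z|=s\}$ is contained in $Ann(r,R)$ and the closed ball $\{|\zeta-z|\le s\}$ contains the closed ball $\{|\zeta|\le r\}$ (which is $\{0\}$ if $r=0$). For integers $p,q\ge 0$ let $H_{p,q}$ be the space of polynomials $P(z)=\sum_{|\alpha|=p}\sum_{|\beta|=q}c_{\alpha\beta}z^\alpha\bar z^\beta$ on $\mathbb C^n$ with $\Delta P=0$, where $\Delta$ is the standard Laplacian, and let $d(p,q)=\dim_{\mathbb C}H_{p,q}$. For all $p,q\ge 0$ let $P_1^{p,q},\dots,P_{d(p,q)}^{p,q}$ be a basis of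 $H_{p,q}$ whose restrictions $Y_j^{p,q}$ to the unit sphere $S^{2n-1}$ are orthonormal in $L^2(S^{2n-1},\mu_1)$. For a continuous function $f$ on $Ann(r,R)$ and $r<\rho<R$ define the spherical harmonic coefficients $$\tilde a_j^{p,q}(\rho)=\rho^{-(p+q)}\int_{S^{2n-1}}f(\rho\omega)\,\overline{Y_j^{p,q}(\omega)}\,d\mu_1(\omega),\qquad 1\le j\le d(p,q).$$ Then a continuous function $f$ on $Ann(r,R)$ belongs to $Z(Ann(r,R))$ if and only if all of the following hold (for all $1\le j\le d(p,q)$ in each case): 1. $\tilde a_j^{0,0}(\rho)=0$ for all $r<\rho<R$. 2. For all $p,q\ge 1$ there are constants $c_1,\dots,c_p,d_1,\dots,d_q\in\mathbb C$ (depending on $p,q,j$) such that for all $r<\rho<R$ $$\tilde a_j^{p,q}(\rho)=\sum_{i=1}^{p}c_i\,e^{\frac14\rho^2}\rho^{-2(p+q+n-i)}+\sum_{k=1}^{q}d_k\,e^{-\frac14\rho^2}\rho^{-2(p+q+n-k)}.$$ 3. For all $p\ge 1$ there are constants $c_1,\dots,c_p\in\mathbb C$ (depending on $p,j$) such that for all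 $r<\rho<R$ $$\tilde a_j^{p,0}(\rho)=\sum_{i=1}^{p}c_i\,e^{\frac14\rho^2}\rho^{-2(p+n-i)},$$ and for all $q\ge 1$ there are constants $d_1,\dots,d_q\in\mathbb C$ (depending on $q,j$) such that for all $r<\rho<R$ $$\tilde a_j^{0,q}(\rho)=\sum_{k=1}^{q}d_k\,e^{-\frac14\rho^2}\rho^{-2(q+n-k)}.$$ -/

import Mathlib

open MeasureTheory

/-- The space `ℂⁿ` with its Euclidean norm. -/
abbrev Cn (n : ℕ) : Type := EuclideanSpace ℂ (Fin n)

/-- The annulus `{z ∈ ℂⁿ : r < |z| < R}`, where `R = ∞` is allowed. -/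
def Ann (n : ℕ) (r : ℝ) (R : EReal) : Set (Cn n) :=
  {z | r < ‖z‖ ∧ ((‖z‖ : ℝ) : EReal) < R}

/-- The normalized surface measure on the unit sphere of `ℂⁿ`. -/
noncomputable def unitSphereMeasure (n : ℕ) : Measure (Metric.sphere (0 : Cn n) 1) :=
  ((volume : Measure (Cn n)).toSphere Set.univ)⁻¹ • (volume : Measure (Cn n)).toSphere

/-- The normalized surface measure `μ_s` on the sphere `{w ∈ ℂⁿ : |w| = s}`. -/
noncomputable def sphereMeasure (n : ℕ) (s : ℝ) : Measure (Cn n) :=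
  (unitSphereMeasure n).map (fun ω : Metric.sphere (0 : Cn n) 1 => s • (ω : Cn n))

/-- The twisted spherical mean
`(f × μ_s)(z) = ∫_{|w| = s} f (z - w) exp ((i/2) Im (z · w̄)) dμ_s(w)`. -/
noncomputable def twistedMean {n : ℕ} (f : Cn n → ℂ) (s : ℝ) (z : Cn n) : ℂ :=
  ∫ w, f (z - w) *
    Complex.exp (Complex.I / 2 * ((∑ j, z j * (starRingEnd ℂ) (w j)).im : ℂ))
    ∂(sphereMeasure n s)

/-- The class `Z(Ann(r,R))`: continuous functions on the annulus whose twisted spherical means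
vanish over all spheres `S_s(z)` contained in the annulus whose ball contains the ball `B_r(0)`.
Balls are closed, so that for `r = 0` the sphere has to surround the origin. -/
def ZAnn (n : ℕ) (r : ℝ) (R : EReal) : Set (Cn n → ℂ) :=
  {f | ContinuousOn f (Ann n r R) ∧
    ∀ (z : Cn n) (s : ℝ), 0 < s → Metric.sphere z s ⊆ Ann n r R →
      Metric.closedBall (0 : Cn n) r ⊆ Metric.closedBall z s → twistedMean f s z = 0}

/-- The space `P_{p,q}` of polynomials `∑_{|α| = p} ∑_{|β| = q} c_{αβ} z^α z̄^β` on `ℂⁿ`. -/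
def bigradedPoly (n p q : ℕ) : Submodule ℂ (Cn n → ℂ) :=
  Submodule.span ℂ {P | ∃ α β : Fin n → ℕ, ∑ j, α j = p ∧ ∑ j, β j = q ∧
    P = fun z => (∏ j, z j ^ α j) * ∏ j, (starRingEnd ℂ) (z j) ^ β j}

theorem contDiff_of_mem_bigradedPoly {n p q : ℕ} {P : Cn n → ℂ}
    (hP : P ∈ bigradedPoly n p q) : ContDiff ℝ 2 P := by
  have hcoord : ∀ j : Fin n, ContDiff ℝ 2 (fun z : Cn n => z j) := fun j => by fun_prop
  have hconj : ∀ j : Fin n, ContDiff ℝ 2 (fun z : Cn n => (starRingEnd ℂ) (z j)) := fun j =>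
    Complex.conjCLE.contDiff.comp (hcoord j)
  refine Submodule.span_induction (p := fun P _ => ContDiff ℝ 2 P) ?_ ?_ ?_ ?_ hP
  · rintro _ ⟨α, β, -, -, rfl⟩
    exact (contDiff_prod fun j _ => (hcoord j).pow _).mul
      (contDiff_prod fun j _ => (hconj j).pow _)
  · exact contDiff_const
  · intro f g _ _ hf hg
    exact hf.add hg
  · intro c f _ hf
    exact contDiff_const.mul hf

/-- The space `H_{p,q}` of bigraded solid harmonics: the elements of `P_{p,q}` that are annihilated
by the standard Laplacian of `ℂⁿ = ℝ²ⁿ`. -/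
noncomputable def solidHarmonics (n p q : ℕ) : Submodule ℂ (Cn n → ℂ) where
  carrier := {P | P ∈ bigradedPoly n p q ∧ ∀ z, Laplacian.laplacian P z = 0}
  zero_mem' := ⟨Submodule.zero_mem _, fun z => by
    have h : Laplacian.laplacian (fun _ : Cn n => (0 : ℂ)) = 0 :=
      InnerProductSpace.laplacian_const
    exact congrFun h z⟩
  add_mem' := fun {f g} hf hg => ⟨Submodule.add_mem _ hf.1 hg.1, fun z => by
    rw [ContDiffAt.laplacian_add (contDiff_of_mem_bigradedPoly hf.1).contDiffAt
      (contDiff_of_mem_bigradedPoly hg.1).contDiffAt, hf.2 z, hg.2 z, add_zero]⟩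
  smul_mem' := fun c f hf => ⟨Submodule.smul_mem _ c hf.1, fun z => by
    have h1 : ContDiff ℝ 2 f := contDiff_of_mem_bigradedPoly hf.1
    have h2 := (h1.contDiffAt (x := z)).laplacian_CLM_comp_left
      (l := ContinuousLinearMap.mul ℝ ℂ c)
    have h3 : (ContinuousLinearMap.mul ℝ ℂ c) ∘ f = c • f := by
      ext w
      simp
    rw [h3] at h2
    rw [h2]
    simp [hf.2 z]⟩

/-- The dimension `d(p,q)` of `H_{p,q}`. -/
noncomputable def dimHarmonics (n p q : ℕ) : ℕ := Module.finrank ℂ (solidHarmonics n p q)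

/-- `P_1, …, P_{d(p,q)}` is a basis of `H_{p,q}` whose restrictions `Y_j` to the unit sphere are
orthonormal for the normalized surface measure. -/
def IsOrthonormalHarmonicBasis (n p q : ℕ) (P : Fin (dimHarmonics n p q) → Cn n → ℂ) : Prop :=
  Submodule.span ℂ (Set.range P) = solidHarmonics n p q ∧
    ∀ j k, ∫ ω, P j (ω : Cn n) * (starRingEnd ℂ) (P k (ω : Cn n)) ∂(unitSphereMeasure n) =
      if j = k then 1 else 0

/-- The spherical harmonic coefficient `a(ρ) = ∫ f(ρω) conj(Y(ω)) dσ(ω)` of `f` along the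
restriction `Y` of `Q` to the unit sphere. -/
noncomputable def sphCoeff {n : ℕ} (f Q : Cn n → ℂ) (ρ : ℝ) : ℂ :=
  ∫ ω, f (ρ • (ω : Cn n)) * (starRingEnd ℂ) (Q (ω : Cn n)) ∂(unitSphereMeasure n)

/-- The modified coefficient `ã(ρ) = ρ^{-(p+q)} a(ρ)`. -/
noncomputable def sphCoeffTilde {n : ℕ} (p q : ℕ) (f Q : Cn n → ℂ) (ρ : ℝ) : ℂ :=
  ((ρ ^ (-((p : ℤ) + q)) : ℝ) : ℂ) * sphCoeff f Q ρ

/-! The twist is carried by a real parameter `κ`, equal to 1/4 in the theorem: complex conjugation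
exchanges `κ` with `-κ` and bidegree `(a, b)` with `(b, a)`, so only one of the two exponentials has
to be treated by hand.

Sufficiency. The building blocks are `e^{κ|u|²} |u|^{-2k} p(u)` with `p` harmonic of bidegree `(a+1,
b)` and `n+b ≤ k ≤ n+a+b`. Move the centre to `τz` and let `τ` be complex, treating `u` and `ū` as
independent variables. The mean becomes holomorphic in `τ` for `|τ||z| < s`. Its derivative is a
combination of means of other building blocks: the window for `k` is stable, because the only terms
that would leave it have coefficient zero (`hasDerivAt_modelMean`). At `τ = 0` every mean vanishes,
since `p` is orthogonal to constants. So all Taylor coefficients vanish, and `τ = 1` gives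
`twist_model_eq_zero`. A continuous `f` need not be the pointwise sum of its harmonic components.
Its twisted means are therefore tested against functions of the radius, and Parseval on each sphere
with dominated convergence reduces the claim to the components (`twist_eq_zero_of_components`).

Necessity. For smooth `F`, the vanishing of the means centred near the origin is inherited by the
derivatives of `F` along the invariant fields of the twisted structure. The divergence theorem,
Euler's identity and harmonicity of `p` turn this into a first-order equation: after multiplication
by `e^{-κρ²} ρ^{2(n+a+b)}`, the derivative of the coefficient of type `(a+1, b)` is a combination of
coefficients of type `(a, b)` of derivatives of `F` (`IsTwistClass.hasDerivAt_radialWeight`).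
Integration stays in the expected function space, and the constant of integration supplies exactly
one new term. The induction starts at `(0, 0)`, where the coefficient is a multiple of the mean, and
conjugation raises `b`. A merely continuous `f` is first smoothed by twisted convolution. The radial
spaces are finite-dimensional, hence closed under pointwise limits, so the conclusion survives
removing the smoothing and exhausting `(r, R)`. -/

/-- The values of the variables `z₁, …, zₙ, z̄₁, …, z̄ₙ` at a point of `ℂⁿ`. -/
def bicoords {n : ℕ} (u : Cn n) : Fin n ⊕ Fin n → ℂ :=
  Sum.elim (fun j => u j) (fun j => (starRingEnd ℂ) (u j))

@[simp] lemma bicoords_inl {n : ℕ} (u : Cn n) (j : Fin n) : bicoords u (Sum.inl j) = u j := rfl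

@[simp] lemma bicoords_inr {n : ℕ} (u : Cn n) (j : Fin n) :
    bicoords u (Sum.inr j) = (starRingEnd ℂ) (u j) := rfl

/-- The function on `ℂⁿ` defined by a polynomial in `z` and `z̄`. -/
noncomputable def evalBi {n : ℕ} (p : MvPolynomial (Fin n ⊕ Fin n) ℂ) (u : Cn n) : ℂ :=
  MvPolynomial.eval (bicoords u) p

/-- The polynomial Laplacian `∑ ∂ⱼ ∂̄ⱼ`. -/
noncomputable def polyLap {n : ℕ} (p : MvPolynomial (Fin n ⊕ Fin n) ℂ) :
    MvPolynomial (Fin n ⊕ Fin n) ℂ :=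
  ∑ j, MvPolynomial.pderiv (Sum.inl j) (MvPolynomial.pderiv (Sum.inr j) p)

/-- The polynomial `|z|²`. -/
noncomputable def normSqPoly (n : ℕ) : MvPolynomial (Fin n ⊕ Fin n) ℂ :=
  ∑ j, MvPolynomial.X (Sum.inl j) * MvPolynomial.X (Sum.inr j)

/-- The weight counting the holomorphic variables. -/
def leftWeight (n : ℕ) : Fin n ⊕ Fin n → ℕ := Sum.elim (fun _ => 1) (fun _ => 0)

/-- The weight counting the antiholomorphic variables. -/
def rightWeight (n : ℕ) : Fin n ⊕ Fin n → ℕ := Sum.elim (fun _ => 0) (fun _ => 1)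

/-- Polynomials that are homogeneous of bidegree `(a, b)`. -/
structure IsBihom {n : ℕ} (a b : ℕ) (p : MvPolynomial (Fin n ⊕ Fin n) ℂ) : Prop where
  left : MvPolynomial.IsWeightedHomogeneous (leftWeight n) p a
  right : MvPolynomial.IsWeightedHomogeneous (rightWeight n) p b

/-- Harmonic polynomials that are homogeneous of bidegree `(a, b)`. -/
structure IsHarm {n : ℕ} (a b : ℕ) (p : MvPolynomial (Fin n ⊕ Fin n) ℂ) : Prop
    extends IsBihom a b p where
  lap : polyLap p = 0

/-! ### Polynomials in `z` and `z̄` as functions on `ℂⁿ` -/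

section eval

variable {n : ℕ}

/-- The scalar field is left open: real lines give the Fréchet derivative of `evalBi`, complex
curves give the holomorphic dependence on `τ` of the model means. -/
lemma hasDerivAt_eval {σ 𝕜 : Type*} [Fintype σ] [NontriviallyNormedField 𝕜] [NormedAlgebra 𝕜 ℂ]
    (p : MvPolynomial σ ℂ) {c : 𝕜 → σ → ℂ} {c' : σ → ℂ} {t : 𝕜}
    (hc : ∀ i, HasDerivAt (fun t => c t i) (c' i) t) :
    HasDerivAt (fun t => MvPolynomial.eval (c t) p)
      (∑ i, c' i * MvPolynomial.eval (c t) (MvPolynomial.pderiv i p)) t := by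
  classical
  induction p using MvPolynomial.induction_on with
  | C a => simpa using hasDerivAt_const t a
  | add p q hp hq =>
    simpa only [map_add, mul_add, Finset.sum_add_distrib] using hp.fun_add hq
  | mul_X p i hp =>
    have h := hp.fun_mul (hc i)
    have e : ∀ j, MvPolynomial.eval (c t) (MvPolynomial.pderiv j (p * MvPolynomial.X i)) =
        MvPolynomial.eval (c t) p * (if i = j then 1 else 0) +
        c t i * MvPolynomial.eval (c t) (MvPolynomial.pderiv j p) := by
      intro j
      rw [Derivation.leibniz, MvPolynomial.pderiv_X]
      by_cases hj : i = j <;> simp [hj]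
    simp_rw [e, map_mul, MvPolynomial.eval_X]
    refine h.congr_deriv ?_
    simp only [mul_add, Finset.sum_add_distrib, Finset.sum_mul, mul_ite, mul_one, mul_zero,
      Finset.sum_ite_eq, Finset.mem_univ, if_true]
    rw [add_comm, mul_comm (c' i)]
    congr 1
    exact Finset.sum_congr rfl fun j _ => by ring

lemma pderiv_pderiv_comm {σ : Type*} (i k : σ) (p : MvPolynomial σ ℂ) :
    MvPolynomial.pderiv i (MvPolynomial.pderiv k p) =
      MvPolynomial.pderiv k (MvPolynomial.pderiv i p) := by
  classical
  have h : ⁅(MvPolynomial.pderiv i : Derivation ℂ (MvPolynomial σ ℂ) (MvPolynomial σ ℂ)),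
      (MvPolynomial.pderiv k : Derivation ℂ (MvPolynomial σ ℂ) (MvPolynomial σ ℂ))⁆ = 0 := by
    refine MvPolynomial.derivation_ext fun l => ?_
    rw [Derivation.commutator_apply, MvPolynomial.pderiv_X, MvPolynomial.pderiv_X]
    simp only [Pi.single_apply]
    split_ifs <;> simp
  have := DFunLike.congr_fun h p
  rwa [Derivation.commutator_apply, Derivation.zero_apply, sub_eq_zero] at this

lemma continuous_bicoords_apply (i : Fin n ⊕ Fin n) : Continuous fun u : Cn n => bicoords u i := by
  rcases i with j | j
  · simp only [bicoords_inl]; fun_prop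
  · simp only [bicoords_inr]; exact Complex.continuous_conj.comp (by fun_prop)

lemma contDiff_bicoords_apply (i : Fin n ⊕ Fin n) :
    ContDiff ℝ ⊤ fun u : Cn n => bicoords u i := by
  rcases i with j | j
  · simp only [bicoords_inl]; fun_prop
  · simp only [bicoords_inr]
    have : ContDiff ℝ ⊤ fun z : Cn n => z j := by fun_prop
    exact Complex.conjCLE.contDiff.comp this

lemma contDiff_evalBi (p : MvPolynomial (Fin n ⊕ Fin n) ℂ) : ContDiff ℝ ⊤ (evalBi p) := by
  induction p using MvPolynomial.induction_on with
  | C a =>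
    have : evalBi (n := n) (MvPolynomial.C a) = fun _ => a := by ext u; simp [evalBi]
    rw [this]; exact contDiff_const
  | add p q hp hq =>
    have : evalBi (p + q) = fun u => evalBi p u + evalBi q u := by ext u; simp [evalBi]
    rw [this]; exact hp.add hq
  | mul_X p i hp =>
    have : evalBi (p * MvPolynomial.X i) = fun u => evalBi p u * bicoords u i := by
      ext u; simp [evalBi]
    rw [this]; exact hp.mul (contDiff_bicoords_apply i)

lemma continuous_evalBi (p : MvPolynomial (Fin n ⊕ Fin n) ℂ) : Continuous (evalBi p) :=
  (contDiff_evalBi p).continuous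

lemma differentiable_evalBi (p : MvPolynomial (Fin n ⊕ Fin n) ℂ) :
    Differentiable ℝ (evalBi p) :=
  (contDiff_evalBi p).differentiable (by simp)

lemma fderiv_evalBi (p : MvPolynomial (Fin n ⊕ Fin n) ℂ) (u v : Cn n) :
    fderiv ℝ (evalBi p) u v = ∑ j, (v j * evalBi (MvPolynomial.pderiv (Sum.inl j) p) u +
      (starRingEnd ℂ) (v j) * evalBi (MvPolynomial.pderiv (Sum.inr j) p) u) := by
  have h1 : HasDerivAt (fun t : ℝ => u + t • v) v 0 := by
    simpa using ((hasDerivAt_id (0 : ℝ)).smul_const v).const_add u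
  have h2 : HasDerivAt (fun t : ℝ => evalBi p (u + t • v)) (fderiv ℝ (evalBi p) u v) 0 := by
    have h3 : HasFDerivAt (evalBi p) (fderiv ℝ (evalBi p) u) (u + (0 : ℝ) • v) := by
      simpa using (differentiable_evalBi p u).hasFDerivAt
    exact h3.comp_hasDerivAt (0 : ℝ) h1
  have h4 := hasDerivAt_eval (t := (0 : ℝ)) (c := fun t => bicoords (u + t • v))
    (c' := bicoords v) p (fun i => by
      rcases i with j | j
      · simpa using ((hasDerivAt_id (0 : ℝ)).smul_const (v j)).const_add (u j)
      · simpa using ((hasDerivAt_id (0 : ℝ)).smul_const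
          ((starRingEnd ℂ) (v j))).const_add ((starRingEnd ℂ) (u j)))
  rw [h2.unique h4]
  simp [Fintype.sum_sum_type, Finset.sum_add_distrib, evalBi]

/-- Points of `ℂⁿ` only supply conjugate pairs as values of the variables. The substitution `A : z ↦
x + iy, z̄ ↦ x - iy` is inverted by `B`, and after it the two polynomials agree at all real points,
a product of infinite sets. -/
lemma evalBi_inj {p q : MvPolynomial (Fin n ⊕ Fin n) ℂ} (h : evalBi p = evalBi q) : p = q := by
  let A : MvPolynomial (Fin n ⊕ Fin n) ℂ →ₐ[ℂ] MvPolynomial (Fin n ⊕ Fin n) ℂ :=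
    MvPolynomial.aeval (Sum.elim
      (fun j => MvPolynomial.X (Sum.inl j) + MvPolynomial.C Complex.I * MvPolynomial.X (Sum.inr j))
      (fun j => MvPolynomial.X (Sum.inl j) -
        MvPolynomial.C Complex.I * MvPolynomial.X (Sum.inr j)))
  let B : MvPolynomial (Fin n ⊕ Fin n) ℂ →ₐ[ℂ] MvPolynomial (Fin n ⊕ Fin n) ℂ :=
    MvPolynomial.aeval (Sum.elim
      (fun j => MvPolynomial.C (1 / 2) *
        (MvPolynomial.X (Sum.inl j) + MvPolynomial.X (Sum.inr j)))
      (fun j => MvPolynomial.C (-Complex.I / 2) *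
        (MvPolynomial.X (Sum.inl j) - MvPolynomial.X (Sum.inr j))))
  have hBA : ∀ p, B (A p) = p := by
    intro p
    have hI : (MvPolynomial.C Complex.I : MvPolynomial (Fin n ⊕ Fin n) ℂ) *
        MvPolynomial.C (-Complex.I / 2) = MvPolynomial.C (1 / 2) := by
      rw [← MvPolynomial.C_mul]; congr 1
      linear_combination (-1 / 2 : ℂ) * Complex.I_mul_I
    have h2 : (MvPolynomial.C (1 / 2) : MvPolynomial (Fin n ⊕ Fin n) ℂ) * 2 = 1 := by
      rw [show (2 : MvPolynomial (Fin n ⊕ Fin n) ℂ) = MvPolynomial.C 2 from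
        (map_ofNat MvPolynomial.C 2).symm, ← MvPolynomial.C_mul]
      norm_num
    have : (B.comp A) = AlgHom.id ℂ _ := by
      apply MvPolynomial.algHom_ext
      rintro (j | j)
      · simp only [A, B, AlgHom.comp_apply, MvPolynomial.aeval_X, Sum.elim_inl, map_add, map_mul,
          Sum.elim_inr, AlgHom.id_apply, MvPolynomial.algHom_C, MvPolynomial.algebraMap_eq]
        rw [← mul_assoc, hI]
        linear_combination (MvPolynomial.X (Sum.inl j)) * h2
      · simp only [A, B, AlgHom.comp_apply, MvPolynomial.aeval_X, Sum.elim_inl, map_sub, map_mul,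
          Sum.elim_inr, AlgHom.id_apply, MvPolynomial.algHom_C, MvPolynomial.algebraMap_eq]
        rw [← mul_assoc, hI]
        linear_combination (MvPolynomial.X (Sum.inr j)) * h2
    exact DFunLike.congr_fun this p
  have hA : A p = A q := by
    refine MvPolynomial.funext_set (fun _ => Set.range ((↑) : ℝ → ℂ))
      (fun _ => Set.infinite_range_of_injective Complex.ofReal_injective) fun x hx => ?_
    choose y hy using fun i => hx i trivial
    have key : ∀ p, MvPolynomial.eval x (A p) =
        evalBi p (WithLp.toLp 2 fun j => (y (Sum.inl j) : ℂ) + Complex.I * y (Sum.inr j)) := by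
      intro p
      have hc : (MvPolynomial.eval x).comp (A : _ →+* _) = MvPolynomial.eval (bicoords
          (WithLp.toLp 2 fun j => (y (Sum.inl j) : ℂ) + Complex.I * y (Sum.inr j))) := by
        apply MvPolynomial.ringHom_ext
        · intro a; simp [A]
        · rintro (j | j)
          · simp [A, hy]
          · simp [A, ← hy, sub_eq_add_neg]
      exact DFunLike.congr_fun hc p
    rw [key, key, h]
  rw [← hBA p, ← hBA q, hA]

lemma evalBi_add (p q : MvPolynomial (Fin n ⊕ Fin n) ℂ) (u : Cn n) :
    evalBi (p + q) u = evalBi p u + evalBi q u := map_add _ _ _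

lemma evalBi_mul (p q : MvPolynomial (Fin n ⊕ Fin n) ℂ) (u : Cn n) :
    evalBi (p * q) u = evalBi p u * evalBi q u := map_mul _ _ _

lemma evalBi_sum {ι : Type*} (s : Finset ι) (p : ι → MvPolynomial (Fin n ⊕ Fin n) ℂ) (u : Cn n) :
    evalBi (∑ i ∈ s, p i) u = ∑ i ∈ s, evalBi (p i) u := map_sum _ _ _

lemma evalBi_smul (c : ℂ) (p : MvPolynomial (Fin n ⊕ Fin n) ℂ) (u : Cn n) :
    evalBi (c • p) u = c * evalBi p u := by simp [evalBi, MvPolynomial.smul_eval]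

@[simp] lemma evalBi_zero (u : Cn n) : evalBi 0 u = 0 := map_zero _

@[simp] lemma evalBi_one (u : Cn n) : evalBi 1 u = 1 := map_one _

@[simp] lemma evalBi_X (i : Fin n ⊕ Fin n) (u : Cn n) :
    evalBi (MvPolynomial.X i) u = bicoords u i := by simp [evalBi]

lemma evalBi_normSqPoly (u : Cn n) : evalBi (normSqPoly n) u = ((‖u‖ ^ 2 : ℝ) : ℂ) := by
  rw [normSqPoly, evalBi_sum, EuclideanSpace.norm_sq_eq]
  push_cast
  exact Finset.sum_congr rfl fun j _ => by
    rw [evalBi_mul, evalBi_X, evalBi_X, bicoords_inl, bicoords_inr, Complex.mul_conj']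

lemma fderiv_evalBi_single (p : MvPolynomial (Fin n ⊕ Fin n) ℂ) (u : Cn n) (j : Fin n) (c : ℂ) :
    fderiv ℝ (evalBi p) u (PiLp.single 2 j c) = evalBi (c • MvPolynomial.pderiv (Sum.inl j) p +
      (starRingEnd ℂ) c • MvPolynomial.pderiv (Sum.inr j) p) u := by
  classical
  rw [fderiv_evalBi, Finset.sum_eq_single j]
  · simp [evalBi_add, evalBi_smul]
  · intro k _ hk
    simp [hk]
  · simp

/-- In the real orthonormal basis `e_j, i e_j` this is `∂_x² + ∂_y² = 4∂∂̄`; the pure terms `∂²` and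
`∂̄²` cancel because `1 + i² = 0`. -/
lemma laplacian_evalBi (p : MvPolynomial (Fin n ⊕ Fin n) ℂ) (u : Cn n) :
    Laplacian.laplacian (evalBi p) u = 4 * evalBi (polyLap p) u := by
  classical
  have h2 : ∀ v : Cn n, iteratedFDeriv ℝ 2 (evalBi p) u ![v, v] =
      fderiv ℝ (fun y => fderiv ℝ (evalBi p) y v) u v := by
    intro v
    rw [iteratedFDeriv_two_apply, fderiv_clm_apply]
    · simp
    · exact ((contDiff_evalBi p).fderiv_right (m := 1) (by exact le_top)).differentiable
        (by simp) u
    · fun_prop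
  have h3 : ∀ (j : Fin n) (c : ℂ),
      iteratedFDeriv ℝ 2 (evalBi p) u ![PiLp.single 2 j c, PiLp.single 2 j c] =
      evalBi (c • MvPolynomial.pderiv (Sum.inl j) (c • MvPolynomial.pderiv (Sum.inl j) p +
          (starRingEnd ℂ) c • MvPolynomial.pderiv (Sum.inr j) p) +
        (starRingEnd ℂ) c • MvPolynomial.pderiv (Sum.inr j) (c • MvPolynomial.pderiv (Sum.inl j) p +
          (starRingEnd ℂ) c • MvPolynomial.pderiv (Sum.inr j) p)) u := by
    intro j c
    rw [h2, ← fderiv_evalBi_single]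
    congr 2
    ext y
    rw [fderiv_evalBi_single]
  rw [InnerProductSpace.laplacian_eq_iteratedFDeriv_orthonormalBasis _
    (Pi.orthonormalBasis fun _ : Fin n => Complex.orthonormalBasisOneI)]
  simp only []
  rw [Fintype.sum_sigma, polyLap, evalBi_sum, Finset.mul_sum]
  refine Finset.sum_congr rfl fun j _ => ?_
  simp only [Fin.sum_univ_two, Pi.orthonormalBasis_apply, h3, Derivation.map_add,
    Derivation.map_smul, evalBi_add, evalBi_smul, pderiv_pderiv_comm (Sum.inr j) (Sum.inl j)]
  simp only [Complex.coe_orthonormalBasisOneI, Matrix.cons_val_zero, Matrix.cons_val_one, map_one,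
    Complex.conj_I]
  linear_combination (evalBi (MvPolynomial.pderiv (Sum.inl j) (MvPolynomial.pderiv (Sum.inl j) p)) u
    + evalBi (MvPolynomial.pderiv (Sum.inr j) (MvPolynomial.pderiv (Sum.inr j) p)) u
    - 2 * evalBi (MvPolynomial.pderiv (Sum.inl j) (MvPolynomial.pderiv (Sum.inr j) p)) u)
    * Complex.I_mul_I

end eval

/-! ### Bihomogeneous and harmonic polynomials, raising operators -/

section bihom

open MvPolynomial

variable {n a b : ℕ} {p q : MvPolynomial (Fin n ⊕ Fin n) ℂ}

lemma IsBihom.add (hp : IsBihom a b p) (hq : IsBihom a b q) : IsBihom a b (p + q) :=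
  ⟨hp.left.add hq.left, hp.right.add hq.right⟩

lemma IsBihom.smul (c : ℂ) (hp : IsBihom a b p) : IsBihom a b (c • p) := by
  rw [MvPolynomial.smul_eq_C_mul]
  exact ⟨hp.left.C_mul c, hp.right.C_mul c⟩

lemma isBihom_zero : IsBihom a b (0 : MvPolynomial (Fin n ⊕ Fin n) ℂ) :=
  ⟨isWeightedHomogeneous_zero _ _ _, isWeightedHomogeneous_zero _ _ _⟩

lemma isBihom_one : IsBihom 0 0 (1 : MvPolynomial (Fin n ⊕ Fin n) ℂ) :=
  ⟨isWeightedHomogeneous_one _ _, isWeightedHomogeneous_one _ _⟩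

lemma IsBihom.sum {ι : Type*} (s : Finset ι) (f : ι → MvPolynomial (Fin n ⊕ Fin n) ℂ)
    (h : ∀ i ∈ s, IsBihom a b (f i)) : IsBihom a b (∑ i ∈ s, f i) :=
  ⟨IsWeightedHomogeneous.sum _ _ _ fun i hi => (h i hi).left,
    IsWeightedHomogeneous.sum _ _ _ fun i hi => (h i hi).right⟩

lemma IsBihom.mul {a' b' : ℕ} (hp : IsBihom a b p) (hq : IsBihom a' b' q) :
    IsBihom (a + a') (b + b') (p * q) := ⟨hp.left.mul hq.left, hp.right.mul hq.right⟩

lemma isBihom_X_inl (j : Fin n) : IsBihom 1 0 (X (R := ℂ) (Sum.inl j : Fin n ⊕ Fin n)) :=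
  ⟨isWeightedHomogeneous_X _ _ _, isWeightedHomogeneous_X _ _ _⟩

lemma isBihom_X_inr (j : Fin n) : IsBihom 0 1 (X (R := ℂ) (Sum.inr j : Fin n ⊕ Fin n)) :=
  ⟨isWeightedHomogeneous_X _ _ _, isWeightedHomogeneous_X _ _ _⟩

lemma isBihom_normSqPoly : IsBihom 1 1 (normSqPoly n) :=
  IsBihom.sum _ _ fun j _ => (isBihom_X_inl j).mul (isBihom_X_inr j)

lemma IsBihom.pderiv_inl (hp : IsBihom (a + 1) b p) (j : Fin n) :
    IsBihom a b (pderiv (Sum.inl j) p) := ⟨hp.left.pderiv rfl, hp.right.pderiv rfl⟩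

lemma IsBihom.pderiv_inr (hp : IsBihom a (b + 1) p) (j : Fin n) :
    IsBihom a b (pderiv (Sum.inr j) p) := ⟨hp.left.pderiv rfl, hp.right.pderiv rfl⟩

lemma pderiv_eq_zero_of_weight_zero {σ : Type*} {w : σ → ℕ} {p : MvPolynomial σ ℂ} {i : σ}
    (hi : w i = 1) (hp : IsWeightedHomogeneous w p 0) : pderiv i p = 0 := by
  apply pderiv_eq_zero_of_notMem_vars
  intro h
  obtain ⟨d, hd, hdi⟩ := (mem_vars_iff_mem_support i).1 h
  have h1 := hp (mem_support_iff.1 hd)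
  have h2 : d i * w i ≤ Finsupp.weight w d := by
    rw [Finsupp.weight_apply]
    exact Finset.single_le_sum (f := fun i => d i • w i) (fun _ _ => Nat.zero_le _) hdi
  rw [h1, hi] at h2
  exact (Finsupp.mem_support_iff.1 hdi) (by omega)

lemma IsBihom.pderiv_inl_eq_zero (hp : IsBihom 0 b p) (j : Fin n) : pderiv (Sum.inl j) p = 0 :=
  pderiv_eq_zero_of_weight_zero rfl hp.left

lemma IsBihom.pderiv_inr_eq_zero (hp : IsBihom a 0 p) (j : Fin n) : pderiv (Sum.inr j) p = 0 :=
  pderiv_eq_zero_of_weight_zero rfl hp.right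

lemma IsBihom.euler_left (hp : IsBihom a b p) :
    ∑ j, X (Sum.inl j) * pderiv (Sum.inl j) p = (a : ℂ) • p := by
  have := hp.left.sum_weight_X_mul_pderiv
  simpa [Fintype.sum_sum_type, leftWeight, ← Nat.cast_smul_eq_nsmul ℂ] using this

lemma IsBihom.euler_right (hp : IsBihom a b p) :
    ∑ j, X (Sum.inr j) * pderiv (Sum.inr j) p = (b : ℂ) • p := by
  have := hp.right.sum_weight_X_mul_pderiv
  simpa [Fintype.sum_sum_type, rightWeight, ← Nat.cast_smul_eq_nsmul ℂ] using this

lemma IsBihom.support (hp : IsBihom a b p) {d : Fin n ⊕ Fin n →₀ ℕ} (hd : d ∈ p.support) :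
    ∑ j, d (Sum.inl j) = a ∧ ∑ j, d (Sum.inr j) = b := by
  have h1 := hp.left (mem_support_iff.1 hd)
  have h2 := hp.right (mem_support_iff.1 hd)
  rw [Finsupp.weight_apply, Finsupp.sum_fintype _ _ (by simp)] at h1 h2
  simpa [Fintype.sum_sum_type, leftWeight, rightWeight] using And.intro h1 h2

lemma evalBi_monomial (d : Fin n ⊕ Fin n →₀ ℕ) (c : ℂ) (u : Cn n) :
    evalBi (monomial d c) u = c * ((∏ j, u j ^ d (Sum.inl j)) *
      ∏ j, (starRingEnd ℂ) (u j) ^ d (Sum.inr j)) := by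
  rw [evalBi, eval_monomial, Finsupp.prod_fintype _ _ (by simp), Fintype.prod_sum_type]
  simp

lemma evalBi_eq_sum (p : MvPolynomial (Fin n ⊕ Fin n) ℂ) (u : Cn n) :
    evalBi p u = ∑ d ∈ p.support, coeff d p * ((∏ j, u j ^ d (Sum.inl j)) *
      ∏ j, (starRingEnd ℂ) (u j) ^ d (Sum.inr j)) := by
  conv_lhs => rw [p.as_sum, evalBi_sum]
  simp only [evalBi_monomial]

lemma IsBihom.eval_smul (hp : IsBihom a b p) (t : ℝ) (u : Cn n) :
    evalBi p (t • u) = (t : ℂ) ^ (a + b) * evalBi p u := by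
  rw [evalBi_eq_sum, evalBi_eq_sum, Finset.mul_sum]
  refine Finset.sum_congr rfl fun d hd => ?_
  obtain ⟨h1, h2⟩ := hp.support hd
  simp only [PiLp.smul_apply, Complex.real_smul, map_mul, Complex.conj_ofReal, mul_pow,
    Finset.prod_mul_distrib, Finset.prod_pow_eq_pow_sum, h1, h2, pow_add]
  ring

lemma polyLap_add (p q : MvPolynomial (Fin n ⊕ Fin n) ℂ) :
    polyLap (p + q) = polyLap p + polyLap q := by
  simp [polyLap, Finset.sum_add_distrib]

lemma polyLap_smul (c : ℂ) (p : MvPolynomial (Fin n ⊕ Fin n) ℂ) :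
    polyLap (c • p) = c • polyLap p := by
  simp [polyLap, Finset.smul_sum, Derivation.map_smul]

lemma polyLap_pderiv (i : Fin n ⊕ Fin n) (p : MvPolynomial (Fin n ⊕ Fin n) ℂ) :
    polyLap (pderiv i p) = pderiv i (polyLap p) := by
  simp only [polyLap, map_sum]
  refine Finset.sum_congr rfl fun j _ => ?_
  rw [pderiv_pderiv_comm (Sum.inr j) i, pderiv_pderiv_comm (Sum.inl j) i]

lemma polyLap_X_inr_mul (j : Fin n) (p : MvPolynomial (Fin n ⊕ Fin n) ℂ) :
    polyLap (X (Sum.inr j) * p) = pderiv (Sum.inl j) p + X (Sum.inr j) * polyLap p := by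
  classical
  have : ∀ i, pderiv (Sum.inl i) (pderiv (Sum.inr i) (X (Sum.inr j) * p)) =
      (if i = j then pderiv (Sum.inl j) p else 0) +
        X (Sum.inr j) * pderiv (Sum.inl i) (pderiv (Sum.inr i) p) := by
    intro i
    by_cases h : i = j
    · subst h; simp [Derivation.leibniz, pderiv_X]; ring
    · simp [Derivation.leibniz, pderiv_X, h, Ne.symm h]
  simp only [polyLap, this, Finset.sum_add_distrib, Finset.mul_sum]
  simp

lemma polyLap_X_inl_mul (j : Fin n) (p : MvPolynomial (Fin n ⊕ Fin n) ℂ) :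
    polyLap (X (Sum.inl j) * p) = pderiv (Sum.inr j) p + X (Sum.inl j) * polyLap p := by
  classical
  have : ∀ i, pderiv (Sum.inl i) (pderiv (Sum.inr i) (X (Sum.inl j) * p)) =
      (if i = j then pderiv (Sum.inr j) p else 0) +
        X (Sum.inl j) * pderiv (Sum.inl i) (pderiv (Sum.inr i) p) := by
    intro i
    by_cases h : i = j
    · subst h; simp [Derivation.leibniz, pderiv_X]; ring
    · simp [Derivation.leibniz, pderiv_X, h, Ne.symm h]
  simp only [polyLap, this, Finset.sum_add_distrib, Finset.mul_sum]
  simp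

lemma pderiv_inl_normSqPoly (j : Fin n) : pderiv (Sum.inl j) (normSqPoly n) = X (Sum.inr j) := by
  classical
  rw [normSqPoly, map_sum, Finset.sum_eq_single j]
  · simp [Derivation.leibniz, pderiv_X]
  · intro i _ hi
    simp [Derivation.leibniz, pderiv_X, hi]
  · simp

lemma pderiv_inr_normSqPoly (j : Fin n) : pderiv (Sum.inr j) (normSqPoly n) = X (Sum.inl j) := by
  classical
  rw [normSqPoly, map_sum, Finset.sum_eq_single j]
  · simp [Derivation.leibniz, pderiv_X]
  · intro i _ hi
    simp [Derivation.leibniz, pderiv_X, hi]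
  · simp

/-- By Leibniz, differentiating `|z|²` twice contributes `n`, and the cross terms are the two Euler
operators, contributing `a` and `b`. -/
lemma IsBihom.polyLap_normSqPoly_mul (hp : IsBihom a b p) :
    polyLap (normSqPoly n * p) = ((n + a + b : ℕ) : ℂ) • p + normSqPoly n * polyLap p := by
  classical
  have : ∀ j, pderiv (Sum.inl j) (pderiv (Sum.inr j) (normSqPoly n * p)) =
      p + X (Sum.inl j) * pderiv (Sum.inl j) p + X (Sum.inr j) * pderiv (Sum.inr j) p +
        normSqPoly n * pderiv (Sum.inl j) (pderiv (Sum.inr j) p) := by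
    intro j
    simp only [Derivation.leibniz, pderiv_inl_normSqPoly, pderiv_inr_normSqPoly, map_add,
      smul_eq_mul, pderiv_X_self]
    ring
  simp only [polyLap, this, Finset.sum_add_distrib, Finset.mul_sum, hp.euler_left, hp.euler_right]
  simp [← Nat.cast_smul_eq_nsmul ℂ, add_smul]

lemma IsHarm.pderiv_inl (hp : IsHarm (a + 1) b p) (j : Fin n) :
    IsHarm a b (pderiv (Sum.inl j) p) :=
  ⟨hp.toIsBihom.pderiv_inl j, by rw [polyLap_pderiv, hp.lap, map_zero]⟩

lemma IsHarm.pderiv_inr (hp : IsHarm a (b + 1) p) (j : Fin n) :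
    IsHarm a b (pderiv (Sum.inr j) p) :=
  ⟨hp.toIsBihom.pderiv_inr j, by rw [polyLap_pderiv, hp.lap, map_zero]⟩

/-- The Laplacian of `z̄_j p` is `∂_j p`, and that of `|z|² ∂_j p` is `(n+a+b) ∂_j p` because `∂_j
p` is harmonic of bidegree `(a, b)`. The correction term thus restores harmonicity. -/
lemma IsHarm.raise_right (hp : IsHarm (a + 1) b p) (hn : n + a + b ≠ 0) (j : Fin n) :
    IsHarm (a + 1) (b + 1) (X (Sum.inr j) * p +
      (-((n + a + b : ℕ) : ℂ)⁻¹) • (normSqPoly n * pderiv (Sum.inl j) p)) := by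
  have hn' : ((n + a + b : ℕ) : ℂ) ≠ 0 := Nat.cast_ne_zero.2 hn
  refine ⟨?_, ?_⟩
  · have h1 := (isBihom_X_inr j).mul hp.toIsBihom
    have h2 := (isBihom_normSqPoly (n := n)).mul (hp.toIsBihom.pderiv_inl j)
    rw [zero_add, add_comm 1] at h1
    rw [add_comm 1, add_comm 1] at h2
    exact h1.add (h2.smul _)
  · rw [polyLap_add, polyLap_smul, polyLap_X_inr_mul,
      (hp.toIsBihom.pderiv_inl j).polyLap_normSqPoly_mul, (hp.pderiv_inl j).lap, hp.lap]
    simp only [mul_zero, add_zero, smul_smul, neg_mul, inv_mul_cancel₀ hn']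
    simp

lemma IsHarm.raise_left (hp : IsHarm (a + 1) b p) (hn : n + a + b ≠ 0) (j : Fin n) :
    IsHarm (a + 2) b (X (Sum.inl j) * p +
      (-((n + a + b : ℕ) : ℂ)⁻¹) • (normSqPoly n * pderiv (Sum.inr j) p)) := by
  have hn' : ((n + a + b : ℕ) : ℂ) ≠ 0 := Nat.cast_ne_zero.2 hn
  have h1 := (isBihom_X_inl j).mul hp.toIsBihom
  rw [zero_add, add_comm 1] at h1
  rcases b with _ | b
  -- For `b = 0` there is no `z̄`, so `z_j p` is already harmonic and the correction is zero.
  · rw [hp.toIsBihom.pderiv_inr_eq_zero, mul_zero, smul_zero, add_zero]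
    exact ⟨h1, by rw [polyLap_X_inl_mul, hp.toIsBihom.pderiv_inr_eq_zero, hp.lap]; simp⟩
  refine ⟨?_, ?_⟩
  · have h2 := (isBihom_normSqPoly (n := n)).mul (hp.toIsBihom.pderiv_inr j)
    rw [add_comm 1, add_comm 1] at h2
    exact h1.add (h2.smul _)
  · rw [polyLap_add, polyLap_smul, polyLap_X_inl_mul,
      (hp.toIsBihom.pderiv_inr j).polyLap_normSqPoly_mul, (hp.pderiv_inr j).lap, hp.lap]
    simp only [mul_zero, add_zero, smul_smul, neg_mul]
    rw [show n + (a + 1) + b = n + a + (b + 1) by ring, inv_mul_cancel₀ hn']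
    simp

lemma IsBihom.mem_bigradedPoly (hp : IsBihom a b p) : evalBi p ∈ bigradedPoly n a b := by
  have : evalBi p = ∑ d ∈ p.support, coeff d p • fun u : Cn n => (∏ j, u j ^ d (Sum.inl j)) *
      ∏ j, (starRingEnd ℂ) (u j) ^ d (Sum.inr j) := by
    ext u
    rw [evalBi_eq_sum]
    simp
  rw [this]
  exact Submodule.sum_mem _ fun d hd => Submodule.smul_mem _ _ (Submodule.subset_span
    ⟨fun j => d (Sum.inl j), fun j => d (Sum.inr j), (hp.support hd).1, (hp.support hd).2, rfl⟩)

lemma exists_isBihom_of_mem_bigradedPoly {P : Cn n → ℂ} (hP : P ∈ bigradedPoly n a b) :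
    ∃ p, IsBihom a b p ∧ evalBi p = P := by
  induction hP using Submodule.span_induction with
  | mem P h =>
    obtain ⟨α, β, hα, hβ, rfl⟩ := h
    refine ⟨monomial (Finsupp.equivFunOnFinite.symm (Sum.elim α β)) 1, ⟨?_, ?_⟩, ?_⟩
    · apply isWeightedHomogeneous_monomial
      rw [Finsupp.weight_apply, Finsupp.sum_fintype _ _ (by simp)]
      simpa [Fintype.sum_sum_type, leftWeight] using hα
    · apply isWeightedHomogeneous_monomial
      rw [Finsupp.weight_apply, Finsupp.sum_fintype _ _ (by simp)]
      simpa [Fintype.sum_sum_type, rightWeight] using hβ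
    · ext u
      rw [evalBi_monomial]
      simp
  | zero => exact ⟨0, isBihom_zero, by ext; simp⟩
  | add P Q _ _ hP hQ =>
    obtain ⟨p, hp, rfl⟩ := hP
    obtain ⟨q, hq, rfl⟩ := hQ
    exact ⟨p + q, hp.add hq, by ext u; simp [evalBi_add]⟩
  | smul c P _ hP =>
    obtain ⟨p, hp, rfl⟩ := hP
    exact ⟨c • p, hp.smul c, by ext u; simp [evalBi_smul]⟩

lemma mem_solidHarmonics_iff {P : Cn n → ℂ} :
    P ∈ solidHarmonics n a b ↔ ∃ p, IsHarm a b p ∧ evalBi p = P := by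
  constructor
  · rintro ⟨h1, h2⟩
    obtain ⟨p, hp, rfl⟩ := exists_isBihom_of_mem_bigradedPoly h1
    refine ⟨p, ⟨hp, evalBi_inj ?_⟩, rfl⟩
    ext u
    have := h2 u
    rw [laplacian_evalBi] at this
    simpa using this
  · rintro ⟨p, hp, rfl⟩
    exact ⟨hp.toIsBihom.mem_bigradedPoly, fun u => by rw [laplacian_evalBi, hp.lap]; simp⟩

lemma conj_mem_bigradedPoly {P : Cn n → ℂ} (hP : P ∈ bigradedPoly n a b) :
    (fun u => (starRingEnd ℂ) (P u)) ∈ bigradedPoly n b a := by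
  induction hP using Submodule.span_induction with
  | mem P h =>
    obtain ⟨α, β, hα, hβ, rfl⟩ := h
    refine Submodule.subset_span ⟨β, α, hβ, hα, ?_⟩
    ext u
    simp [mul_comm]
  | zero =>
    convert Submodule.zero_mem (bigradedPoly n b a) using 1
    ext u; simp
  | add P Q _ _ hP hQ =>
    convert Submodule.add_mem _ hP hQ using 1
    ext u; simp
  | smul c P _ hP =>
    convert Submodule.smul_mem _ ((starRingEnd ℂ) c) hP using 1
    ext u; simp

lemma conj_mem_solidHarmonics {P : Cn n → ℂ} (hP : P ∈ solidHarmonics n a b) :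
    (fun u => (starRingEnd ℂ) (P u)) ∈ solidHarmonics n b a := by
  refine ⟨conj_mem_bigradedPoly hP.1, fun u => ?_⟩
  · have h := (contDiff_of_mem_bigradedPoly hP.1).contDiffAt (x := u)
    have h2 := h.laplacian_CLM_comp_left (l := (Complex.conjCLE : ℂ →L[ℝ] ℂ))
    have h3 : ((Complex.conjCLE : ℂ →L[ℝ] ℂ) ∘ P) = fun u => (starRingEnd ℂ) (P u) := rfl
    rw [h3] at h2
    rw [h2, Function.comp_apply, hP.2 u, map_zero]

/-- This symmetry transfers every result on the first index of the bidegree to the second. -/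
lemma IsHarm.exists_conj (hp : IsHarm a b p) :
    ∃ q, IsHarm b a q ∧ ∀ u, evalBi q u = (starRingEnd ℂ) (evalBi p u) := by
  obtain ⟨q, hq, h⟩ := mem_solidHarmonics_iff.1
    (conj_mem_solidHarmonics (mem_solidHarmonics_iff.2 ⟨p, hp, rfl⟩))
  exact ⟨q, hq, fun u => congrFun h u⟩

end bihom

/-! ### Integration over spheres and in polar coordinates -/

section measure

variable {n : ℕ}

lemma finrank_real_Cn (n : ℕ) : Module.finrank ℝ (Cn n) = 2 * n := by
  rw [← Module.finrank_mul_finrank ℝ ℂ (Cn n)]; simp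

lemma nontrivial_Cn (hn : 1 ≤ n) : Nontrivial (Cn n) := by
  have : NeZero n := ⟨by omega⟩
  infer_instance

/-- The area of the unit sphere of `ℂⁿ`. -/
noncomputable def sphereArea (n : ℕ) : ℝ := ((volume : Measure (Cn n)).toSphere Set.univ).toReal

lemma sphereArea_pos (hn : 1 ≤ n) : 0 < sphereArea n := by
  have := nontrivial_Cn hn
  refine ENNReal.toReal_pos ?_ (measure_ne_top _ _)
  rw [Ne, Measure.measure_univ_eq_zero]
  exact Measure.toSphere_ne_zero _

lemma isProbabilityMeasure_unitSphereMeasure (hn : 1 ≤ n) :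
    IsProbabilityMeasure (unitSphereMeasure n) := by
  have := nontrivial_Cn hn
  have : NeZero (volume : Measure (Cn n)).toSphere := ⟨Measure.toSphere_ne_zero _⟩
  exact isProbabilityMeasureSMul

instance : IsFiniteMeasure (unitSphereMeasure n) := by
  rcases Nat.eq_zero_or_pos n with rfl | hn
  · have h : ((volume : Measure (Cn 0)).toSphere) = 0 := by
      rw [Measure.toSphere_eq_zero_iff]; infer_instance
    rw [unitSphereMeasure, h, smul_zero]
    infer_instance
  · have := isProbabilityMeasure_unitSphereMeasure hn
    infer_instance

instance : (unitSphereMeasure n).IsOpenPosMeasure := by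
  refine ⟨fun U hU hne h => ?_⟩
  rw [unitSphereMeasure, Measure.smul_apply, smul_eq_mul, mul_eq_zero] at h
  rcases h with h | h
  · exact measure_ne_top _ _ (ENNReal.inv_eq_zero.1 h)
  · exact hU.measure_ne_zero _ hne h

lemma toSphere_eq_smul (hn : 1 ≤ n) : (volume : Measure (Cn n)).toSphere =
    (volume : Measure (Cn n)).toSphere Set.univ • unitSphereMeasure n := by
  have := nontrivial_Cn hn
  rw [unitSphereMeasure, smul_smul, ENNReal.mul_inv_cancel, one_smul]
  · rw [Ne, Measure.measure_univ_eq_zero]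
    exact Measure.toSphere_ne_zero _
  · exact measure_ne_top _ _

lemma integral_toSphere (hn : 1 ≤ n) (F : Metric.sphere (0 : Cn n) 1 → ℂ) :
    ∫ ω, F ω ∂(volume : Measure (Cn n)).toSphere =
      sphereArea n • ∫ ω, F ω ∂(unitSphereMeasure n) := by
  rw [toSphere_eq_smul hn, integral_smul_measure]
  rfl

/-- Integration in polar coordinates on `ℂⁿ`. -/
lemma integral_polar (hn : 1 ≤ n) {F : Cn n → ℂ} (hF : Integrable F) :
    ∫ u, F u = sphereArea n • ∫ ρ in Set.Ioi (0 : ℝ), ρ ^ (2 * n - 1) •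
      ∫ ω, F (ρ • (ω : Cn n)) ∂(unitSphereMeasure n) := by
  have := nontrivial_Cn hn
  have hmp := (volume : Measure (Cn n)).measurePreserving_homeomorphUnitSphereProd
  have hemb := (homeomorphUnitSphereProd (Cn n)).measurableEmbedding
  let G : Metric.sphere (0 : Cn n) 1 × Set.Ioi (0 : ℝ) → ℂ := fun x => F ((x.2 : ℝ) • (x.1 : Cn n))
  have hG : ∀ x : ({(0 : Cn n)}ᶜ : Set (Cn n)), G (homeomorphUnitSphereProd (Cn n) x) = F x := by
    intro x
    simp only [G]
    congr 1
    have hx : ‖(x : Cn n)‖ ≠ 0 := norm_ne_zero_iff.2 x.2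
    simp [smul_smul, hx]
  have hint : Integrable G ((volume : Measure (Cn n)).toSphere.prod
      (Measure.volumeIoiPow (Module.finrank ℝ (Cn n) - 1))) := by
    rw [← hmp.integrable_comp_emb hemb]
    have : (G ∘ homeomorphUnitSphereProd (Cn n)) = F ∘ Subtype.val := by
      ext x; exact hG x
    rw [this, ← integrableOn_iff_comap_subtypeVal (measurableSet_singleton _).compl]
    exact hF.integrableOn
  calc ∫ u, F u = ∫ x : ({(0 : Cn n)}ᶜ : Set (Cn n)), F x ∂(Measure.comap Subtype.val volume) := by
        rw [integral_subtype_comap (measurableSet_singleton _).compl F, restrict_compl_singleton]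
    _ = ∫ x, G x ∂((volume : Measure (Cn n)).toSphere.prod
        (Measure.volumeIoiPow (Module.finrank ℝ (Cn n) - 1))) := by
        rw [← hmp.integral_comp hemb]
        simp only [hG]
    _ = ∫ ρ, (∫ ω, G (ω, ρ) ∂(volume : Measure (Cn n)).toSphere)
          ∂(Measure.volumeIoiPow (Module.finrank ℝ (Cn n) - 1)) := integral_prod_symm _ hint
    _ = _ := by
        simp only [integral_toSphere hn, G]
        rw [integral_smul, finrank_real_Cn]
        congr 1
        simp only [Measure.volumeIoiPow, ENNReal.ofReal]
        rw [integral_withDensity_eq_integral_smul,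
          integral_subtype_comap measurableSet_Ioi fun a : ℝ => Real.toNNReal (a ^ (2 * n - 1)) •
            ∫ ω, F (a • (ω : Cn n)) ∂(unitSphereMeasure n)]
        · refine setIntegral_congr_fun measurableSet_Ioi fun x hx => ?_
          rw [NNReal.smul_def, Real.coe_toNNReal _ (pow_nonneg (le_of_lt hx) _)]
        · exact (measurable_subtype_coe.pow_const _).real_toNNReal

/-- Up to a constant, the measure of a set on the sphere is the volume of the cone over it, and
volume is invariant under `u ↦ -u`. -/
lemma map_neg_unitSphereMeasure :
    (unitSphereMeasure n).map (fun ω => -ω) = unitSphereMeasure n := by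
  have hmeas : Measurable fun ω : Metric.sphere (0 : Cn n) 1 => -ω :=
    continuous_neg.measurable
  rw [unitSphereMeasure, Measure.map_smul]
  congr 1
  ext s hs
  rw [Measure.map_apply hmeas hs, Measure.toSphere_apply' _ (hmeas hs),
    Measure.toSphere_apply' _ hs]
  congr 1
  rw [← Measure.measure_preimage_neg (volume : Measure (Cn n))]
  congr 1
  ext u
  simp only [Set.mem_smul, Set.mem_preimage, Set.mem_image]
  constructor
  · rintro ⟨t, ht, _, ⟨ω, hω, rfl⟩, h⟩
    exact ⟨t, ht, _, ⟨-ω, hω, rfl⟩, by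
      rw [coe_neg_sphere, smul_neg, h, neg_neg]⟩
  · rintro ⟨t, ht, _, ⟨ω, hω, rfl⟩, h⟩
    refine ⟨t, ht, _, ⟨-ω, ?_, rfl⟩, ?_⟩
    · simpa using hω
    · simp [h]

lemma integral_neg_sphere (F : Metric.sphere (0 : Cn n) 1 → ℂ) :
    ∫ ω, F (-ω) ∂(unitSphereMeasure n) = ∫ ω, F ω ∂(unitSphereMeasure n) := by
  conv_rhs => rw [← map_neg_unitSphereMeasure]
  exact ((Homeomorph.neg (Metric.sphere (0 : Cn n) 1)).measurableEmbedding.integral_map _).symm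

lemma integrable_sphere {F : Metric.sphere (0 : Cn n) 1 → ℂ} (hF : Continuous F) :
    Integrable F (unitSphereMeasure n) := by
  simpa using hF.continuousOn.integrableOn_compact (μ := unitSphereMeasure n) isCompact_univ

lemma continuous_integral_sphere {X : Type*} [TopologicalSpace X] [FirstCountableTopology X]
    [LocallyCompactSpace X] {F : X → Metric.sphere (0 : Cn n) 1 → ℂ}
    (hF : Continuous (Function.uncurry F)) :
    Continuous fun x => ∫ ω, F x ω ∂(unitSphereMeasure n) := by
  simpa using continuous_parametric_integral_of_continuous (μ := unitSphereMeasure n) hF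
    isCompact_univ

/-- Compactness of the parameter space bounds `F'` by a constant near `x`, which serves as the
dominating function. It is applied with a real radius and with the complex variable `τ`. -/
lemma hasDerivAt_integral_of_compact {𝕜 α : Type*} [RCLike 𝕜] [NormedSpace 𝕜 ℂ] [TopologicalSpace α]
    [CompactSpace α] [T2Space α] [MeasurableSpace α] [OpensMeasurableSpace α] (ν : Measure α)
    [IsFiniteMeasure ν] {U : Set 𝕜} (hU : IsOpen U) {F F' : 𝕜 → α → ℂ}
    (hF : ∀ x ∈ U, Continuous (F x)) (hF' : ContinuousOn (Function.uncurry F') (U ×ˢ Set.univ))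
    (hd : ∀ x ∈ U, ∀ a, HasDerivAt (fun x => F x a) (F' x a) x) {x : 𝕜} (hx : x ∈ U) :
    HasDerivAt (fun x => ∫ a, F x a ∂ν) (∫ a, F' x a ∂ν) x := by
  obtain ⟨δ, hδ, hδU⟩ := Metric.nhds_basis_closedBall.mem_iff.1 (hU.mem_nhds hx)
  have hK : IsCompact (Metric.closedBall x δ ×ˢ (Set.univ : Set α)) :=
    (isCompact_closedBall x δ).prod isCompact_univ
  obtain ⟨C, hC⟩ := hK.exists_bound_of_continuousOn
    (hF'.mono (Set.prod_mono hδU le_rfl))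
  have hc : ∀ y ∈ U, Continuous (F' y) := fun y hy => by
    have : ContinuousOn (fun a => (y, a)) (Set.univ : Set α) := by fun_prop
    have h2 := hF'.comp this (fun a _ => ⟨hy, trivial⟩)
    rwa [continuousOn_univ] at h2
  refine (hasDerivAt_integral_of_dominated_loc_of_deriv_le (F := F) (F' := F')
    (bound := fun _ => C) (Metric.closedBall_mem_nhds x hδ) ?_ ?_ ?_ ?_ ?_ ?_).2
  · filter_upwards [hU.mem_nhds hx] with y hy
    exact (hF y hy).aestronglyMeasurable
  · simpa using (hF x hx).continuousOn.integrableOn_compact (μ := ν) isCompact_univ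
  · exact (hc x hx).aestronglyMeasurable
  · exact Filter.Eventually.of_forall fun a y hy => hC (y, a) ⟨hy, trivial⟩
  · exact integrable_const C
  · exact Filter.Eventually.of_forall fun a y hy => hd y (hδU hy) a

end measure

/-! ### The divergence theorem on centred spheres -/

section divergence

variable {n : ℕ}

lemma hasFDerivAt_norm_Cn {u : Cn n} (hu : u ≠ 0) :
    HasFDerivAt (fun u : Cn n => ‖u‖) (‖u‖⁻¹ • innerSL ℝ u) u := by
  have h := ((hasStrictFDerivAt_norm_sq u).hasFDerivAt).sqrt
    (pow_ne_zero 2 (norm_ne_zero_iff.2 hu))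
  simp only [Real.sqrt_sq (norm_nonneg _)] at h
  refine h.congr_fderiv ?_
  rw [← Nat.cast_smul_eq_nsmul ℝ, smul_smul]
  congr 1
  push_cast
  have := norm_ne_zero_iff.2 hu
  field_simp

/-- The norm fails to be differentiable only at the origin, where `ψ ‖u‖` is locally zero. -/
lemma contDiff_norm_smul {ψ : ℝ → ℝ} (hψ : ContDiff ℝ 1 ψ) (h0 : (0 : ℝ) ∉ tsupport ψ)
    {F : Cn n → ℂ} (hF : ContDiff ℝ 1 F) : ContDiff ℝ 1 fun u : Cn n => ψ ‖u‖ • F u := by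
  rw [contDiff_iff_contDiffAt]
  intro u
  by_cases hu : u = 0
  · have h1 : ∀ᶠ t in nhds ‖u‖, ψ t = 0 := by
      rw [hu, norm_zero]
      filter_upwards [(isClosed_tsupport ψ).isOpen_compl.mem_nhds h0] with t ht
      exact image_eq_zero_of_notMem_tsupport ht
    have h2 : (fun u : Cn n => ψ ‖u‖ • F u) =ᶠ[nhds u] fun _ => 0 := by
      filter_upwards [continuous_norm.continuousAt.eventually h1] with v hv
      rw [hv, zero_smul]
    exact contDiffAt_const.congr_of_eventuallyEq h2
  · exact (hψ.contDiffAt.comp u (contDiffAt_norm ℝ hu)).smul hF.contDiffAt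

lemma hasCompactSupport_norm_smul {ψ : ℝ → ℝ} (hψ : HasCompactSupport ψ) (F : Cn n → ℂ) :
    HasCompactSupport fun u : Cn n => ψ ‖u‖ • F u := by
  obtain ⟨C, hC⟩ := hψ.isCompact.isBounded.subset_closedBall 0
  refine HasCompactSupport.of_support_subset_isCompact (isCompact_closedBall (0 : Cn n) C) ?_
  intro u hu
  have : ψ ‖u‖ ≠ 0 := fun h => hu (by simp [h])
  simpa using hC (subset_tsupport _ this)

lemma integral_fderiv_eq_zero {F : Cn n → ℂ} (hF : ContDiff ℝ 1 F) (hc : HasCompactSupport F)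
    (v : Cn n) : ∫ u, fderiv ℝ F u v = 0 := by
  have hd : Continuous fun u => fderiv ℝ F u v :=
    (hF.continuous_fderiv (by simp)).clm_apply continuous_const
  have hdc : HasCompactSupport fun u => fderiv ℝ F u v := hc.fderiv_apply (𝕜 := ℝ) v
  have := integral_mul_fderiv_eq_neg_fderiv_mul_of_integrable (μ := (volume : Measure (Cn n)))
    (f := fun _ => (1 : ℂ)) (g := F) (v := v) (by simp)
    (by simpa using hd.integrable_of_hasCompactSupport hdc)
    (by simpa using hF.continuous.integrable_of_hasCompactSupport hc)
    (fun _ _ => differentiableAt_const _)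
    (fun x _ => hF.differentiable (by simp) x)
  simpa using this

lemma continuous_smul_sphere :
    Continuous fun x : ℝ × Metric.sphere (0 : Cn n) 1 => x.1 • (x.2 : Cn n) := by fun_prop

lemma hasDerivAt_sphere_integral {F : Cn n → ℂ} (hF : ContDiff ℝ 1 F)
    {g : Metric.sphere (0 : Cn n) 1 → ℂ} (hg : Continuous g) (ρ : ℝ) :
    HasDerivAt (fun ρ : ℝ => ∫ ω, F (ρ • (ω : Cn n)) * g ω ∂(unitSphereMeasure n))
      (∫ ω, fderiv ℝ F (ρ • (ω : Cn n)) ω * g ω ∂(unitSphereMeasure n)) ρ := by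
  have hF' := hF.continuous_fderiv (by simp)
  refine hasDerivAt_integral_of_compact (unitSphereMeasure n) isOpen_univ
    (F := fun ρ ω => F (ρ • (ω : Cn n)) * g ω)
    (F' := fun ρ ω => fderiv ℝ F (ρ • (ω : Cn n)) ω * g ω) ?_ ?_ ?_ (Set.mem_univ ρ)
  · intro x _
    have := hF.continuous
    fun_prop
  · apply Continuous.continuousOn
    have h1 := hF'.comp (continuous_smul_sphere (n := n))
    exact (h1.clm_apply (by fun_prop)).mul (by fun_prop)
  · intro x _ ω
    have h1 : HasDerivAt (fun ρ : ℝ => ρ • (ω : Cn n)) (ω : Cn n) x := by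
      simpa using (hasDerivAt_id x).smul_const (ω : Cn n)
    exact ((hF.differentiable (by simp) _).hasFDerivAt.comp_hasDerivAt x h1).mul_const (g ω)

/-- The divergence theorem on spheres centred at the origin, in differentiated form. -/
lemma hasDerivAt_sphere_flux (hn : 1 ≤ n) {F : Cn n → ℂ} (hF : ContDiff ℝ 1 F) (v : Cn n)
    {ρ : ℝ} (hρ : 0 < ρ) :
    HasDerivAt (fun ρ : ℝ => ρ ^ (2 * n - 1) •
        ∫ ω, F (ρ • (ω : Cn n)) * (inner ℝ (ω : Cn n) v : ℝ) ∂(unitSphereMeasure n))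
      (ρ ^ (2 * n - 1) • ∫ ω, fderiv ℝ F (ρ • (ω : Cn n)) v ∂(unitSphereMeasure n)) ρ := by
  have hF' := hF.continuous_fderiv (by simp)
  have hg : Continuous fun ω : Metric.sphere (0 : Cn n) 1 => ((inner ℝ (ω : Cn n) v : ℝ) : ℂ) := by
    fun_prop
  set A : ℝ → ℂ := fun ρ => ρ ^ (2 * n - 1) •
    ∫ ω, F (ρ • (ω : Cn n)) * (inner ℝ (ω : Cn n) v : ℝ) ∂(unitSphereMeasure n) with hA
  set B : ℝ → ℂ := fun ρ => ρ ^ (2 * n - 1) •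
    ∫ ω, fderiv ℝ F (ρ • (ω : Cn n)) v ∂(unitSphereMeasure n) with hB
  -- `A'` is the derivative of the flux `A` by the product rule. It is continuous, so `A' = B` may
  -- be proved in the weak sense.
  set A' : ℝ → ℂ := fun ρ => ρ ^ (2 * n - 1) •
      (∫ ω, fderiv ℝ F (ρ • (ω : Cn n)) ω * (inner ℝ (ω : Cn n) v : ℝ) ∂(unitSphereMeasure n)) +
    (((2 * n - 1 : ℕ) : ℝ) * ρ ^ (2 * n - 1 - 1)) •
      ∫ ω, F (ρ • (ω : Cn n)) * (inner ℝ (ω : Cn n) v : ℝ) ∂(unitSphereMeasure n) with hA'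
  have hdA : ∀ ρ, HasDerivAt A (A' ρ) ρ := fun ρ =>
    (hasDerivAt_pow (2 * n - 1) ρ).smul (hasDerivAt_sphere_integral hF hg ρ)
  have hBc : Continuous B := by
    refine (continuous_pow _).smul (continuous_integral_sphere ?_)
    exact (hF'.comp continuous_smul_sphere).clm_apply continuous_const
  have hAc : Continuous A := continuous_iff_continuousAt.2 fun ρ => (hdA ρ).continuousAt
  have hA'c : Continuous A' := by
    refine ((continuous_pow _).smul (continuous_integral_sphere ?_)).add
      ((continuous_const.mul (continuous_pow _)).smul (continuous_integral_sphere ?_))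
    · exact ((hF'.comp continuous_smul_sphere).clm_apply (by fun_prop)).mul (by fun_prop)
    · exact (hF.continuous.comp continuous_smul_sphere).mul (by fun_prop)
  -- The integral of `∂_v(ψ(|u|) F)` over `ℂⁿ` is zero. In polar coordinates this reads `∫ (ψ' A + ψ
  -- B) = 0`, and integrating by parts in the radius replaces `ψ' A` by `-ψ A'`.
  have key : ∀ ψ : ℝ → ℝ, ContDiff ℝ (⊤ : ℕ∞) ψ → HasCompactSupport ψ →
      tsupport ψ ⊆ Set.Ioi 0 → ∫ ρ, ψ ρ • (B ρ - A' ρ) = 0 := by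
    intro ψ hψ hψc hψs
    have hψ1 : ContDiff ℝ 1 ψ := hψ.of_le (by exact_mod_cast le_top)
    have h0 : (0 : ℝ) ∉ tsupport ψ := fun h => lt_irrefl (0 : ℝ) (hψs h)
    have hψd : Continuous (deriv ψ) := hψ1.continuous_deriv le_rfl
    have hΦ := contDiff_norm_smul hψ1 h0 hF
    have hΦc := hasCompactSupport_norm_smul hψc F
    have hcalc : ∀ ρ : ℝ, 0 < ρ → ∀ ω : Metric.sphere (0 : Cn n) 1,
        fderiv ℝ (fun u : Cn n => ψ ‖u‖ • F u) (ρ • (ω : Cn n)) v =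
        deriv ψ ρ • (F (ρ • (ω : Cn n)) * (inner ℝ (ω : Cn n) v : ℝ)) +
          ψ ρ • fderiv ℝ F (ρ • (ω : Cn n)) v := by
      intro ρ hρ ω
      have hω : ‖(ω : Cn n)‖ = 1 := by simp
      have hnorm : ‖ρ • (ω : Cn n)‖ = ρ := by rw [norm_smul, hω, mul_one, Real.norm_of_nonneg hρ.le]
      have hne : ρ • (ω : Cn n) ≠ 0 := by rw [← norm_ne_zero_iff, hnorm]; exact hρ.ne'
      have h1 : HasDerivAt ψ (deriv ψ ρ) ‖ρ • (ω : Cn n)‖ := by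
        rw [hnorm]; exact (hψ1.differentiable (by simp) ρ).hasDerivAt
      have h2 := (h1.comp_hasFDerivAt _ (hasFDerivAt_norm_Cn hne)).smul
        (hF.differentiable (by simp) (ρ • (ω : Cn n))).hasFDerivAt
      have h3 : HasFDerivAt (fun u : Cn n => ψ ‖u‖ • F u) _ (ρ • (ω : Cn n)) := h2
      rw [h3.fderiv]
      simp only [Function.comp_apply, hnorm, add_apply,
        smul_apply, ContinuousLinearMap.smulRight_apply, innerSL_apply_apply,
        smul_eq_mul, real_inner_smul_left, Complex.real_smul]
      push_cast
      have : (ρ : ℂ) ≠ 0 := Complex.ofReal_ne_zero.2 hρ.ne'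
      field_simp
      ring
    have hz := integral_fderiv_eq_zero hΦ hΦc v
    have hint : Integrable fun u => fderiv ℝ (fun u : Cn n => ψ ‖u‖ • F u) u v :=
      ((hΦ.continuous_fderiv (by simp)).clm_apply
        continuous_const).integrable_of_hasCompactSupport (hΦc.fderiv_apply (𝕜 := ℝ) v)
    rw [integral_polar hn hint, smul_eq_zero] at hz
    replace hz := hz.resolve_left (sphereArea_pos hn).ne'
    have hz2 : ∫ ρ in Set.Ioi (0 : ℝ), (deriv ψ ρ • A ρ + ψ ρ • B ρ) = 0 := by
      rw [← hz]
      refine setIntegral_congr_fun measurableSet_Ioi fun ρ hρ => ?_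
      simp only [hcalc ρ hρ]
      rw [integral_add, integral_smul, integral_smul, smul_add, hA, hB, smul_comm, smul_comm (ψ ρ)]
      · refine integrable_sphere ?_
        have := hF.continuous
        fun_prop
      · refine integrable_sphere ?_
        have h4 : Continuous fun ω : Metric.sphere (0 : Cn n) 1 =>
            fderiv ℝ F (ρ • (ω : Cn n)) v :=
          (hF'.comp (by fun_prop)).clm_apply continuous_const
        fun_prop
    rw [setIntegral_eq_integral_of_forall_compl_eq_zero] at hz2
    · have i1 : Integrable fun ρ => deriv ψ ρ • A ρ :=
        (hψd.smul hAc).integrable_of_hasCompactSupport (hψc.deriv.smul_right)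
      have i2 : Integrable fun ρ => ψ ρ • B ρ :=
        (hψ1.continuous.smul hBc).integrable_of_hasCompactSupport hψc.smul_right
      have i3 : Integrable fun ρ => ψ ρ • A' ρ :=
        (hψ1.continuous.smul hA'c).integrable_of_hasCompactSupport hψc.smul_right
      have i4 : Integrable fun ρ => ψ ρ • A ρ :=
        (hψ1.continuous.smul hAc).integrable_of_hasCompactSupport hψc.smul_right
      have hparts := integral_mul_deriv_eq_deriv_mul_of_integrable
        (u := fun ρ => (ψ ρ : ℂ)) (u' := fun ρ => ((deriv ψ ρ : ℝ) : ℂ)) (v := A) (v' := A')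
        (fun ρ _ => (hψ1.differentiable (by simp) ρ).hasDerivAt.ofReal_comp) (fun ρ _ => hdA ρ)
        (by simpa using! i3) (by simpa using! i1) (by simpa using! i4)
      simp only [← Complex.real_smul] at hparts
      rw [integral_add i1 i2] at hz2
      simp only [smul_sub]
      rw [integral_sub i2 i3, hparts]
      linear_combination hz2
    · intro ρ hρ
      have h1 : ρ ∉ tsupport ψ := fun h => hρ (hψs h)
      have h2 : deriv ψ ρ = 0 := by
        have : ρ ∉ tsupport (deriv ψ) := fun h => h1 (tsupport_deriv_subset h)
        exact image_eq_zero_of_notMem_tsupport this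
      rw [h2, image_eq_zero_of_notMem_tsupport h1, zero_smul, zero_smul, add_zero]
  have hae := isOpen_Ioi.ae_eq_zero_of_integral_contDiff_smul_eq_zero (μ := volume)
    (U := Set.Ioi (0 : ℝ)) ((hBc.sub hA'c).locallyIntegrable.locallyIntegrableOn _) key
  have heq : Set.EqOn (fun ρ => B ρ - A' ρ) (fun _ => 0) (Set.Ioi (0 : ℝ)) :=
    Measure.eqOn_open_of_ae_eq ((ae_restrict_iff' measurableSet_Ioi).2 hae) isOpen_Ioi
      (hBc.sub hA'c).continuousOn continuousOn_const
  have := heq hρ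
  change HasDerivAt A (B ρ) ρ
  rw [show B ρ = A' ρ from sub_eq_zero.1 this]
  exact hdA ρ

end divergence

/-! ### Wirtinger derivatives and orthogonality of harmonics -/

section wirtinger

variable {n : ℕ}

/-- The Wirtinger derivative `∂F/∂zⱼ`. -/
noncomputable def wirt (F : Cn n → ℂ) (j : Fin n) (u : Cn n) : ℂ :=
  1 / 2 * (fderiv ℝ F u (PiLp.single 2 j 1) - Complex.I * fderiv ℝ F u (PiLp.single 2 j Complex.I))

lemma wirt_evalBi (p : MvPolynomial (Fin n ⊕ Fin n) ℂ) (j : Fin n) (u : Cn n) :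
    wirt (evalBi p) j u = evalBi (MvPolynomial.pderiv (Sum.inl j) p) u := by
  simp only [wirt, fderiv_evalBi_single, evalBi_add, evalBi_smul, map_one, Complex.conj_I]
  linear_combination (-1 / 2 * evalBi (MvPolynomial.pderiv (Sum.inl j) p) u +
    1 / 2 * evalBi (MvPolynomial.pderiv (Sum.inr j) p) u) * Complex.I_mul_I

lemma hasFDerivAt_conj_evalBi (p : MvPolynomial (Fin n ⊕ Fin n) ℂ) (u : Cn n) :
    HasFDerivAt (fun u => (starRingEnd ℂ) (evalBi p u))
      ((Complex.conjCLE : ℂ →L[ℝ] ℂ).comp (fderiv ℝ (evalBi p) u)) u :=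
  (Complex.conjCLE : ℂ →L[ℝ] ℂ).hasFDerivAt.comp u (differentiable_evalBi p u).hasFDerivAt

lemma contDiff_conj_evalBi (p : MvPolynomial (Fin n ⊕ Fin n) ℂ) :
    ContDiff ℝ ⊤ fun u => (starRingEnd ℂ) (evalBi p u) :=
  Complex.conjCLE.contDiff.comp (contDiff_evalBi p)

lemma wirt_conj_evalBi (p : MvPolynomial (Fin n ⊕ Fin n) ℂ) (j : Fin n) (u : Cn n) :
    wirt (fun u => (starRingEnd ℂ) (evalBi p u)) j u =
      (starRingEnd ℂ) (evalBi (MvPolynomial.pderiv (Sum.inr j) p) u) := by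
  rw [wirt, (hasFDerivAt_conj_evalBi p u).fderiv]
  simp only [ContinuousLinearMap.comp_apply, fderiv_evalBi_single, evalBi_add, evalBi_smul,
    map_one, Complex.conj_I, ContinuousLinearEquiv.coe_coe, Complex.conjCLE_apply, map_add,
    map_mul, map_neg]
  linear_combination (1 / 2 * (starRingEnd ℂ) (evalBi (MvPolynomial.pderiv (Sum.inl j) p) u) -
    1 / 2 * (starRingEnd ℂ) (evalBi (MvPolynomial.pderiv (Sum.inr j) p) u)) * Complex.I_mul_I

lemma wirt_mul {F G : Cn n → ℂ} {u : Cn n} (hF : DifferentiableAt ℝ F u)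
    (hG : DifferentiableAt ℝ G u) (j : Fin n) :
    wirt (fun u => F u * G u) j u = wirt F j u * G u + F u * wirt G j u := by
  have := (hF.hasFDerivAt.mul hG.hasFDerivAt)
  have h2 : HasFDerivAt (fun u => F u * G u) _ u := this
  rw [wirt, h2.fderiv, wirt, wirt]
  simp only [add_apply, smul_apply, smul_eq_mul]
  ring

/-- The normal component of twice the Wirtinger field, `e_j - i (i e_j)`, on the unit sphere. It is
the source of the factor `ω̄_j` in the divergence theorem below. -/
lemma inner_single_sub (ω : Cn n) (j : Fin n) :
    ((inner ℝ ω (PiLp.single 2 j 1 : Cn n) : ℝ) : ℂ) -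
      Complex.I * (inner ℝ ω (PiLp.single 2 j Complex.I : Cn n) : ℝ) = (starRingEnd ℂ) (ω j) := by
  have h : ∀ c : ℂ, inner ℝ ω (PiLp.single 2 j c : Cn n) = inner ℝ (ω j) c := by
    intro c
    rw [PiLp.inner_apply, Finset.sum_eq_single j]
    · simp
    · intro i _ hi; simp [hi]
    · simp
  rw [h, h]
  apply Complex.ext <;> simp [Complex.inner]

/-- The divergence theorem on spheres for Wirtinger derivatives. -/
lemma hasDerivAt_sphere_wirt (hn : 1 ≤ n) {F : Cn n → ℂ} (hF : ContDiff ℝ 1 F) (j : Fin n)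
    {ρ : ℝ} (hρ : 0 < ρ) :
    HasDerivAt (fun ρ : ℝ => (ρ : ℂ) ^ (2 * n - 1) *
        ∫ ω, F (ρ • (ω : Cn n)) * (starRingEnd ℂ) ((ω : Cn n) j) ∂(unitSphereMeasure n))
      (2 * (ρ : ℂ) ^ (2 * n - 1) * ∫ ω, wirt F j (ρ • (ω : Cn n)) ∂(unitSphereMeasure n)) ρ := by
  have h := (hasDerivAt_sphere_flux hn hF (PiLp.single 2 j 1) hρ).fun_sub
    ((hasDerivAt_sphere_flux hn hF (PiLp.single 2 j Complex.I) hρ).const_mul Complex.I)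
  have hF' := hF.continuous_fderiv (by simp)
  have hFc := hF.continuous
  have hd : ∀ (ρ : ℝ) v, Integrable (fun ω : Metric.sphere (0 : Cn n) 1 =>
      fderiv ℝ F (ρ • (ω : Cn n)) v) (unitSphereMeasure n) := fun ρ v =>
    integrable_sphere ((hF'.comp (by fun_prop)).clm_apply continuous_const)
  have hi : ∀ (ρ : ℝ) (v : Cn n), Integrable (fun ω : Metric.sphere (0 : Cn n) 1 =>
      F (ρ • (ω : Cn n)) * (inner ℝ (ω : Cn n) v : ℝ)) (unitSphereMeasure n) := fun ρ v =>
    integrable_sphere (by fun_prop)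
  have e1 : ∀ ρ : ℝ,
      ∫ ω, F (ρ • (ω : Cn n)) * (starRingEnd ℂ) ((ω : Cn n) j) ∂(unitSphereMeasure n) =
      ∫ ω, F (ρ • (ω : Cn n)) * (inner ℝ (ω : Cn n) (PiLp.single 2 j 1 : Cn n) : ℝ)
        ∂(unitSphereMeasure n) - Complex.I * ∫ ω, F (ρ • (ω : Cn n)) *
        (inner ℝ (ω : Cn n) (PiLp.single 2 j Complex.I : Cn n) : ℝ) ∂(unitSphereMeasure n) := by
    intro ρ
    rw [← integral_const_mul, ← integral_sub (hi _ _) ((hi _ _).const_mul _)]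
    refine integral_congr_ae (Filter.Eventually.of_forall fun ω => ?_)
    simp only [← inner_single_sub]
    ring
  have e2 : 2 * ∫ ω, wirt F j (ρ • (ω : Cn n)) ∂(unitSphereMeasure n) =
      ∫ ω, fderiv ℝ F (ρ • (ω : Cn n)) (PiLp.single 2 j 1) ∂(unitSphereMeasure n) -
      Complex.I * ∫ ω, fderiv ℝ F (ρ • (ω : Cn n)) (PiLp.single 2 j Complex.I)
        ∂(unitSphereMeasure n) := by
    rw [← integral_const_mul, ← integral_const_mul,
      ← integral_sub (hd _ _) ((hd _ _).const_mul _)]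
    refine integral_congr_ae (Filter.Eventually.of_forall fun ω => ?_)
    simp only [wirt]
    ring
  refine (h.congr_deriv ?_).congr_of_eventuallyEq (Filter.Eventually.of_forall fun ρ => ?_)
  · rw [mul_right_comm, e2, Complex.real_smul, Complex.real_smul, Complex.ofReal_pow]
    ring
  · simp only [e1, Complex.real_smul, Complex.ofReal_pow]
    ring

/-- By homogeneity the flux is a multiple of `ρ^{2n-1+d}`, so the divergence theorem at `ρ = 1`
becomes an identity between two integrals over the unit sphere. -/
lemma sphere_wirt_of_homogeneous (hn : 1 ≤ n) {F : Cn n → ℂ} (hF : ContDiff ℝ 1 F) {d : ℕ}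
    (hd : ∀ (t : ℝ) u, F (t • u) = (t : ℂ) ^ d * F u) (j : Fin n) :
    ((2 * n - 1 + d : ℕ) : ℂ) *
        ∫ ω : Metric.sphere (0 : Cn n) 1, F ω * (starRingEnd ℂ) ((ω : Cn n) j) ∂(unitSphereMeasure n) =
      2 * ∫ ω : Metric.sphere (0 : Cn n) 1, wirt F j ω ∂(unitSphereMeasure n) := by
  have h := hasDerivAt_sphere_wirt hn hF j one_pos
  simp only [hd, mul_assoc, integral_const_mul] at h
  simp only [← mul_assoc, ← pow_add] at h
  have h2 := ((hasDerivAt_pow (2 * n - 1 + d) (1 : ℝ)).ofReal_comp).mul_const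
    (∫ ω : Metric.sphere (0 : Cn n) 1, F ω * (starRingEnd ℂ) ((ω : Cn n) j) ∂(unitSphereMeasure n))
  simp only [Complex.ofReal_pow] at h2
  have := h2.unique h
  simpa using this

open MvPolynomial in
/-- Spherical harmonics of bidegree `(a', b')` are orthogonal to polynomials of lower degree
in `z`. -/
lemma integral_bihom_mul_conj_harm_eq_zero (hn : 1 ≤ n) {a b a' b' : ℕ}
    {p q : MvPolynomial (Fin n ⊕ Fin n) ℂ} (hp : IsBihom a b p) (hq : IsHarm a' b' q)
    (h : a < a') : ∫ ω : Metric.sphere (0 : Cn n) 1, evalBi p ω * (starRingEnd ℂ) (evalBi q ω)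
      ∂(unitSphereMeasure n) = 0 := by
  have hc := fun r : MvPolynomial (Fin n ⊕ Fin n) ℂ => continuous_evalBi r
  induction a' generalizing a p q with
  | zero => omega
  | succ a' ih =>
    -- The divergence identity for `p · conj(∂_j q)` removes the factor `ω̄_j`. The term with `∂_j
    -- p` vanishes by induction, since both holomorphic degrees drop by one, or because `∂_j p = 0`
    -- when `a = 0`.
    have hstep : ∀ j, ∫ ω : Metric.sphere (0 : Cn n) 1, evalBi p ω *
        (starRingEnd ℂ) (evalBi (pderiv (Sum.inl j) q) ω) * (starRingEnd ℂ) ((ω : Cn n) j)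
        ∂(unitSphereMeasure n) = 2 / ((2 * n - 1 + (a + b + (a' + b')) : ℕ) : ℂ) *
        ∫ ω : Metric.sphere (0 : Cn n) 1, evalBi p ω *
          (starRingEnd ℂ) (evalBi (pderiv (Sum.inr j) (pderiv (Sum.inl j) q)) ω)
          ∂(unitSphereMeasure n) := by
      intro j
      have hne : ((2 * n - 1 + (a + b + (a' + b')) : ℕ) : ℂ) ≠ 0 := Nat.cast_ne_zero.2 (by omega)
      have h1 := sphere_wirt_of_homogeneous hn (F := fun u => evalBi p u *
        (starRingEnd ℂ) (evalBi (pderiv (Sum.inl j) q) u)) (d := a + b + (a' + b'))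
        (((contDiff_evalBi p).mul (contDiff_conj_evalBi _)).of_le le_top)
        (fun t u => by
          rw [hp.eval_smul, (hq.pderiv_inl j).toIsBihom.eval_smul, map_mul, map_pow,
            Complex.conj_ofReal]
          ring) j
      simp only [wirt_mul (differentiable_evalBi p _) (hasFDerivAt_conj_evalBi _ _).differentiableAt,
        wirt_evalBi, wirt_conj_evalBi] at h1
      rw [integral_add (integrable_sphere (by
          have := hc (pderiv (Sum.inl j) p); have := hc (pderiv (Sum.inl j) q); fun_prop))
        (integrable_sphere (by
          have := hc p; have := hc (pderiv (Sum.inr j) (pderiv (Sum.inl j) q)); fun_prop))] at h1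
      have h2 : ∫ ω : Metric.sphere (0 : Cn n) 1, evalBi (pderiv (Sum.inl j) p) ω *
          (starRingEnd ℂ) (evalBi (pderiv (Sum.inl j) q) ω) ∂(unitSphereMeasure n) = 0 := by
        rcases a with _ | a
        · simp [hp.pderiv_inl_eq_zero j]
        · exact ih (hp.pderiv_inl j) (hq.pderiv_inl j) (by omega)
      rw [h2, zero_add] at h1
      field_simp
      linear_combination h1
    -- Euler's identity for `q` produces the factors `ω̄_j` that `hstep` integrates away; what is
    -- left sums to the conjugate Laplacian of `q`, hence to zero.
    have heuler : ∀ ω : Metric.sphere (0 : Cn n) 1, evalBi p ω * (starRingEnd ℂ) (evalBi q ω) =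
        ((a' + 1 : ℕ) : ℂ)⁻¹ * ∑ j, evalBi p ω *
        (starRingEnd ℂ) (evalBi (pderiv (Sum.inl j) q) ω) * (starRingEnd ℂ) ((ω : Cn n) j) := by
      intro ω
      have hne : ((a' + 1 : ℕ) : ℂ) ≠ 0 := Nat.cast_ne_zero.2 (by omega)
      have := congrArg (fun r => (starRingEnd ℂ) (evalBi r (ω : Cn n))) hq.toIsBihom.euler_left
      simp only [evalBi_sum, evalBi_mul, evalBi_smul, map_sum, map_mul, evalBi_X, bicoords_inl,
        map_natCast] at this
      rw [eq_inv_mul_iff_mul_eq₀ hne, mul_left_comm, ← this, Finset.mul_sum]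
      exact Finset.sum_congr rfl fun j _ => by ring
    simp_rw [heuler]
    rw [integral_const_mul, integral_finsetSum]
    · simp_rw [hstep]
      rw [← Finset.mul_sum, ← integral_finsetSum]
      · simp_rw [← Finset.mul_sum, ← map_sum, ← evalBi_sum, pderiv_pderiv_comm (Sum.inr _) (Sum.inl _)]
        have := hq.lap
        rw [polyLap] at this
        simp [this]
      · intro j _
        have := hc p
        have := hc (pderiv (Sum.inr j) (pderiv (Sum.inl j) q))
        exact integrable_sphere (by fun_prop)
    · intro j _
      have := hc p
      have := hc (pderiv (Sum.inl j) q)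
      have h3 : Continuous fun ω : Metric.sphere (0 : Cn n) 1 =>
        (starRingEnd ℂ) ((ω : Cn n) j) := by fun_prop
      exact integrable_sphere (by fun_prop)

end wirtinger

/-! ### Decomposition of polynomials into harmonics -/

section completeness

open MvPolynomial

variable {n : ℕ}

lemma IsBihom.polyLap {a b : ℕ} {p : MvPolynomial (Fin n ⊕ Fin n) ℂ}
    (hp : IsBihom (a + 1) (b + 1) p) : IsBihom a b (polyLap p) :=
  IsBihom.sum _ _ fun j _ => (hp.pderiv_inr j).pderiv_inl j

/-- The space of polynomials of bidegree `(a, b)`. -/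
noncomputable def bihomSubmodule (n a b : ℕ) : Submodule ℂ (MvPolynomial (Fin n ⊕ Fin n) ℂ) :=
  weightedHomogeneousSubmodule ℂ (leftWeight n) a ⊓ weightedHomogeneousSubmodule ℂ (rightWeight n) b

lemma mem_bihomSubmodule {a b : ℕ} {p : MvPolynomial (Fin n ⊕ Fin n) ℂ} :
    p ∈ bihomSubmodule n a b ↔ IsBihom a b p :=
  ⟨fun h => ⟨h.1, h.2⟩, fun h => ⟨h.left, h.right⟩⟩

instance (a b : ℕ) : FiniteDimensional ℂ (bihomSubmodule n a b) := by
  have hle : bihomSubmodule n a b ≤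
      weightedHomogeneousSubmodule ℂ (fun _ : Fin n ⊕ Fin n => 1) (a + b) := by
    intro p hp d hd
    obtain ⟨h1, h2⟩ := (mem_bihomSubmodule.1 hp).support (mem_support_iff.2 hd)
    rw [Finsupp.weight_apply, Finsupp.sum_fintype _ _ (by simp)]
    simp [Fintype.sum_sum_type, h1, h2]
  have : FiniteDimensional ℂ
      (weightedHomogeneousSubmodule ℂ (fun _ : Fin n ⊕ Fin n => 1) (a + b)) :=
    Module.Finite.iff_fg.2 (weightedHomogeneousSubmodule_fg ℂ (fun _ : Fin n ⊕ Fin n => 1)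
      (fun _ => one_ne_zero) (a + b))
  exact Submodule.finiteDimensional_of_le hle

lemma IsBihom.eq_zero_of_sphere {a b : ℕ} {p : MvPolynomial (Fin n ⊕ Fin n) ℂ}
    (hp : IsBihom a b p) (hn : 1 ≤ n)
    (h : ∀ ω : Metric.sphere (0 : Cn n) 1, evalBi p ω = 0) : p = 0 := by
  apply evalBi_inj
  ext u
  rw [evalBi_zero]
  by_cases hu : u = 0
  · have := nontrivial_Cn hn
    obtain ⟨ω, hω⟩ := (NormedSpace.sphere_nonempty (x := (0 : Cn n)) (r := 1)).2 zero_le_one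
    have h1 := hp.eval_smul 0 ω
    rw [h ⟨ω, hω⟩, mul_zero, zero_smul] at h1
    rw [hu, h1]
  · have hu' := norm_ne_zero_iff.2 hu
    have h1 := hp.eval_smul ‖u‖ (‖u‖⁻¹ • u)
    rw [smul_smul, mul_inv_cancel₀ hu', one_smul,
      h ⟨‖u‖⁻¹ • u, by simp [norm_smul, hu']⟩, mul_zero] at h1
    exact h1

/-- The map `u ↦ Δ(|z|² u)` on bidegree `(a, b)` is injective: if `|z|² u` is harmonic of bidegree
`(a+1, b+1)`, it is orthogonal to the lower-degree `u`; on the unit sphere it equals `u`, so `u`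
vanishes there. In finite dimension the map is then onto. Choosing `u` with `Δ(|z|² u) = Δp` makes
`p - |z|² u` harmonic. -/
lemma exists_harm_add_normSq_mul (hn : 1 ≤ n) {a b : ℕ} {p : MvPolynomial (Fin n ⊕ Fin n) ℂ}
    (hp : IsBihom (a + 1) (b + 1) p) :
    ∃ h u, IsHarm (a + 1) (b + 1) h ∧ IsBihom a b u ∧ p = h + normSqPoly n * u := by
  have hQ : ∀ u, IsBihom a b u → IsBihom (a + 1) (b + 1) (normSqPoly n * u) := fun u hu => by
    have := isBihom_normSqPoly.mul hu
    rwa [add_comm 1, add_comm 1] at this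
  let T : bihomSubmodule n a b →ₗ[ℂ] bihomSubmodule n a b :=
    { toFun := fun u => ⟨_root_.polyLap (normSqPoly n * u.1),
        mem_bihomSubmodule.2 (hQ _ (mem_bihomSubmodule.1 u.2)).polyLap⟩
      map_add' := fun u v => by
        ext1; simp [mul_add, polyLap_add]
      map_smul' := fun c u => by
        ext1; simp [polyLap_smul] }
  have hT : Function.Injective T := by
    rw [← LinearMap.ker_eq_bot, LinearMap.ker_eq_bot']
    rintro ⟨u, hu⟩ h
    have hu' := mem_bihomSubmodule.1 hu
    have hh : IsHarm (a + 1) (b + 1) (normSqPoly n * u) := ⟨hQ u hu', congrArg Subtype.val h⟩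
    have h0 := integral_bihom_mul_conj_harm_eq_zero hn hu' hh (Nat.lt_succ_self a)
    have h1 : ∫ ω : Metric.sphere (0 : Cn n) 1, ‖evalBi u ω‖ ^ 2 ∂(unitSphereMeasure n) = 0 := by
      have h2 : ∀ ω : Metric.sphere (0 : Cn n) 1, evalBi u ω * (starRingEnd ℂ)
          (evalBi (normSqPoly n * u) ω) = ((‖evalBi u ω‖ ^ 2 : ℝ) : ℂ) := by
        intro ω
        rw [evalBi_mul, evalBi_normSqPoly]
        simp [Complex.mul_conj']
      simp_rw [h2] at h0
      rw [integral_complex_ofReal] at h0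
      exact_mod_cast h0
    have hc : Continuous fun ω : Metric.sphere (0 : Cn n) 1 => ‖evalBi u ω‖ ^ 2 := by
      have := continuous_evalBi u
      fun_prop
    ext1
    refine hu'.eq_zero_of_sphere hn fun ω => ?_
    by_contra hne
    have := hc.integral_pos_of_hasCompactSupport_nonneg_nonzero (μ := unitSphereMeasure n)
      (x := ω) (HasCompactSupport.of_compactSpace _) (fun _ => by positivity)
      (by simpa using hne)
    exact this.ne' h1
  obtain ⟨u, hu⟩ := LinearMap.injective_iff_surjective.1 hT ⟨_, mem_bihomSubmodule.2 hp.polyLap⟩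
  have hu' := mem_bihomSubmodule.1 u.2
  refine ⟨p + (-1 : ℂ) • (normSqPoly n * u.1), u.1, ⟨hp.add ((hQ _ hu').smul _), ?_⟩, hu', by
    simp⟩
  have := congrArg Subtype.val hu
  simp only [T, LinearMap.coe_mk, AddHom.coe_mk] at this
  rw [polyLap_add, polyLap_smul, this]
  simp

/-- The restriction of a polynomial to the unit sphere. -/
noncomputable def sphereRestrict (p : MvPolynomial (Fin n ⊕ Fin n) ℂ) :
    C(Metric.sphere (0 : Cn n) 1, ℂ) :=
  ⟨fun ω => evalBi p ω, (continuous_evalBi p).comp continuous_subtype_val⟩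

/-- On the unit sphere `|z|² = 1`, so splitting off the harmonic part lowers the bidegree by `(1,
1)`. The recursion ends when one index is zero, where every polynomial is harmonic. -/
lemma IsBihom.sphereRestrict_mem_span (hn : 1 ≤ n) {a b : ℕ}
    {p : MvPolynomial (Fin n ⊕ Fin n) ℂ} (hp : IsBihom a b p) :
    sphereRestrict p ∈ Submodule.span ℂ
      {g | ∃ a b q, IsHarm a b q ∧ sphereRestrict (n := n) q = g} := by
  induction a generalizing b p with
  | zero =>
    refine Submodule.subset_span ⟨0, b, p, ⟨hp, ?_⟩, rfl⟩
    simp [_root_.polyLap, pderiv_pderiv_comm (Sum.inl _) (Sum.inr _), hp.pderiv_inl_eq_zero]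
  | succ a ih =>
    rcases b with _ | b
    · refine Submodule.subset_span ⟨a + 1, 0, p, ⟨hp, ?_⟩, rfl⟩
      simp [_root_.polyLap, hp.pderiv_inr_eq_zero]
    · obtain ⟨h, u, hh, hu, rfl⟩ := exists_harm_add_normSq_mul hn hp
      have : sphereRestrict (h + normSqPoly n * u) = sphereRestrict h + sphereRestrict u := by
        ext ω
        simp [sphereRestrict, evalBi_add, evalBi_mul, evalBi_normSqPoly]
      rw [this]
      exact Submodule.add_mem _ (Submodule.subset_span ⟨_, _, _, hh, rfl⟩) (ih hu)

lemma sphereRestrict_mem_span (hn : 1 ≤ n) (p : MvPolynomial (Fin n ⊕ Fin n) ℂ) :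
    sphereRestrict p ∈ Submodule.span ℂ
      {g | ∃ a b q, IsHarm a b q ∧ sphereRestrict (n := n) q = g} := by
  induction p using MvPolynomial.induction_on' with
  | monomial d c =>
    exact IsBihom.sphereRestrict_mem_span hn
      ⟨isWeightedHomogeneous_monomial _ _ _ rfl, isWeightedHomogeneous_monomial _ _ _ rfl⟩
  | add p q hp hq =>
    have : sphereRestrict (p + q) = sphereRestrict p + sphereRestrict q := by
      ext ω
      simp [sphereRestrict, evalBi_add]
    rw [this]
    exact Submodule.add_mem _ hp hq

lemma exists_star_sphereRestrict (p : MvPolynomial (Fin n ⊕ Fin n) ℂ) :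
    ∃ q, sphereRestrict q = star (sphereRestrict p) := by
  induction p using MvPolynomial.induction_on with
  | C c => exact ⟨C ((starRingEnd ℂ) c), by ext ω; simp [sphereRestrict, evalBi]⟩
  | add p q hp hq =>
    obtain ⟨p', hp'⟩ := hp
    obtain ⟨q', hq'⟩ := hq
    refine ⟨p' + q', ?_⟩
    ext ω
    have h1 := DFunLike.congr_fun hp' ω
    have h2 := DFunLike.congr_fun hq' ω
    simp only [sphereRestrict, ContinuousMap.coe_mk, ContinuousMap.star_apply] at h1 h2 ⊢
    simp [evalBi_add, h1, h2]
  | mul_X p i hp =>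
    obtain ⟨p', hp'⟩ := hp
    refine ⟨p' * X i.swap, ?_⟩
    ext ω
    have h1 := DFunLike.congr_fun hp' ω
    simp only [sphereRestrict, ContinuousMap.coe_mk, ContinuousMap.star_apply] at h1 ⊢
    rcases i with j | j <;> simp [evalBi_mul, h1]

end completeness

/-! ### Spherical harmonics as a Hilbert basis -/

section hilbert

variable {n : ℕ}

/-- The case `a < a'` is known; conjugation gives `b < b'`, and interchanging `p` and `q` gives the
reversed inequalities. -/
lemma IsHarm.integral_mul_conj_eq_zero (hn : 1 ≤ n) {a b a' b' : ℕ}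
    {p q : MvPolynomial (Fin n ⊕ Fin n) ℂ} (hp : IsHarm a b p) (hq : IsHarm a' b' q)
    (h : (a, b) ≠ (a', b')) :
    ∫ ω : Metric.sphere (0 : Cn n) 1, evalBi p ω * (starRingEnd ℂ) (evalBi q ω)
      ∂(unitSphereMeasure n) = 0 := by
  have hswap : ∀ {a b a' b' : ℕ} {p q : MvPolynomial (Fin n ⊕ Fin n) ℂ}, IsHarm a b p →
      IsHarm a' b' q → a < a' ∨ b < b' →
      ∫ ω : Metric.sphere (0 : Cn n) 1, evalBi p ω * (starRingEnd ℂ) (evalBi q ω)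
        ∂(unitSphereMeasure n) = 0 := by
    intro a b a' b' p q hp hq h
    rcases h with h | h
    · exact integral_bihom_mul_conj_harm_eq_zero hn hp.toIsBihom hq h
    · obtain ⟨p', hp', ep⟩ := hp.exists_conj
      obtain ⟨q', hq', eq⟩ := hq.exists_conj
      have h1 := integral_bihom_mul_conj_harm_eq_zero hn hp'.toIsBihom hq' h
      simp only [ep, eq, ← map_mul] at h1
      rw [integral_conj] at h1
      exact (map_eq_zero _).1 h1
  by_cases h1 : a < a' ∨ b < b'
  · exact hswap hp hq h1
  · have h2 : a' < a ∨ b' < b := by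
      by_contra h2
      exact h (Prod.ext (by simp only; omega) (by simp only; omega))
    have h3 := congrArg (starRingEnd ℂ) (hswap hq hp h2)
    rw [← integral_conj, map_zero] at h3
    rw [← h3]
    refine integral_congr_ae (Filter.Eventually.of_forall fun ω => ?_)
    simp [mul_comm]

/-- Stone–Weierstrass: the coordinate functions separate points, and polynomials in `z` and `z̄` are
closed under conjugation. -/
lemma dense_sphereRestrict :
    Dense (Set.range (sphereRestrict (n := n))) := by
  let A : StarSubalgebra ℂ C(Metric.sphere (0 : Cn n) 1, ℂ) := StarAlgebra.adjoin ℂ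
    (Set.range fun j : Fin n => sphereRestrict (MvPolynomial.X (Sum.inl j)))
  have hA : A.SeparatesPoints := by
    intro x y hxy
    have : ∃ j, (x : Cn n) j ≠ (y : Cn n) j := by
      by_contra h
      push Not at h
      exact hxy (Subtype.ext (PiLp.ext h))
    obtain ⟨j, hj⟩ := this
    refine ⟨_, ⟨sphereRestrict (MvPolynomial.X (Sum.inl j)),
      StarAlgebra.subset_adjoin _ _ ⟨j, rfl⟩, rfl⟩, ?_⟩
    simpa [sphereRestrict] using hj
  have hle : (A : Set C(Metric.sphere (0 : Cn n) 1, ℂ)) ⊆ Set.range (sphereRestrict (n := n)) := by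
    intro g hg
    induction hg using StarAlgebra.adjoin_induction with
    | mem g h => obtain ⟨j, rfl⟩ := h; exact ⟨_, rfl⟩
    | algebraMap c =>
      exact ⟨MvPolynomial.C c, by ext ω; simp [sphereRestrict, evalBi]⟩
    | add f g _ _ hf hg =>
      obtain ⟨p, rfl⟩ := hf
      obtain ⟨q, rfl⟩ := hg
      exact ⟨p + q, by ext ω; simp [sphereRestrict, evalBi_add]⟩
    | mul f g _ _ hf hg =>
      obtain ⟨p, rfl⟩ := hf
      obtain ⟨q, rfl⟩ := hg
      exact ⟨p * q, by ext ω; simp [sphereRestrict, evalBi_mul]⟩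
    | star f _ hf =>
      obtain ⟨p, rfl⟩ := hf
      exact exists_star_sphereRestrict p
  have h := ContinuousMap.starSubalgebra_topologicalClosure_eq_top_of_separatesPoints A hA
  have h2 : Dense (A : Set C(Metric.sphere (0 : Cn n) 1, ℂ)) := by
    intro g
    have : g ∈ A.topologicalClosure := by rw [h]; trivial
    exact this
  exact h2.mono hle

/-- The index set of a complete system of spherical harmonics. -/
abbrev HarmIndex (n : ℕ) : Type := Σ a : ℕ × ℕ, Fin (dimHarmonics n a.1 a.2)

variable {pol : ∀ a b : ℕ, Fin (dimHarmonics n a b) → MvPolynomial (Fin n ⊕ Fin n) ℂ}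

lemma orthonormal_toLp (hn : 1 ≤ n) (hpol : ∀ a b j, IsHarm a b (pol a b j))
    (hP : ∀ a b, IsOrthonormalHarmonicBasis n a b fun j => evalBi (pol a b j)) :
    Orthonormal ℂ fun i : HarmIndex n =>
      ContinuousMap.toLp 2 (unitSphereMeasure n) ℂ (sphereRestrict (pol i.1.1 i.1.2 i.2)) := by
  rw [orthonormal_iff_ite]
  rintro ⟨⟨a, b⟩, j⟩ ⟨⟨a', b'⟩, k⟩
  rw [ContinuousMap.inner_toLp]
  simp only [sphereRestrict, ContinuousMap.coe_mk]
  by_cases h : (a, b) = (a', b')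
  · obtain ⟨rfl, rfl⟩ := Prod.ext_iff.1 h
    rw [(hP a b).2 k j]
    simp [eq_comm]
  · rw [(hpol a' b' k).integral_mul_conj_eq_zero hn (hpol a b j) (Ne.symm h), if_neg]
    intro he
    exact h (congrArg Sigma.fst he)

/-- Restricted polynomials are combinations of harmonics, they are uniformly dense in the continuous
functions, and these are dense in `L²`. -/
lemma span_toLp (hn : 1 ≤ n)
    (hP : ∀ a b, IsOrthonormalHarmonicBasis n a b fun j => evalBi (pol a b j)) :
    ⊤ ≤ (Submodule.span ℂ (Set.range fun i : HarmIndex n => ContinuousMap.toLp 2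
      (unitSphereMeasure n) ℂ (sphereRestrict (pol i.1.1 i.1.2 i.2)))).topologicalClosure := by
  set E := Submodule.span ℂ (Set.range fun i : HarmIndex n => ContinuousMap.toLp 2
      (unitSphereMeasure n) ℂ (sphereRestrict (pol i.1.1 i.1.2 i.2))) with hE
  have h1 : ∀ p, ContinuousMap.toLp 2 (unitSphereMeasure n) ℂ (sphereRestrict p) ∈ E := by
    intro p
    have h2 : Submodule.span ℂ {g | ∃ a b q, IsHarm a b q ∧ sphereRestrict (n := n) q = g} ≤
        E.comap (ContinuousMap.toLp (E := ℂ) 2 (unitSphereMeasure n) ℂ).toLinearMap := by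
      rw [Submodule.span_le]
      rintro _ ⟨a, b, q, hq, rfl⟩
      -- The given basis spans a space of functions on `ℂⁿ`, not on the sphere, so the span relation
      -- is transported through restrictions.
      have h3 : ∀ F ∈ Submodule.span ℂ (Set.range fun j => evalBi (pol a b j)),
          ∃ g : C(Metric.sphere (0 : Cn n) 1, ℂ), (∀ ω, g ω = F ω) ∧
            ContinuousMap.toLp 2 (unitSphereMeasure n) ℂ g ∈ E := by
        intro F hF
        induction hF using Submodule.span_induction with
        | mem F h =>
          obtain ⟨j, rfl⟩ := h
          exact ⟨sphereRestrict (pol a b j), fun _ => rfl,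
            Submodule.subset_span ⟨⟨(a, b), j⟩, rfl⟩⟩
        | zero => exact ⟨0, fun _ => rfl, by rw [map_zero]; exact E.zero_mem⟩
        | add F G _ _ hF hG =>
          obtain ⟨f, hf, hf'⟩ := hF
          obtain ⟨g, hg, hg'⟩ := hG
          exact ⟨f + g, fun ω => by simp [hf, hg], by rw [map_add]; exact E.add_mem hf' hg'⟩
        | smul c F _ hF =>
          obtain ⟨f, hf, hf'⟩ := hF
          exact ⟨c • f, fun ω => by simp [hf], by rw [map_smul]; exact E.smul_mem _ hf'⟩
      obtain ⟨g, hg, hg'⟩ := h3 (evalBi q) (by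
        rw [(hP a b).1]; exact mem_solidHarmonics_iff.2 ⟨q, hq, rfl⟩)
      have : sphereRestrict q = g := by ext ω; exact (hg ω).symm
      rw [this]
      exact hg'
    exact h2 (sphereRestrict_mem_span hn p)
  have h4 : Set.range (ContinuousMap.toLp (E := ℂ) 2 (unitSphereMeasure n) ℂ) ⊆
      (E.topologicalClosure : Set _) := by
    rintro _ ⟨g, rfl⟩
    have h5 := image_closure_subset_closure_image
      (ContinuousMap.toLp (E := ℂ) 2 (unitSphereMeasure n) ℂ).continuous
      ⟨g, dense_sphereRestrict g, rfl⟩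
    refine closure_mono ?_ h5
    rintro _ ⟨_, ⟨p, rfl⟩, rfl⟩
    exact h1 p
  intro x _
  have h6 := ContinuousMap.toLp_denseRange ℂ (unitSphereMeasure n) ℂ (p := 2) (by simp)
  exact closure_minimal h4 E.isClosed_topologicalClosure (h6 x)

/-- Parseval's identity for spherical harmonics. -/
lemma hasSum_sphere (hn : 1 ≤ n) (hpol : ∀ a b j, IsHarm a b (pol a b j))
    (hP : ∀ a b, IsOrthonormalHarmonicBasis n a b fun j => evalBi (pol a b j))
    {g h : Metric.sphere (0 : Cn n) 1 → ℂ} (hg : Continuous g) (hh : Continuous h) :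
    HasSum (fun i : HarmIndex n =>
      (∫ ω, g ω * (starRingEnd ℂ) (evalBi (pol i.1.1 i.1.2 i.2) ω) ∂(unitSphereMeasure n)) *
      ∫ ω, evalBi (pol i.1.1 i.1.2 i.2) ω * h ω ∂(unitSphereMeasure n))
      (∫ ω, g ω * h ω ∂(unitSphereMeasure n)) := by
  let b := HilbertBasis.mk (orthonormal_toLp hn hpol hP) (span_toLp hn hP)
  -- The conjugate `star h` turns the sesquilinear inner product into the bilinear pairing of `g`
  -- and `h`.
  have hs := b.hasSum_inner_mul_inner
    (ContinuousMap.toLp 2 (unitSphereMeasure n) ℂ (star (⟨h, hh⟩ : C(_, ℂ))))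
    (ContinuousMap.toLp 2 (unitSphereMeasure n) ℂ (⟨g, hg⟩ : C(_, ℂ)))
  simp only [b, HilbertBasis.coe_mk, ContinuousMap.inner_toLp] at hs
  simpa [sphereRestrict, mul_comm] using hs

/-- Bessel's inequality for each factor and `2xy ≤ x² + y²`. The bound does not depend on `s`, which
is what dominated convergence in the radius needs. -/
lemma sum_norm_sphere_le (hn : 1 ≤ n) (hpol : ∀ a b j, IsHarm a b (pol a b j))
    (hP : ∀ a b, IsOrthonormalHarmonicBasis n a b fun j => evalBi (pol a b j))
    {g h : Metric.sphere (0 : Cn n) 1 → ℂ} (hg : Continuous g) (hh : Continuous h)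
    {M : ℝ} (hgM : ∀ ω, ‖g ω‖ ≤ M) (hhM : ∀ ω, ‖h ω‖ ≤ M) (s : Finset (HarmIndex n)) :
    ‖∑ i ∈ s,
      (∫ ω, g ω * (starRingEnd ℂ) (evalBi (pol i.1.1 i.1.2 i.2) ω) ∂(unitSphereMeasure n)) *
      ∫ ω, evalBi (pol i.1.1 i.1.2 i.2) ω * h ω ∂(unitSphereMeasure n)‖ ≤ M ^ 2 := by
  have := isProbabilityMeasure_unitSphereMeasure hn
  have hv := orthonormal_toLp hn hpol hP
  have hbound : ∀ f : C(Metric.sphere (0 : Cn n) 1, ℂ), (∀ ω, ‖f ω‖ ≤ M) →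
      ∑ i ∈ s, ‖∫ ω, f ω * (starRingEnd ℂ) (evalBi (pol i.1.1 i.1.2 i.2) ω)
        ∂(unitSphereMeasure n)‖ ^ 2 ≤ M ^ 2 := by
    intro f hf
    have h1 := hv.sum_inner_products_le (s := s)
      (ContinuousMap.toLp 2 (unitSphereMeasure n) ℂ f)
    simp only [ContinuousMap.inner_toLp] at h1
    refine h1.trans ?_
    rw [← inner_self_eq_norm_sq (𝕜 := ℂ), ContinuousMap.inner_toLp]
    have h2 : ∫ ω, f ω * (starRingEnd ℂ) (f ω) ∂(unitSphereMeasure n) =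
        ((∫ ω, ‖f ω‖ ^ 2 ∂(unitSphereMeasure n) : ℝ) : ℂ) := by
      rw [← integral_complex_ofReal]
      simp [Complex.mul_conj']
    rw [h2]
    have h3 : ∫ ω, ‖f ω‖ ^ 2 ∂(unitSphereMeasure n) ≤ ∫ _, M ^ 2 ∂(unitSphereMeasure n) := by
      refine integral_mono_of_nonneg (Filter.Eventually.of_forall fun _ => by positivity)
        (integrable_const _) (Filter.Eventually.of_forall fun ω => ?_)
      exact pow_le_pow_left₀ (norm_nonneg _) (hf ω) 2
    simpa using h3
  have hb1 := hbound ⟨g, hg⟩ hgM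
  have hb2 := hbound (star ⟨h, hh⟩) (fun ω => by simpa using hhM ω)
  have e2 : ∀ i : HarmIndex n, ‖∫ ω, (star (⟨h, hh⟩ : C(_, ℂ))) ω *
      (starRingEnd ℂ) (evalBi (pol i.1.1 i.1.2 i.2) ω) ∂(unitSphereMeasure n)‖ =
      ‖∫ ω, evalBi (pol i.1.1 i.1.2 i.2) ω * h ω ∂(unitSphereMeasure n)‖ := by
    intro i
    rw [← RCLike.norm_conj, ← integral_conj]
    congr 1
    refine integral_congr_ae (Filter.Eventually.of_forall fun ω => ?_)
    simp [mul_comm]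
  simp only [e2] at hb2
  refine (norm_sum_le _ _).trans ?_
  have h5 : ∀ i ∈ s, ‖(∫ ω, g ω * (starRingEnd ℂ) (evalBi (pol i.1.1 i.1.2 i.2) ω)
      ∂(unitSphereMeasure n)) * ∫ ω, evalBi (pol i.1.1 i.1.2 i.2) ω * h ω
      ∂(unitSphereMeasure n)‖ ≤
      1 / 2 * ‖∫ ω, g ω * (starRingEnd ℂ) (evalBi (pol i.1.1 i.1.2 i.2) ω)
      ∂(unitSphereMeasure n)‖ ^ 2 + 1 / 2 * ‖∫ ω, evalBi (pol i.1.1 i.1.2 i.2) ω * h ω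
      ∂(unitSphereMeasure n)‖ ^ 2 := by
    intro i _
    rw [norm_mul]
    nlinarith [sq_nonneg (‖∫ ω, g ω * (starRingEnd ℂ) (evalBi (pol i.1.1 i.1.2 i.2) ω)
      ∂(unitSphereMeasure n)‖ - ‖∫ ω, evalBi (pol i.1.1 i.1.2 i.2) ω * h ω
      ∂(unitSphereMeasure n)‖)]
  refine (Finset.sum_le_sum h5).trans ?_
  rw [Finset.sum_add_distrib, ← Finset.mul_sum, ← Finset.mul_sum]
  simp only [ContinuousMap.coe_mk] at hb1
  linarith

end hilbert

/-! ### Twisted spherical means -/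

section twist

variable {n : ℕ}

/-- The symplectic form `Im (z · ū)`. -/
noncomputable def symp (z u : Cn n) : ℝ := (∑ j, z j * (starRingEnd ℂ) (u j)).im

/-- The twisted spherical mean with twist parameter `κ`. -/
noncomputable def twist (κ : ℝ) (f : Cn n → ℂ) (z : Cn n) (s : ℝ) : ℂ :=
  ∫ ω : Metric.sphere (0 : Cn n) 1, f (z - s • (ω : Cn n)) *
    Complex.exp (2 * Complex.I * κ * (s * symp z ω)) ∂(unitSphereMeasure n)

lemma two_I_mul_symp (z u : Cn n) : 2 * Complex.I * (symp z u : ℂ) =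
    ∑ j, (z j * (starRingEnd ℂ) (u j) - (starRingEnd ℂ) (z j) * u j) := by
  have h : (∑ j, (starRingEnd ℂ) (z j) * u j) =
      (starRingEnd ℂ) (∑ j, z j * (starRingEnd ℂ) (u j)) := by
    simp [map_sum]
  rw [Finset.sum_sub_distrib, h, Complex.sub_conj, symp]
  push_cast
  ring

lemma symp_smul_right (t : ℝ) (z u : Cn n) : symp z (t • u) = t * symp z u := by
  simp only [symp, PiLp.smul_apply, Complex.real_smul, map_mul, Complex.conj_ofReal,
    Complex.im_sum, Finset.mul_sum]
  refine Finset.sum_congr rfl fun j _ => ?_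
  rw [mul_left_comm, Complex.im_ofReal_mul]

lemma symp_swap (z u : Cn n) : symp z u = -symp u z := by
  simp only [symp, Complex.im_sum, ← Finset.sum_neg_distrib]
  refine Finset.sum_congr rfl fun j _ => ?_
  simp
  ring

lemma symp_self (z : Cn n) : symp z z = 0 := by
  have := symp_swap z z
  linarith

lemma symp_add_left (z w u : Cn n) : symp (z + w) u = symp z u + symp w u := by
  simp [symp, add_mul, Finset.sum_add_distrib]

lemma symp_sub_right (z u w : Cn n) : symp z (u - w) = symp z u - symp z w := by
  simp [symp, mul_sub, Finset.sum_sub_distrib]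

lemma continuous_symp : Continuous fun x : Cn n × Cn n => symp x.1 x.2 := by
  unfold symp
  fun_prop

/-- With `κ = 1/4` the factor `2iκ` is the `i/2` of the definition. -/
lemma twistedMean_eq_twist (f : Cn n → ℂ) {s : ℝ} (hs : 0 < s) (z : Cn n) :
    twistedMean f s z = twist (1 / 4) f z s := by
  have hemb : MeasurableEmbedding (fun ω : Metric.sphere (0 : Cn n) 1 => s • (ω : Cn n)) :=
    (measurableEmbedding_const_smul₀ hs.ne').comp
      (MeasurableEmbedding.subtype_coe Metric.isClosed_sphere.measurableSet)
  rw [twistedMean, sphereMeasure, hemb.integral_map, twist]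
  refine integral_congr_ae (Filter.Eventually.of_forall fun ω => ?_)
  simp only []
  congr 2
  have := symp_smul_right s z ω
  rw [symp] at this
  rw [this]
  push_cast
  ring

end twist

/-! ### Model functions along a complexified translation -/

section model

open MvPolynomial

variable {n : ℕ}

/-- The function `e^{κ|u|²} |u|^{-2k} p(u)`, with `u` and `ū` replaced by independent variables. -/
noncomputable def modelC (κ : ℝ) (k : ℤ) (p : MvPolynomial (Fin n ⊕ Fin n) ℂ)
    (c : Fin n ⊕ Fin n → ℂ) : ℂ :=
  Complex.exp (κ * eval c (normSqPoly n)) * (eval c (normSqPoly n)) ^ (-k) * eval c p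

/-- The complex curve extending `τ ↦ τ z - s ω`. -/
noncomputable def curve (z : Cn n) (s : ℝ) (ω : Cn n) (τ : ℂ) (i : Fin n ⊕ Fin n) : ℂ :=
  τ * bicoords z i - s * bicoords ω i

/-- The integrand of the twisted mean of `modelC` at `τ z`. -/
noncomputable def modelIntegrand (κ : ℝ) (z : Cn n) (s : ℝ) (k : ℤ)
    (p : MvPolynomial (Fin n ⊕ Fin n) ℂ) (τ : ℂ) (ω : Cn n) : ℂ :=
  modelC κ k p (curve z s ω τ) * Complex.exp (2 * Complex.I * κ * (s * symp z ω) * τ)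

/-- The twisted mean of `modelC` at `τ z`. -/
noncomputable def modelMean (κ : ℝ) (z : Cn n) (s : ℝ) (k : ℤ)
    (p : MvPolynomial (Fin n ⊕ Fin n) ℂ) (τ : ℂ) : ℂ :=
  ∫ ω : Metric.sphere (0 : Cn n) 1, modelIntegrand κ z s k p τ ω ∂(unitSphereMeasure n)

lemma hasDerivAt_curve (z : Cn n) (s : ℝ) (ω : Cn n) (τ : ℂ) (i : Fin n ⊕ Fin n) :
    HasDerivAt (fun τ => curve z s ω τ i) (bicoords z i) τ := by
  simpa [curve] using ((hasDerivAt_id τ).mul_const (bicoords z i)).sub_const (s * bicoords ω i)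

/-- Write `c_j`, `c'_j` for the values of `z_j`, `z̄_j` on the curve. The phase has logarithmic
derivative `-κ ∑ (z_j c'_j - z̄_j c_j)`. This cancels the derivative of `e^{κq}` in the `z_j`
directions and doubles it in the `z̄_j` directions. The products `c'_j p` and `c_j p` are then split
into raised polynomial plus a multiple of `q` times a derivative of `p`; the splitting is an
identity for every `m ≠ 0`, and harmonicity will dictate `m = n+a+b`. -/
lemma hasDerivAt_modelIntegrand {κ : ℝ} {z : Cn n} {s : ℝ} {k : ℤ}
    {p : MvPolynomial (Fin n ⊕ Fin n) ℂ} {τ : ℂ} {ω : Cn n} {m : ℂ} (hm : m ≠ 0)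
    (hq : eval (curve z s ω τ) (normSqPoly n) ≠ 0) :
    HasDerivAt (fun τ => modelIntegrand κ z s k p τ ω)
      (∑ j, (z j * (-k * modelIntegrand κ z s (k + 1) (X (Sum.inr j) * p +
              (-m⁻¹) • (normSqPoly n * pderiv (Sum.inl j) p)) τ ω +
            (1 - k / m) * modelIntegrand κ z s k (pderiv (Sum.inl j) p) τ ω) +
        (starRingEnd ℂ) (z j) * (2 * κ * modelIntegrand κ z s k (X (Sum.inl j) * p +
              (-m⁻¹) • (normSqPoly n * pderiv (Sum.inr j) p)) τ ω +
            2 * κ / m * modelIntegrand κ z s (k - 1) (pderiv (Sum.inr j) p) τ ω +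
            -k * modelIntegrand κ z s (k + 1) (X (Sum.inl j) * p +
              (-m⁻¹) • (normSqPoly n * pderiv (Sum.inr j) p)) τ ω +
            (1 - k / m) * modelIntegrand κ z s k (pderiv (Sum.inr j) p) τ ω))) τ := by
  set q := eval (curve z s ω τ) (normSqPoly n) with hqdef
  have hQ := hasDerivAt_eval (normSqPoly n) (hasDerivAt_curve z s ω τ)
  have hp := hasDerivAt_eval p (hasDerivAt_curve z s ω τ)
  have hE := (hQ.const_mul (κ : ℂ)).cexp
  have hZ := (hasDerivAt_zpow (-k) q (Or.inl hq)).comp τ hQ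
  have hph := ((hasDerivAt_id τ).const_mul (2 * Complex.I * κ * (s * symp z ω))).cexp
  have h := ((hE.mul hZ).mul hp).mul hph
  refine h.congr_deriv ?_
  simp only [Pi.mul_apply, Function.comp_apply, id, mul_one, ← hqdef, Fintype.sum_sum_type,
    pderiv_inl_normSqPoly, pderiv_inr_normSqPoly, eval_X, bicoords_inl, bicoords_inr]
  have hs : 2 * Complex.I * (κ : ℂ) * (s * symp z ω) = -κ * ∑ j, (z j * curve z s ω τ (Sum.inr j) -
      (starRingEnd ℂ) (z j) * curve z s ω τ (Sum.inl j)) := by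
    have := two_I_mul_symp z ω
    have e : ∑ j, (z j * curve z s ω τ (Sum.inr j) -
      (starRingEnd ℂ) (z j) * curve z s ω τ (Sum.inl j)) = -s * (∑ j, (z j * (starRingEnd ℂ) (ω j) -
        (starRingEnd ℂ) (z j) * ω j)) := by
      rw [Finset.mul_sum]
      refine Finset.sum_congr rfl fun j _ => ?_
      simp only [curve, bicoords_inl, bicoords_inr]
      ring
    rw [e, ← this]
    ring
  set W := Complex.exp (2 * Complex.I * κ * (s * symp z ω) * τ) with hW
  rw [hs]
  have hz1 : q ^ (-(k + 1)) = q ^ (-k) / q := by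
    rw [neg_add, ← sub_eq_add_neg, zpow_sub_one₀ hq]; rfl
  have hz2 : q ^ (-(k - 1)) = q ^ (-k) * q := by
    rw [neg_sub, sub_eq_add_neg, add_comm, zpow_add_one₀ hq]
  have hz3 : q ^ (-k - 1) = q ^ (-k) / q := by rw [zpow_sub_one₀ hq]; rfl
  simp only [modelIntegrand, modelC, ← hqdef, ← hW, hz1, hz2, hz3, map_add, map_mul, eval_X,
    MvPolynomial.smul_eval]
  simp only [← Finset.sum_add_distrib, Finset.mul_sum, Finset.sum_mul]
  refine Finset.sum_congr rfl fun j _ => ?_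
  push_cast
  field_simp
  ring

lemma continuousOn_modelIntegrand (κ : ℝ) (z : Cn n) (s : ℝ) (k : ℤ)
    (p : MvPolynomial (Fin n ⊕ Fin n) ℂ) {U : Set (ℂ × Metric.sphere (0 : Cn n) 1)}
    (hU : ∀ x ∈ U, eval (curve z s x.2 x.1) (normSqPoly n) ≠ 0) :
    ContinuousOn (fun x : ℂ × Metric.sphere (0 : Cn n) 1 => modelIntegrand κ z s k p x.1 x.2) U := by
  have hc : ∀ r : MvPolynomial (Fin n ⊕ Fin n) ℂ,
      Continuous fun x : ℂ × Metric.sphere (0 : Cn n) 1 => eval (curve z s x.2 x.1) r := by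
    intro r
    have h1 : Continuous fun x : ℂ × Metric.sphere (0 : Cn n) 1 => curve z s x.2 x.1 := by
      refine continuous_pi fun i => ?_
      have := (continuous_bicoords_apply (n := n) i).comp
        (continuous_subtype_val.comp (continuous_snd (X := ℂ) (Y := Metric.sphere (0 : Cn n) 1)))
      unfold curve
      exact (continuous_fst.mul continuous_const).sub (continuous_const.mul this)
    exact (MvPolynomial.continuous_eval r).comp h1
  have hsy : Continuous fun x : ℂ × Metric.sphere (0 : Cn n) 1 => symp z x.2 :=
    continuous_symp.comp
      (continuous_const.prodMk (continuous_subtype_val.comp continuous_snd))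
  unfold modelIntegrand modelC
  refine ContinuousOn.mul (ContinuousOn.mul (ContinuousOn.mul ?_ ?_) (hc p).continuousOn) ?_
  · exact (Complex.continuous_exp.comp
      (continuous_const.mul (hc (normSqPoly n)))).continuousOn
  · exact (hc _).continuousOn.zpow₀ _ fun x hx => Or.inl (hU x hx)
  · refine (Complex.continuous_exp.comp (Continuous.mul (continuous_const.mul
      (continuous_const.mul (Complex.continuous_ofReal.comp hsy))) continuous_fst)).continuousOn

/-- The value is a real quadratic in `τ` that factors as `(s - τw)(s - τw̄)` with `|w| = |z|`, hence
has no zero for `|τ||z| < s`. Here `w = x.re + iy` with `y` chosen to give `w` the norm of `z`. -/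
lemma eval_curve_normSqPoly_ne_zero {z : Cn n} {s : ℝ} (hs : 0 < s) {τ : ℂ}
    (hτ : ‖τ‖ * ‖z‖ < s) (ω : Metric.sphere (0 : Cn n) 1) :
    eval (curve z s ω τ) (normSqPoly n) ≠ 0 := by
  have hω : ‖(ω : Cn n)‖ = 1 := by simp
  set x : ℂ := inner ℂ (ω : Cn n) z with hx
  have hxz : x.re ^ 2 ≤ ‖z‖ ^ 2 := by
    have h1 : ‖x‖ ≤ ‖z‖ := by simpa [hω] using norm_inner_le_norm (𝕜 := ℂ) (ω : Cn n) z
    have h2 := Complex.abs_re_le_norm x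
    rw [← sq_abs]
    exact pow_le_pow_left₀ (abs_nonneg _) (h2.trans h1) 2
  have hn2 : ∀ u : Cn n, ∑ j, u j * (starRingEnd ℂ) (u j) = ((‖u‖ ^ 2 : ℝ) : ℂ) := by
    intro u
    rw [EuclideanSpace.norm_sq_eq]
    push_cast
    exact Finset.sum_congr rfl fun j _ => by rw [Complex.mul_conj']
  have hxe : ∑ j, z j * (starRingEnd ℂ) ((ω : Cn n) j) = x := by
    rw [hx, PiLp.inner_apply]; simp
  have hxe' : ∑ j, (starRingEnd ℂ) (z j) * (ω : Cn n) j = (starRingEnd ℂ) x := by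
    rw [← hxe]; simp [map_sum]
  have hval : eval (curve z s ω τ) (normSqPoly n) =
      τ ^ 2 * (‖z‖ ^ 2 : ℝ) - 2 * s * τ * x.re + s ^ 2 := by
    have h1 : eval (curve z s ω τ) (normSqPoly n) = τ ^ 2 * ∑ j, z j * (starRingEnd ℂ) (z j) -
        s * τ * (∑ j, z j * (starRingEnd ℂ) ((ω : Cn n) j)) -
        s * τ * (∑ j, (starRingEnd ℂ) (z j) * (ω : Cn n) j) +
        s ^ 2 * ∑ j, (ω : Cn n) j * (starRingEnd ℂ) ((ω : Cn n) j) := by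
      simp only [normSqPoly, map_sum, map_mul, eval_X, curve, bicoords_inl, bicoords_inr,
        Finset.mul_sum, ← Finset.sum_sub_distrib, ← Finset.sum_add_distrib]
      exact Finset.sum_congr rfl fun j _ => by ring
    rw [h1, hn2, hn2, hxe, hxe', hω]
    have := Complex.add_conj x
    push_cast at this ⊢
    linear_combination (-s * τ) * this
  rw [hval]
  set y := Real.sqrt (‖z‖ ^ 2 - x.re ^ 2) with hy
  have hy2 : y ^ 2 = ‖z‖ ^ 2 - x.re ^ 2 := Real.sq_sqrt (by linarith)
  have hy2' : (y : ℂ) ^ 2 = (‖z‖ ^ 2 : ℝ) - (x.re : ℂ) ^ 2 := by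
    rw [← Complex.ofReal_pow, hy2]; push_cast; ring
  have hfac : τ ^ 2 * (‖z‖ ^ 2 : ℝ) - 2 * s * τ * x.re + s ^ 2 =
      (s - τ * (x.re + y * Complex.I)) * (s - τ * (x.re - y * Complex.I)) := by
    linear_combination (-τ ^ 2) * hy2' + (τ ^ 2 * y ^ 2) * Complex.I_sq
  rw [hfac]
  have hne : ∀ w : ℂ, ‖w‖ = ‖z‖ → (s : ℂ) - τ * w ≠ 0 := by
    intro w hw h0
    have h1 : ‖τ * w‖ = s := by
      rw [← sub_eq_zero.1 h0, Complex.norm_real, Real.norm_of_nonneg hs.le]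
    rw [norm_mul, hw] at h1
    linarith
  have hnorm : ∀ y' : ℝ, y' ^ 2 = y ^ 2 → ‖(x.re : ℂ) + y' * Complex.I‖ = ‖z‖ := by
    intro y' hy'
    rw [Complex.norm_add_mul_I, hy', hy2, add_sub_cancel, Real.sqrt_sq (norm_nonneg _)]
  refine mul_ne_zero (hne _ (hnorm y rfl)) (hne _ ?_)
  have := hnorm (-y) (by ring)
  rwa [Complex.ofReal_neg, neg_mul, ← sub_eq_add_neg] at this

end model

/-- Iterating the closure property shows that every derivative at `0` vanishes, so the Taylor series
on the disc is zero. -/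
lemma eq_zero_of_family_closed_under_deriv {𝓕 : Set (ℂ → ℂ)} {T : ℝ} (hT : 0 < T)
    (h0 : ∀ g ∈ 𝓕, g 0 = 0)
    (hd : ∀ g ∈ 𝓕, ∃ g' ∈ 𝓕, ∀ τ ∈ Metric.ball (0 : ℂ) T, HasDerivAt g (g' τ) τ)
    {g : ℂ → ℂ} (hg : g ∈ 𝓕) {τ : ℂ} (hτ : τ ∈ Metric.ball (0 : ℂ) T) : g τ = 0 := by
  have key : ∀ N : ℕ, ∀ g ∈ 𝓕, iteratedDeriv N g 0 = 0 := by
    intro N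
    induction N with
    | zero => intro g hg; simpa using h0 g hg
    | succ N ih =>
      intro g hg
      obtain ⟨g', hg', h⟩ := hd g hg
      rw [iteratedDeriv_succ']
      have : deriv g =ᶠ[nhds 0] g' := by
        filter_upwards [Metric.ball_mem_nhds (0 : ℂ) hT] with t ht using (h t ht).deriv
      rw [this.iteratedDeriv_eq, ih g' hg']
  obtain ⟨g', -, h⟩ := hd g hg
  have hdiff : DifferentiableOn ℂ g (Metric.ball 0 T) := fun t ht =>
    (h t ht).differentiableAt.differentiableWithinAt
  have hs := Complex.hasSum_taylorSeries_on_ball hdiff hτ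
  simp only [key _ g hg, smul_zero] at hs
  exact hs.unique hasSum_zero

lemma integral_six {α : Type*} [MeasurableSpace α] {ν : Measure α} {f₁ f₂ f₃ f₄ f₅ f₆ : α → ℂ}
    (h₁ : Integrable f₁ ν) (h₂ : Integrable f₂ ν) (h₃ : Integrable f₃ ν) (h₄ : Integrable f₄ ν)
    (h₅ : Integrable f₅ ν) (h₆ : Integrable f₆ ν) (c d c₁ c₂ c₃ c₄ c₅ c₆ : ℂ) :
    Integrable (fun x => c * (c₁ * f₁ x + c₂ * f₂ x) +
      d * (c₃ * f₃ x + c₄ * f₄ x + c₅ * f₅ x + c₆ * f₆ x)) ν ∧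
    ∫ x, (c * (c₁ * f₁ x + c₂ * f₂ x) + d * (c₃ * f₃ x + c₄ * f₄ x + c₅ * f₅ x + c₆ * f₆ x)) ∂ν =
      c * (c₁ * (∫ x, f₁ x ∂ν) + c₂ * ∫ x, f₂ x ∂ν) +
      d * (c₃ * (∫ x, f₃ x ∂ν) + c₄ * (∫ x, f₄ x ∂ν) + c₅ * (∫ x, f₅ x ∂ν) +
        c₆ * ∫ x, f₆ x ∂ν) := by
  have k₁ := h₁.const_mul c₁
  have k₂ := h₂.const_mul c₂
  have k₃ := h₃.const_mul c₃
  have k₄ := h₄.const_mul c₄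
  have k₅ := h₅.const_mul c₅
  have k₆ := h₆.const_mul c₆
  refine ⟨((k₁.add k₂).const_mul c).add ((((k₃.add k₄).add k₅).add k₆).const_mul d), ?_⟩
  have e0 := integral_add ((k₁.add k₂).const_mul c) ((((k₃.add k₄).add k₅).add k₆).const_mul d)
  have e1 := integral_add k₁ k₂
  have e2 := integral_add ((k₃.add k₄).add k₅) k₆
  have e3 := integral_add (k₃.add k₄) k₅
  have e4 := integral_add k₃ k₄
  simp only [Pi.add_apply, integral_const_mul] at e0 e1 e2 e3 e4 ⊢
  rw [e0, e1, e2, e3, e4]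

/-! ### Vanishing of the twisted means of the model functions -/

section modelmean

open MvPolynomial

variable {n : ℕ}

lemma integral_harm_eq_zero (hn : 1 ≤ n) {a b : ℕ} {p : MvPolynomial (Fin n ⊕ Fin n) ℂ}
    (hp : IsHarm (a + 1) b p) :
    ∫ ω : Metric.sphere (0 : Cn n) 1, evalBi p ω ∂(unitSphereMeasure n) = 0 := by
  have h := integral_bihom_mul_conj_harm_eq_zero hn isBihom_one hp (Nat.succ_pos a)
  simp only [evalBi_one, one_mul] at h
  rw [integral_conj] at h
  exact (map_eq_zero _).1 h

lemma modelC_bicoords (κ : ℝ) (k : ℤ) (p : MvPolynomial (Fin n ⊕ Fin n) ℂ) (u : Cn n) :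
    modelC κ k p (bicoords u) =
      ((Real.exp (κ * ‖u‖ ^ 2) * (‖u‖ ^ 2) ^ (-k) : ℝ) : ℂ) * evalBi p u := by
  have h := evalBi_normSqPoly u
  rw [evalBi] at h
  rw [modelC, h, evalBi]
  push_cast
  rfl

lemma curve_zero (z : Cn n) (s : ℝ) (ω : Cn n) :
    curve z s ω 0 = bicoords ((-s) • ω) := by
  ext i
  rcases i with j | j <;> simp [curve]

lemma curve_one (z : Cn n) (s : ℝ) (ω : Cn n) :
    curve z s ω 1 = bicoords (z - s • ω) := by
  ext i
  rcases i with j | j <;> simp [curve]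

/-- At `τ = 0` the sphere is centred at the origin: the radial factor and the phase are constant,
and `p` has mean zero. -/
lemma modelMean_zero (hn : 1 ≤ n) (κ : ℝ) (z : Cn n) (s : ℝ) (k : ℤ) {a b : ℕ}
    {p : MvPolynomial (Fin n ⊕ Fin n) ℂ} (hp : IsHarm (a + 1) b p) :
    modelMean κ z s k p 0 = 0 := by
  have h : ∀ ω : Metric.sphere (0 : Cn n) 1, modelIntegrand κ z s k p 0 ω =
      ((Real.exp (κ * s ^ 2) * (s ^ 2) ^ (-k) : ℝ) : ℂ) * ((-s : ℝ) : ℂ) ^ (a + 1 + b) *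
        evalBi p ω := by
    intro ω
    rw [modelIntegrand, curve_zero, modelC_bicoords, hp.toIsBihom.eval_smul]
    have : ‖(-s) • (ω : Cn n)‖ ^ 2 = s ^ 2 := by simp [norm_smul]
    rw [this, mul_zero, Complex.exp_zero]
    ring
  rw [modelMean]
  simp_rw [h]
  rw [integral_const_mul, integral_harm_eq_zero hn hp, mul_zero]

lemma modelMean_zero_poly (κ : ℝ) (z : Cn n) (s : ℝ) (k : ℤ) :
    modelMean κ z s k (0 : MvPolynomial (Fin n ⊕ Fin n) ℂ) = 0 := by
  ext τ
  simp [modelMean, modelIntegrand, modelC]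

/-- The span of the twisted means of the model functions. -/
noncomputable def modelSpan (κ : ℝ) (z : Cn n) (s : ℝ) : Submodule ℂ (ℂ → ℂ) :=
  Submodule.span ℂ {g | ∃ (a b : ℕ) (k : ℤ) (p : MvPolynomial (Fin n ⊕ Fin n) ℂ),
    IsHarm (a + 1) b p ∧ (n + b : ℤ) ≤ k ∧ k ≤ n + a + b ∧ g = modelMean κ z s k p}

/-- The window `n+b ≤ k ≤ n+a+b` is stable. Raising `b` comes with `k+1`, raising `a` with `k` or
`k+1`, lowering `b` with `k-1`. Lowering `a` or `b` at fixed `k` leaves the window only when `k =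
n+a+b`, and there the coefficient `1 - k/m` is zero. -/
lemma hasDerivAt_modelMean (hn : 1 ≤ n) {κ : ℝ} {z : Cn n} {s : ℝ} (hs : 0 < s) {a b : ℕ} {k : ℤ}
    {p : MvPolynomial (Fin n ⊕ Fin n) ℂ} (hp : IsHarm (a + 1) b p) (hk1 : (n + b : ℤ) ≤ k)
    (hk2 : k ≤ n + a + b) :
    ∃ g' ∈ modelSpan κ z s, ∀ τ : ℂ, ‖τ‖ * ‖z‖ < s →
      HasDerivAt (modelMean κ z s k p) (g' τ) τ := by
  set m : ℂ := ((n + a + b : ℕ) : ℂ) with hmdef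
  have hm0 : n + a + b ≠ 0 := by omega
  have hm : m ≠ 0 := Nat.cast_ne_zero.2 hm0
  set hR : Fin n → MvPolynomial (Fin n ⊕ Fin n) ℂ := fun j =>
    X (Sum.inr j) * p + (-m⁻¹) • (normSqPoly n * pderiv (Sum.inl j) p) with hRdef
  set hL : Fin n → MvPolynomial (Fin n ⊕ Fin n) ℂ := fun j =>
    X (Sum.inl j) * p + (-m⁻¹) • (normSqPoly n * pderiv (Sum.inr j) p) with hLdef
  have hRh : ∀ j, IsHarm (a + 1) (b + 1) (hR j) := fun j => hp.raise_right hm0 j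
  have hLh : ∀ j, IsHarm (a + 2) b (hL j) := fun j => hp.raise_left hm0 j
  have hcoef : k = n + a + b → (1 - (k : ℂ) / m) = 0 := by
    intro h
    rw [h, hmdef]
    push_cast
    have : ((n : ℂ) + a + b) ≠ 0 := by rw [hmdef] at hm; exact_mod_cast hm
    rw [div_self this, sub_self]
  have m1 : ∀ j, modelMean κ z s (k + 1) (hR j) ∈ modelSpan κ z s := fun j =>
    Submodule.subset_span ⟨a, b + 1, k + 1, _, hRh j, by push_cast; omega, by push_cast; omega, rfl⟩
  have m2 : ∀ j, (1 - k / m) • modelMean κ z s k (pderiv (Sum.inl j) p) ∈ modelSpan κ z s := by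
    intro j
    by_cases h : k = n + a + b
    · rw [hcoef h, zero_smul]; exact Submodule.zero_mem _
    -- For `a = 0` the window would force `k = n+b = n+a+b`. So the lowered polynomial still has
    -- positive degree in `z`.
    · obtain ⟨a', rfl⟩ : ∃ a', a = a' + 1 := ⟨a - 1, by omega⟩
      exact Submodule.smul_mem _ _ (Submodule.subset_span
        ⟨a', b, k, _, hp.pderiv_inl j, hk1, by push_cast at hk2 h ⊢; omega, rfl⟩)
  have m3 : ∀ j, modelMean κ z s k (hL j) ∈ modelSpan κ z s := fun j =>
    Submodule.subset_span ⟨a + 1, b, k, _, hLh j, hk1, by push_cast; omega, rfl⟩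
  have m4 : ∀ j, modelMean κ z s (k - 1) (pderiv (Sum.inr j) p) ∈ modelSpan κ z s := by
    intro j
    rcases b with _ | b
    · rw [hp.toIsBihom.pderiv_inr_eq_zero, modelMean_zero_poly]; exact Submodule.zero_mem _
    · exact Submodule.subset_span ⟨a, b, k - 1, _, hp.pderiv_inr j, by push_cast at hk1; omega,
        by push_cast at hk2; omega, rfl⟩
  have m5 : ∀ j, modelMean κ z s (k + 1) (hL j) ∈ modelSpan κ z s := fun j =>
    Submodule.subset_span ⟨a + 1, b, k + 1, _, hLh j, by omega, by push_cast; omega, rfl⟩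
  have m6 : ∀ j, (1 - k / m) • modelMean κ z s k (pderiv (Sum.inr j) p) ∈ modelSpan κ z s := by
    intro j
    by_cases h : k = n + a + b
    · rw [hcoef h, zero_smul]; exact Submodule.zero_mem _
    rcases b with _ | b
    · rw [hp.toIsBihom.pderiv_inr_eq_zero, modelMean_zero_poly, smul_zero]
      exact Submodule.zero_mem _
    · exact Submodule.smul_mem _ _ (Submodule.subset_span
        ⟨a, b, k, _, hp.pderiv_inr j, by push_cast at hk1; omega,
          by push_cast at hk2 h; omega, rfl⟩)
  refine ⟨∑ j, (z j • ((-k : ℂ) • modelMean κ z s (k + 1) (hR j) +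
      (1 - k / m) • modelMean κ z s k (pderiv (Sum.inl j) p)) +
    (starRingEnd ℂ) (z j) • ((2 * κ : ℂ) • modelMean κ z s k (hL j) +
      (2 * κ / m : ℂ) • modelMean κ z s (k - 1) (pderiv (Sum.inr j) p) +
      (-k : ℂ) • modelMean κ z s (k + 1) (hL j) +
      (1 - k / m) • modelMean κ z s k (pderiv (Sum.inr j) p))), ?_, ?_⟩
  · refine Submodule.sum_mem _ fun j _ => Submodule.add_mem _ (Submodule.smul_mem _ _
      (Submodule.add_mem _ (Submodule.smul_mem _ _ (m1 j)) (m2 j))) (Submodule.smul_mem _ _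
      (Submodule.add_mem _ (Submodule.add_mem _ (Submodule.add_mem _
        (Submodule.smul_mem _ _ (m3 j)) (Submodule.smul_mem _ _ (m4 j)))
        (Submodule.smul_mem _ _ (m5 j))) (m6 j)))
  · intro τ hτ
    set U : Set ℂ := {τ | ‖τ‖ * ‖z‖ < s} with hU
    have hUo : IsOpen U := isOpen_lt (by fun_prop) continuous_const
    have hne : ∀ τ ∈ U, ∀ ω : Metric.sphere (0 : Cn n) 1,
        eval (curve z s ω τ) (normSqPoly n) ≠ 0 := fun τ hτ ω =>
      eval_curve_normSqPoly_ne_zero hs hτ ω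
    have hco : ∀ k p, ContinuousOn (fun x : ℂ × Metric.sphere (0 : Cn n) 1 =>
        modelIntegrand κ z s k p x.1 x.2) (U ×ˢ Set.univ) := fun k p =>
      continuousOn_modelIntegrand κ z s k p fun x hx => hne x.1 hx.1 x.2
    have hc : ∀ k p, ∀ τ ∈ U, Continuous fun ω : Metric.sphere (0 : Cn n) 1 =>
        modelIntegrand κ z s k p τ ω := by
      intro k p τ hτ
      have h1 : ContinuousOn (fun ω : Metric.sphere (0 : Cn n) 1 => (τ, ω)) Set.univ := by fun_prop
      have h2 := (hco k p).comp h1 fun ω _ => ⟨hτ, trivial⟩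
      rwa [continuousOn_univ] at h2
    have hi : ∀ k p, Integrable (fun ω : Metric.sphere (0 : Cn n) 1 =>
        modelIntegrand κ z s k p τ ω) (unitSphereMeasure n) := fun k p =>
      integrable_sphere (hc k p τ hτ)
    have h := hasDerivAt_integral_of_compact (unitSphereMeasure n) hUo
      (F := fun τ ω => modelIntegrand κ z s k p τ ω) (fun τ hτ => hc k p τ hτ)
      (F' := fun τ ω => ∑ j, (z j * (-k * modelIntegrand κ z s (k + 1) (hR j) τ ω +
            (1 - k / m) * modelIntegrand κ z s k (pderiv (Sum.inl j) p) τ ω) +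
        (starRingEnd ℂ) (z j) * (2 * κ * modelIntegrand κ z s k (hL j) τ ω +
            2 * κ / m * modelIntegrand κ z s (k - 1) (pderiv (Sum.inr j) p) τ ω +
            -k * modelIntegrand κ z s (k + 1) (hL j) τ ω +
            (1 - k / m) * modelIntegrand κ z s k (pderiv (Sum.inr j) p) τ ω))) (by
        refine continuousOn_finsetSum _ fun j _ => ?_
        refine ContinuousOn.add (continuousOn_const.mul ?_) (continuousOn_const.mul ?_)
        · exact (continuousOn_const.mul (hco _ _)).add (continuousOn_const.mul (hco _ _))
        · exact (((continuousOn_const.mul (hco _ _)).add (continuousOn_const.mul (hco _ _))).add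
            (continuousOn_const.mul (hco _ _))).add (continuousOn_const.mul (hco _ _)))
      (fun τ hτ ω => hasDerivAt_modelIntegrand hm (hne τ hτ ω)) (x := τ) hτ
    refine h.congr_deriv ?_
    rw [integral_finsetSum _ fun j _ => (integral_six (hi _ _) (hi _ _) (hi _ _) (hi _ _) (hi _ _)
      (hi _ _) _ _ _ _ _ _ _ _).1, Finset.sum_apply]
    refine Finset.sum_congr rfl fun j _ => ?_
    rw [(integral_six (hi _ _) (hi _ _) (hi _ _) (hi _ _) (hi _ _) (hi _ _) _ _ _ _ _ _ _ _).2]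
    simp only [Pi.add_apply, Pi.smul_apply, smul_eq_mul, modelMean]

/-- The twisted mean is the model mean at `τ = 1`. Since `|z| < s`, this point is interior to a disc
on which the model means are holomorphic, and `modelSpan` satisfies the hypotheses of the Taylor
argument. -/
lemma twist_model_eq_zero (hn : 1 ≤ n) (κ : ℝ) {z : Cn n} {s : ℝ} (hz : ‖z‖ < s) {a b : ℕ} {k : ℤ}
    {p : MvPolynomial (Fin n ⊕ Fin n) ℂ} (hp : IsHarm (a + 1) b p) (hk1 : (n + b : ℤ) ≤ k)
    (hk2 : k ≤ n + a + b) :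
    twist κ (fun u => ((Real.exp (κ * ‖u‖ ^ 2) * (‖u‖ ^ 2) ^ (-k) : ℝ) : ℂ) * evalBi p u) z s = 0 := by
  have hs : 0 < s := (norm_nonneg z).trans_lt hz
  obtain ⟨T, hT1, hT⟩ : ∃ T : ℝ, 1 < T ∧ T * ‖z‖ < s := by
    by_cases h : ‖z‖ = 0
    · exact ⟨2, by norm_num, by rw [h]; simpa using hs⟩
    · have hpos : 0 < ‖z‖ := lt_of_le_of_ne (norm_nonneg _) (Ne.symm h)
      obtain ⟨T, h1, h2⟩ := exists_between ((one_lt_div hpos).2 hz)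
      exact ⟨T, h1, (lt_div_iff₀ hpos).1 h2⟩
  have hball : ∀ τ ∈ Metric.ball (0 : ℂ) T, ‖τ‖ * ‖z‖ < s := fun τ hτ =>
    (mul_le_mul_of_nonneg_right (mem_ball_zero_iff.1 hτ).le (norm_nonneg _)).trans_lt hT
  have h0 : ∀ g ∈ (modelSpan κ z s : Set (ℂ → ℂ)), g 0 = 0 := by
    intro g hg
    induction hg using Submodule.span_induction with
    | mem g h =>
      obtain ⟨a, b, k, p, hp, -, -, rfl⟩ := h
      exact modelMean_zero hn κ z s k hp
    | zero => rfl
    | add f g _ _ hf hg => simp [hf, hg]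
    | smul c f _ hf => simp [hf]
  have hd : ∀ g ∈ (modelSpan κ z s : Set (ℂ → ℂ)), ∃ g' ∈ (modelSpan κ z s : Set (ℂ → ℂ)),
      ∀ τ ∈ Metric.ball (0 : ℂ) T, HasDerivAt g (g' τ) τ := by
    intro g hg
    induction hg using Submodule.span_induction with
    | mem g h =>
      obtain ⟨a, b, k, p, hp, hk1, hk2, rfl⟩ := h
      obtain ⟨g', hg', h⟩ := hasDerivAt_modelMean hn hs hp hk1 hk2 (κ := κ) (z := z)
      exact ⟨g', hg', fun τ hτ => h τ (hball τ hτ)⟩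
    | zero => exact ⟨0, Submodule.zero_mem _, fun τ _ => hasDerivAt_const τ 0⟩
    | add f g _ _ hf hg =>
      obtain ⟨f', hf', h1⟩ := hf
      obtain ⟨g', hg', h2⟩ := hg
      exact ⟨f' + g', Submodule.add_mem _ hf' hg', fun τ hτ => (h1 τ hτ).add (h2 τ hτ)⟩
    | smul c f _ hf =>
      obtain ⟨f', hf', h1⟩ := hf
      exact ⟨c • f', Submodule.smul_mem _ c hf', fun τ hτ => (h1 τ hτ).const_smul c⟩
  have h := eq_zero_of_family_closed_under_deriv (zero_lt_one.trans hT1) h0 hd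
    (Submodule.subset_span ⟨a, b, k, p, hp, hk1, hk2, rfl⟩) (τ := 1) (by simpa using hT1)
  rw [modelMean] at h
  rw [twist, ← h]
  refine integral_congr_ae (Filter.Eventually.of_forall fun ω => ?_)
  simp only [modelIntegrand, curve_one, modelC_bicoords, mul_one]

end modelmean

/-! ### Reduction to harmonic components -/

section projection

variable {n : ℕ}

/-- Polar coordinates about `z`: averaging the twisted means over the radius gives an integral of
`g` against a function on `ℂⁿ`, where Parseval on spheres about the origin applies. -/
lemma twist_pairing (hn : 1 ≤ n) (κ : ℝ) (z : Cn n) {g : Cn n → ℂ} {ψ : ℝ → ℝ}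
    (hg : Integrable fun u : Cn n => g u *
      ((ψ ‖z - u‖ : ℂ) * Complex.exp (2 * Complex.I * κ * (symp z (z - u) : ℂ)))) :
    ∫ u, g u * ((ψ ‖z - u‖ : ℂ) * Complex.exp (2 * Complex.I * κ * (symp z (z - u) : ℂ))) =
      sphereArea n • ∫ σ in Set.Ioi (0 : ℝ), ψ σ • (σ ^ (2 * n - 1) • twist κ g z σ) := by
  rw [← integral_sub_left_eq_self _ volume z, integral_polar hn (hg.comp_sub_left z)]
  congr 1
  refine setIntegral_congr_fun measurableSet_Ioi fun σ hσ => ?_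
  have hσ' : (0 : ℝ) < σ := hσ
  rw [smul_comm, twist]
  congr 1
  rw [← integral_smul]
  refine integral_congr_ae (Filter.Eventually.of_forall fun ω => ?_)
  have hω : ‖σ • (ω : Cn n)‖ = σ := by simp [norm_smul, abs_of_pos hσ']
  simp only [sub_sub_cancel, hω, symp_smul_right, Complex.real_smul]
  push_cast
  ring

lemma continuous_smul_sphere_apply {E : Type*} [TopologicalSpace E] {F : Cn n → E}
    (hF : Continuous F) :
    Continuous fun x : ℝ × Metric.sphere (0 : Cn n) 1 => F (x.1 • (x.2 : Cn n)) :=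
  hF.comp (continuous_fst.smul (continuous_subtype_val.comp continuous_snd))

lemma continuous_conj_evalBi_sphere (p : MvPolynomial (Fin n ⊕ Fin n) ℂ) :
    Continuous fun x : ℝ × Metric.sphere (0 : Cn n) 1 =>
      (starRingEnd ℂ) (evalBi p (x.2 : Cn n)) :=
  Complex.continuous_conj.comp ((continuous_evalBi p).comp
    (continuous_subtype_val.comp continuous_snd))

lemma continuous_sphCoeff {g : Cn n → ℂ} (hg : Continuous g)
    (p : MvPolynomial (Fin n ⊕ Fin n) ℂ) : Continuous (sphCoeff g (evalBi p)) := by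
  have h : Continuous (Function.uncurry fun (ρ : ℝ) (ω : Metric.sphere (0 : Cn n) 1) =>
      g (ρ • (ω : Cn n)) * (starRingEnd ℂ) (evalBi p (ω : Cn n))) :=
    (continuous_smul_sphere_apply hg).mul (continuous_conj_evalBi_sphere p)
  exact continuous_integral_sphere h

lemma continuous_twist {g : Cn n → ℂ} (hg : Continuous g) (κ : ℝ) (z : Cn n) :
    Continuous (twist κ g z) := by
  have h : Continuous (Function.uncurry fun (s : ℝ) (ω : Metric.sphere (0 : Cn n) 1) =>
      g (z - s • (ω : Cn n)) * Complex.exp (2 * Complex.I * κ * (s * symp z ω))) := by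
    have hsy : Continuous fun x : ℝ × Metric.sphere (0 : Cn n) 1 => symp z x.2 :=
      continuous_symp.comp
        (continuous_const.prodMk (continuous_subtype_val.comp continuous_snd))
    refine (continuous_smul_sphere_apply (F := fun u => g (z - u)) (by fun_prop)).mul
      (Complex.continuous_exp.comp (continuous_const.mul
        ((Complex.continuous_ofReal.comp continuous_fst).mul
          (Complex.continuous_ofReal.comp hsy))))
  exact continuous_integral_sphere h

/-- The component of `g` along the bigraded solid harmonic `Q`. -/
noncomputable def harmComponent (a b : ℕ) (g Q : Cn n → ℂ) (u : Cn n) : ℂ :=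
  sphCoeffTilde a b g Q ‖u‖ * Q u

lemma harmComponent_smul {a b : ℕ} {p : MvPolynomial (Fin n ⊕ Fin n) ℂ} (hp : IsBihom a b p)
    (g : Cn n → ℂ) {ρ : ℝ} (hρ : 0 < ρ) (ω : Metric.sphere (0 : Cn n) 1) :
    harmComponent a b g (evalBi p) (ρ • (ω : Cn n)) = sphCoeff g (evalBi p) ρ * evalBi p ω := by
  have hω : ‖ρ • (ω : Cn n)‖ = ρ := by simp [norm_smul, abs_of_pos hρ]
  rw [harmComponent, hω, hp.eval_smul, sphCoeffTilde]
  have : (ρ : ℂ) ≠ 0 := by exact_mod_cast hρ.ne'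
  have h2 : ((ρ ^ (-((a : ℤ) + b)) : ℝ) : ℂ) * (ρ : ℂ) ^ (a + b) = 1 := by
    push_cast
    rw [← zpow_natCast, ← zpow_add₀ this]
    simp
  linear_combination (sphCoeff g (evalBi p) ρ * evalBi p ω) * h2

/-- The negative power of `|u|` may be singular at the origin, but `χ` vanishes nearby. -/
lemma continuous_harmComponent_mul {a b : ℕ} (p : MvPolynomial (Fin n ⊕ Fin n) ℂ)
    {g χ : Cn n → ℂ} (hg : Continuous g) (hχ : Continuous χ) {l : ℝ} (hl : 0 < l)
    (hl' : ∀ u, ‖u‖ < l → χ u = 0) :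
    Continuous fun u => harmComponent a b g (evalBi p) u * χ u := by
  rw [continuous_iff_continuousAt]
  intro u
  by_cases hu : u = 0
  · have : (fun u => harmComponent a b g (evalBi p) u * χ u) =ᶠ[nhds u] fun _ => 0 := by
      rw [hu]
      filter_upwards [Metric.ball_mem_nhds (0 : Cn n) hl] with v hv
      rw [hl' v (by simpa using hv), mul_zero]
    exact continuousAt_const.congr this.symm
  · refine ContinuousAt.mul (ContinuousAt.mul (ContinuousAt.mul ?_ ?_)
      (continuous_evalBi p).continuousAt) hχ.continuousAt
    · refine Complex.continuous_ofReal.continuousAt.comp ?_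
      exact continuousAt_id.norm.zpow₀ _ (Or.inl (norm_ne_zero_iff.2 hu))
    · exact ((continuous_sphCoeff hg p).comp continuous_norm).continuousAt

variable {pol : ∀ a b : ℕ, Fin (dimHarmonics n a b) → MvPolynomial (Fin n ⊕ Fin n) ℂ}

/-- On each sphere Parseval expands `∫ g χ` into the contributions of the components. Partial sums
are bounded uniformly in the radius, so the expansion may be integrated term by term. -/
lemma integral_mul_eq_zero_of_components (hn : 1 ≤ n) (hpol : ∀ a b j, IsHarm a b (pol a b j))
    (hP : ∀ a b, IsOrthonormalHarmonicBasis n a b fun j => evalBi (pol a b j))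
    {g χ : Cn n → ℂ} (hg : Continuous g) (hχ : Continuous χ) (hχc : HasCompactSupport χ)
    {l : ℝ} (hl : 0 < l) (hl' : ∀ u, ‖u‖ < l → χ u = 0)
    (h : ∀ a b j, ∫ u, harmComponent a b g (evalBi (pol a b j)) u * χ u = 0) :
    ∫ u, g u * χ u = 0 := by
  have hA := sphereArea_pos hn
  have hgχ : Integrable fun u => g u * χ u :=
    (hg.mul hχ).integrable_of_hasCompactSupport hχc.mul_left
  rw [integral_polar hn hgχ]
  obtain ⟨L, hL0, hL⟩ : ∃ L : ℝ, 0 < L ∧ ∀ u, L < ‖u‖ → χ u = 0 := by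
    obtain ⟨L, hL⟩ := hχc.isCompact.isBounded.subset_closedBall (0 : Cn n)
    refine ⟨max L 1, by positivity, fun u hu => ?_⟩
    by_contra hne
    have := hL (subset_tsupport _ hne)
    rw [mem_closedBall_zero_iff] at this
    linarith [le_max_left L 1]
  obtain ⟨M1, hM1⟩ := (isCompact_closedBall (0 : Cn n) L).exists_bound_of_continuousOn
    hg.continuousOn
  obtain ⟨M2, hM2⟩ := (isCompact_closedBall (0 : Cn n) L).exists_bound_of_continuousOn
    hχ.continuousOn
  set M := max M1 M2
  have hρc : ∀ {F : Cn n → ℂ}, Continuous F → ∀ ρ : ℝ,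
      Continuous fun ω : Metric.sphere (0 : Cn n) 1 => F (ρ • (ω : Cn n)) := fun hF ρ =>
    hF.comp (continuous_subtype_val.const_smul ρ)
  have hcY : ∀ i : HarmIndex n, Continuous fun ρ : ℝ =>
      ∫ ω, evalBi (pol i.1.1 i.1.2 i.2) ω * χ (ρ • (ω : Cn n)) ∂(unitSphereMeasure n) := by
    intro i
    have h : Continuous (Function.uncurry fun (ρ : ℝ) (ω : Metric.sphere (0 : Cn n) 1) =>
        evalBi (pol i.1.1 i.1.2 i.2) ω * χ (ρ • (ω : Cn n))) :=
      ((continuous_evalBi _).comp (continuous_subtype_val.comp continuous_snd)).mul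
        (continuous_smul_sphere_apply hχ)
    exact continuous_integral_sphere h
  have hterm : ∀ i : HarmIndex n, Continuous fun ρ : ℝ => ρ ^ (2 * n - 1) •
      (sphCoeff g (evalBi (pol i.1.1 i.1.2 i.2)) ρ *
      ∫ ω, evalBi (pol i.1.1 i.1.2 i.2) ω * χ (ρ • (ω : Cn n)) ∂(unitSphereMeasure n)) :=
    fun i => (continuous_id.pow _).smul ((continuous_sphCoeff hg _).mul (hcY i))
  have hzero : ∀ i : HarmIndex n, ∫ ρ in Set.Ioi (0 : ℝ), ρ ^ (2 * n - 1) •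
      (sphCoeff g (evalBi (pol i.1.1 i.1.2 i.2)) ρ *
      ∫ ω, evalBi (pol i.1.1 i.1.2 i.2) ω * χ (ρ • (ω : Cn n)) ∂(unitSphereMeasure n)) = 0 := by
    intro i
    have h1 := h i.1.1 i.1.2 i.2
    rw [integral_polar hn ((continuous_harmComponent_mul _ hg hχ hl hl').integrable_of_hasCompactSupport
      hχc.mul_left), smul_eq_zero_iff_right hA.ne'] at h1
    rw [← h1]
    refine setIntegral_congr_fun measurableSet_Ioi fun ρ hρ => ?_
    rw [← integral_const_mul]
    congr 1
    refine integral_congr_ae (Filter.Eventually.of_forall fun ω => ?_)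
    simp only []
    rw [harmComponent_smul (hpol _ _ _).toIsBihom g hρ, mul_assoc]
  have hlim : Filter.Tendsto (fun s : Finset (HarmIndex n) => ∫ ρ in Set.Ioi (0 : ℝ),
      ρ ^ (2 * n - 1) • ∑ i ∈ s, (sphCoeff g (evalBi (pol i.1.1 i.1.2 i.2)) ρ *
      ∫ ω, evalBi (pol i.1.1 i.1.2 i.2) ω * χ (ρ • (ω : Cn n)) ∂(unitSphereMeasure n)))
      Filter.atTop (nhds (∫ ρ in Set.Ioi (0 : ℝ), ρ ^ (2 * n - 1) •
        ∫ ω, g (ρ • (ω : Cn n)) * χ (ρ • (ω : Cn n)) ∂(unitSphereMeasure n))) := by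
    refine tendsto_integral_filter_of_dominated_convergence
      ((Set.Ioc 0 L).indicator fun _ => L ^ (2 * n - 1) * M ^ 2) ?_ ?_ ?_ ?_
    · refine Filter.Eventually.of_forall fun s => Continuous.aestronglyMeasurable ?_
      simp only [Finset.smul_sum]
      exact continuous_finsetSum _ fun i _ => hterm i
    · refine Filter.Eventually.of_forall fun s => ?_
      refine (ae_restrict_iff' measurableSet_Ioi).2 (Filter.Eventually.of_forall fun ρ hρ => ?_)
      have hρ0 : (0 : ℝ) < ρ := hρ
      have hω : ∀ ω : Metric.sphere (0 : Cn n) 1, ‖ρ • (ω : Cn n)‖ = ρ := fun ω => by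
        simp [norm_smul, abs_of_pos hρ0]
      by_cases hρL : ρ ≤ L
      · rw [Set.indicator_of_mem (show ρ ∈ Set.Ioc 0 L from ⟨hρ0, hρL⟩), norm_smul, Real.norm_of_nonneg (by positivity)]
        have hmem : ∀ ω : Metric.sphere (0 : Cn n) 1, ρ • (ω : Cn n) ∈ Metric.closedBall (0 : Cn n) L :=
          fun ω => by rw [mem_closedBall_zero_iff, hω]; exact hρL
        refine mul_le_mul (pow_le_pow_left₀ hρ0.le hρL _) ?_ (norm_nonneg _) (by positivity)
        exact sum_norm_sphere_le hn hpol hP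
          (g := fun ω => g (ρ • (ω : Cn n))) (h := fun ω => χ (ρ • (ω : Cn n)))
          (hρc hg ρ) (hρc hχ ρ) (fun ω => (hM1 _ (hmem ω)).trans (le_max_left _ _))
          (fun ω => (hM2 _ (hmem ω)).trans (le_max_right _ _)) s
      · rw [Set.indicator_of_notMem fun h => hρL h.2]
        have : ∀ ω : Metric.sphere (0 : Cn n) 1, χ (ρ • (ω : Cn n)) = 0 := fun ω =>
          hL _ (by rw [hω]; exact not_le.1 hρL)
        simp [this]
    · exact ((integrable_indicator_iff measurableSet_Ioc).2 (integrableOn_const (by simp))).restrict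
    · refine Filter.Eventually.of_forall fun ρ => Filter.Tendsto.const_smul ?_ _
      have := hasSum_sphere hn hpol hP (hρc hg ρ) (hρc hχ ρ)
      rwa [HasSum, SummationFilter.unconditional_filter] at this
  have hint : ∀ i : HarmIndex n, IntegrableOn (fun ρ : ℝ => ρ ^ (2 * n - 1) •
      (sphCoeff g (evalBi (pol i.1.1 i.1.2 i.2)) ρ *
      ∫ ω, evalBi (pol i.1.1 i.1.2 i.2) ω * χ (ρ • (ω : Cn n)) ∂(unitSphereMeasure n)))
      (Set.Ioi 0) := by
    intro i
    refine Integrable.integrableOn ((hterm i).integrable_of_hasCompactSupport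
      (HasCompactSupport.intro (isCompact_Icc (a := -L) (b := L)) fun ρ hρ => ?_))
    have : ∀ ω : Metric.sphere (0 : Cn n) 1, χ (ρ • (ω : Cn n)) = 0 := fun ω => by
      refine hL _ ?_
      simp only [norm_smul, norm_eq_of_mem_sphere, mul_one, Real.norm_eq_abs]
      by_contra hc
      exact hρ (abs_le.1 (not_lt.1 hc))
    simp [this]
  have hz : ∀ s : Finset (HarmIndex n), ∫ ρ in Set.Ioi (0 : ℝ),
      ρ ^ (2 * n - 1) • ∑ i ∈ s, (sphCoeff g (evalBi (pol i.1.1 i.1.2 i.2)) ρ *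
      ∫ ω, evalBi (pol i.1.1 i.1.2 i.2) ω * χ (ρ • (ω : Cn n)) ∂(unitSphereMeasure n)) = 0 := by
    intro s
    simp only [Finset.smul_sum]
    rw [integral_finsetSum _ fun i _ => hint i]
    exact Finset.sum_eq_zero fun i _ => hzero i
  simp only [hz] at hlim
  rw [tendsto_nhds_unique hlim tendsto_const_nhds, smul_zero]

/-- Harmonic expansions of continuous functions need not converge pointwise, hence the weak
formulation in the radius `σ`. Because `|z| < α`, the test function built from `ψ` vanishes near the
origin. -/
lemma twist_eq_zero_of_components (hn : 1 ≤ n) (hpol : ∀ a b j, IsHarm a b (pol a b j))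
    (hP : ∀ a b, IsOrthonormalHarmonicBasis n a b fun j => evalBi (pol a b j))
    {g : Cn n → ℂ} (hg : Continuous g) {κ : ℝ} {z : Cn n} {α β : ℝ} (hα : ‖z‖ < α)
    (h : ∀ a b j, ∀ σ ∈ Set.Ioo α β,
      twist κ (harmComponent a b g (evalBi (pol a b j))) z σ = 0) :
    ∀ σ ∈ Set.Ioo α β, twist κ g z σ = 0 := by
  have hα0 : 0 < α := (norm_nonneg z).trans_lt hα
  have hA := sphereArea_pos hn
  have hcont : Continuous fun σ : ℝ => σ ^ (2 * n - 1) • twist κ g z σ :=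
    (continuous_id.pow _).smul (continuous_twist hg κ z)
  have hae := isOpen_Ioo.ae_eq_zero_of_integral_contDiff_smul_eq_zero (μ := volume)
    (U := Set.Ioo α β) (f := fun σ : ℝ => σ ^ (2 * n - 1) • twist κ g z σ)
    (hcont.locallyIntegrable.locallyIntegrableOn _) (fun ψ hψ hψc hψs => by
      have hψ0 : ∀ σ, σ ∉ Set.Ioo α β → ψ σ = 0 := fun σ hσ => by
        by_contra hne
        exact hσ (hψs (subset_tsupport _ hne))
      set χ : Cn n → ℂ := fun u =>
        (ψ ‖z - u‖ : ℂ) * Complex.exp (2 * Complex.I * κ * (symp z (z - u) : ℂ)) with hχdef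
      have hχ : Continuous χ := by
        have h1 : Continuous fun u : Cn n => symp z (z - u) :=
          continuous_symp.comp (by fun_prop : Continuous fun u : Cn n => (z, z - u))
        have h2 := hψ.continuous
        fun_prop
      have hχc : HasCompactSupport χ := by
        refine HasCompactSupport.intro (isCompact_closedBall z β) fun u hu => ?_
        simp only [hχdef]
        rw [hψ0, Complex.ofReal_zero, zero_mul]
        intro hm
        refine hu ?_
        rw [Metric.mem_closedBall', dist_eq_norm]
        exact hm.2.le
      have hl : 0 < α - ‖z‖ := by linarith
      have hl' : ∀ u, ‖u‖ < α - ‖z‖ → χ u = 0 := by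
        intro u hu
        simp only [hχdef]
        rw [hψ0, Complex.ofReal_zero, zero_mul]
        intro hm
        have := norm_sub_le z u
        linarith [hm.1]
      have h0 := integral_mul_eq_zero_of_components hn hpol hP hg hχ hχc hl hl' (by
        intro a b j
        rw [twist_pairing hn κ z ((continuous_harmComponent_mul _ hg hχ hl
          hl').integrable_of_hasCompactSupport hχc.mul_left)]
        rw [setIntegral_eq_zero_of_forall_eq_zero, smul_zero]
        intro σ _
        by_cases hσ : σ ∈ Set.Ioo α β
        · rw [h a b j σ hσ, smul_zero, smul_zero]
        · rw [hψ0 σ hσ, zero_smul])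
      rw [twist_pairing hn κ z ((hg.mul hχ).integrable_of_hasCompactSupport hχc.mul_left),
        smul_eq_zero_iff_right hA.ne'] at h0
      rw [← h0]
      refine (setIntegral_eq_integral_of_forall_compl_eq_zero fun σ hσ => ?_).symm
      rw [hψ0, zero_smul]
      intro hm
      exact hσ (hα0.trans hm.1))
  -- Vanishing almost everywhere on an open interval becomes vanishing everywhere, since `twist κ g
  -- z` is continuous.
  have heq := Measure.eqOn_open_of_ae_eq (μ := (volume : Measure ℝ)) (U := Set.Ioo α β)
    (f := fun σ : ℝ => σ ^ (2 * n - 1) • twist κ g z σ) (g := fun _ => 0)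
    ((ae_restrict_iff' measurableSet_Ioo).2 hae) isOpen_Ioo hcont.continuousOn continuousOn_const
  intro σ hσ
  have h1 := heq hσ
  have hσ0 : 0 < σ := hα0.trans hσ.1
  exact (smul_eq_zero_iff_right (pow_pos hσ0 _).ne').1 h1

end projection

/-! ### Radial coefficient spaces and sufficiency -/

section radial

variable {n : ℕ}

/-- The radial function `ρ ↦ e^{κρ²} ρ^{-2k}`. -/
noncomputable def radialModel (κ : ℝ) (k : ℤ) (ρ : ℝ) : ℂ :=
  ((Real.exp (κ * ρ ^ 2) * (ρ ^ 2) ^ (-k) : ℝ) : ℂ)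

/-- The space of radial coefficients of type `(a, b)`. -/
noncomputable def radialSpace (n : ℕ) (κ : ℝ) (a b : ℕ) : Submodule ℂ (ℝ → ℂ) :=
  Submodule.span ℂ (radialModel κ '' Set.Ico (n + b : ℤ) (n + a + b) ∪
    radialModel (-κ) '' Set.Ico (n + a : ℤ) (n + a + b))

lemma continuousAt_radialModel (κ : ℝ) (k : ℤ) {ρ : ℝ} (hρ : ρ ≠ 0) :
    ContinuousAt (radialModel κ k) ρ := by
  unfold radialModel
  refine Complex.continuous_ofReal.continuousAt.comp (ContinuousAt.mul (by fun_prop) ?_)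
  exact ((continuous_id.pow 2).continuousAt (x := ρ)).zpow₀ _ (Or.inl (pow_ne_zero 2 hρ))

lemma continuousAt_of_mem_radialSpace {κ : ℝ} {a b : ℕ} {v : ℝ → ℂ} (hv : v ∈ radialSpace n κ a b)
    {ρ : ℝ} (hρ : ρ ≠ 0) : ContinuousAt v ρ := by
  induction hv using Submodule.span_induction with
  | mem v h =>
    rcases h with ⟨k, -, rfl⟩ | ⟨k, -, rfl⟩
    · exact continuousAt_radialModel κ k hρ
    · exact continuousAt_radialModel (-κ) k hρ
  | zero => exact continuousAt_const
  | add f g _ _ hf hg => exact hf.add hg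
  | smul c f _ hf => exact hf.const_smul c

lemma conj_twist (κ : ℝ) (f : Cn n → ℂ) (z : Cn n) (s : ℝ) :
    (starRingEnd ℂ) (twist κ f z s) = twist (-κ) (fun u => (starRingEnd ℂ) (f u)) z s := by
  rw [twist, twist, ← integral_conj]
  refine integral_congr_ae (Filter.Eventually.of_forall fun ω => ?_)
  simp only [map_mul, ← Complex.exp_conj, Complex.conj_I, Complex.conj_ofReal, map_ofNat]
  push_cast
  ring_nf

lemma norm_sub_smul_sphere_ge (z : Cn n) {s : ℝ} (hs : 0 < s) (ω : Metric.sphere (0 : Cn n) 1) :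
    s - ‖z‖ ≤ ‖z - s • (ω : Cn n)‖ := by
  have h := norm_sub_norm_le (s • (ω : Cn n)) z
  rw [norm_sub_rev] at h
  simpa [norm_smul, abs_of_pos hs] using h

lemma norm_sub_smul_sphere_le (z : Cn n) {s : ℝ} (hs : 0 < s) (ω : Metric.sphere (0 : Cn n) 1) :
    ‖z - s • (ω : Cn n)‖ ≤ ‖z‖ + s := by
  have h := norm_sub_le z (s • (ω : Cn n))
  simpa [norm_smul, abs_of_pos hs] using h

/-- The generators with `e^{κρ²}` are model functions. Those with `e^{-κρ²}` become model functions
of type `(b, a)` for `-κ` after conjugation. -/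
lemma twist_radial_eq_zero (hn : 1 ≤ n) {κ : ℝ} {z : Cn n} {s : ℝ} (hz : ‖z‖ < s) {a b : ℕ}
    {p : MvPolynomial (Fin n ⊕ Fin n) ℂ} (hp : IsHarm a b p) {v : ℝ → ℂ}
    (hv : v ∈ radialSpace n κ a b) : twist κ (fun u => v ‖u‖ * evalBi p u) z s = 0 := by
  have hs : 0 < s := (norm_nonneg z).trans_lt hz
  have hcont : ∀ v ∈ radialSpace n κ a b, Integrable (fun ω : Metric.sphere (0 : Cn n) 1 =>
      v ‖z - s • (ω : Cn n)‖ * evalBi p (z - s • (ω : Cn n)) *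
        Complex.exp (2 * Complex.I * κ * (s * symp z ω))) (unitSphereMeasure n) := by
    intro v hv
    refine integrable_sphere ?_
    have h1 : Continuous fun ω : Metric.sphere (0 : Cn n) 1 => z - s • (ω : Cn n) := by fun_prop
    have h2 : Continuous fun ω : Metric.sphere (0 : Cn n) 1 => symp z ω :=
      continuous_symp.comp (continuous_const.prodMk continuous_subtype_val)
    have h3 : Continuous fun ω : Metric.sphere (0 : Cn n) 1 => v ‖z - s • (ω : Cn n)‖ := by
      rw [continuous_iff_continuousAt]
      intro ω
      refine ContinuousAt.comp (f := fun ω : Metric.sphere (0 : Cn n) 1 => ‖z - s • (ω : Cn n)‖)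
        (continuousAt_of_mem_radialSpace hv ?_) h1.norm.continuousAt
      have := norm_sub_smul_sphere_ge z hs ω
      linarith
    have h4 := (continuous_evalBi p).comp h1
    exact (h3.mul h4).mul (by fun_prop)
  induction hv using Submodule.span_induction with
  | mem v h =>
    rcases h with ⟨k, hk, rfl⟩ | ⟨k, hk, rfl⟩
    · obtain ⟨hk1, hk2⟩ := hk
      -- The interval of exponents is empty when `a = 0`.
      obtain ⟨a', rfl⟩ : ∃ a', a = a' + 1 := ⟨a - 1, by omega⟩
      exact twist_model_eq_zero hn κ hz hp hk1 (by push_cast at hk2; omega)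
    · obtain ⟨hk1, hk2⟩ := hk
      obtain ⟨b', rfl⟩ : ∃ b', b = b' + 1 := ⟨b - 1, by omega⟩
      obtain ⟨q, hq, hqe⟩ := hp.exists_conj
      have h := twist_model_eq_zero hn (-κ) hz hq hk1 (by push_cast at hk2; omega)
      rw [← map_eq_zero (starRingEnd ℂ), conj_twist, ← h]
      congr 1
      ext u
      rw [map_mul, hqe, radialModel, Complex.conj_ofReal]
  | zero => simp [twist]
  | add f g hf' hg' hf hg =>
    have h := integral_add (hcont f hf') (hcont g hg')
    rw [twist] at hf hg ⊢
    rw [hf, hg, add_zero] at h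
    rw [← h]
    refine integral_congr_ae (Filter.Eventually.of_forall fun ω => ?_)
    simp only [Pi.add_apply]
    ring
  | smul c f _ hf =>
    rw [twist] at hf ⊢
    rw [← mul_zero c, ← hf, ← integral_const_mul]
    refine integral_congr_ae (Filter.Eventually.of_forall fun ω => ?_)
    simp only [Pi.smul_apply, smul_eq_mul]
    ring

lemma exists_continuous_eq_on_shell {f : Cn n → ℂ} {l L : ℝ}
    (hf : ContinuousOn f {u | l ≤ ‖u‖ ∧ ‖u‖ ≤ L}) :
    ∃ g : Cn n → ℂ, Continuous g ∧ ∀ u, l ≤ ‖u‖ → ‖u‖ ≤ L → g u = f u := by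
  have hK : IsClosed {u : Cn n | l ≤ ‖u‖ ∧ ‖u‖ ≤ L} :=
    (isClosed_le continuous_const continuous_norm).inter
      (isClosed_le continuous_norm continuous_const)
  obtain ⟨g, hg⟩ := ContinuousMap.exists_restrict_eq hK
    (⟨_, hf.domRestrict⟩ : C({u : Cn n | l ≤ ‖u‖ ∧ ‖u‖ ≤ L}, ℂ))
  refine ⟨g, g.continuous, fun u h1 h2 => ?_⟩
  exact congrArg (fun F : C(_, ℂ) => F ⟨u, h1, h2⟩) hg

lemma exists_unit_direction (hn : 1 ≤ n) (z : Cn n) : ∃ e : Cn n, ‖e‖ = 1 ∧ z = ‖z‖ • e := by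
  have := nontrivial_Cn hn
  by_cases hz : z = 0
  · obtain ⟨e, he⟩ := exists_norm_eq (Cn n) zero_le_one
    exact ⟨e, he, by simp [hz]⟩
  · exact ⟨‖z‖⁻¹ • z, by simp [norm_smul, hz], by simp [smul_smul, hz]⟩

/-- Only points on the line through `0` and `z` matter. The point `-r e` of the inner ball gives
`|z| + r ≤ s`; the nearest point `z - s e` of the sphere lies in the open annulus, which makes this
strict; the farthest point `z + s e` gives the outer bound. -/
lemma lt_of_sphere_subset_Ann (hn : 1 ≤ n) {r : ℝ} {R : EReal} (hr : 0 ≤ r) {z : Cn n} {s : ℝ}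
    (hs : 0 < s) (h1 : Metric.sphere z s ⊆ Ann n r R)
    (h2 : Metric.closedBall (0 : Cn n) r ⊆ Metric.closedBall z s) :
    ‖z‖ + r < s ∧ ((‖z‖ + s : ℝ) : EReal) < R := by
  obtain ⟨e, he, hz⟩ := exists_unit_direction hn z
  have hnorm : ∀ t : ℝ, ‖z + t • e‖ = |‖z‖ + t| := fun t => by
    nth_rw 1 [hz]
    rw [← add_smul, norm_smul, he, mul_one, Real.norm_eq_abs]
  have hmem : ∀ t : ℝ, |t| = s → z + t • e ∈ Metric.sphere z s := fun t ht => by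
    simp [norm_smul, he, ht]
  have h3 : ‖z‖ + r ≤ s := by
    have : -(r • e) ∈ Metric.closedBall z s := h2 (by simp [norm_smul, he, abs_of_nonneg hr])
    rw [Metric.mem_closedBall', dist_eq_norm, sub_neg_eq_add, hnorm,
      abs_of_nonneg (by positivity)] at this
    exact this
  have h4 := (h1 (hmem (-s) (by rw [abs_neg, abs_of_pos hs]))).1
  have h5 := (h1 (hmem s (abs_of_pos hs))).2
  rw [hnorm, abs_of_nonneg (by positivity)] at h5
  rw [hnorm, abs_of_nonpos (by linarith)] at h4
  exact ⟨by linarith, h5⟩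

variable {pol : ∀ a b : ℕ, Fin (dimHarmonics n a b) → MvPolynomial (Fin n ⊕ Fin n) ℂ}

lemma mem_ZAnn_of_radialSpace (hn : 1 ≤ n) (hpol : ∀ a b j, IsHarm a b (pol a b j))
    (hP : ∀ a b, IsOrthonormalHarmonicBasis n a b fun j => evalBi (pol a b j))
    {r : ℝ} {R : EReal} (hr : 0 ≤ r) {f : Cn n → ℂ} (hf : ContinuousOn f (Ann n r R))
    (h : ∀ a b j, ∃ v ∈ radialSpace n (1 / 4) a b, ∀ ρ : ℝ, r < ρ → (ρ : EReal) < R →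
      sphCoeffTilde a b f (evalBi (pol a b j)) ρ = v ρ) : f ∈ ZAnn n r R := by
  refine ⟨hf, fun z s hs h1 h2 => ?_⟩
  obtain ⟨h3, h4⟩ := lt_of_sphere_subset_Ann hn hr hs h1 h2
  -- The strict inequalities leave room for a closed shell inside the annulus containing all spheres
  -- about `z` of radius near `s`; off this shell `f` is replaced by a continuous extension.
  obtain ⟨l, hl1, hl2⟩ := exists_between (show r < s - ‖z‖ by linarith)
  obtain ⟨L, hL1, hL2⟩ := EReal.lt_iff_exists_real_btwn.1 h4
  have hL1' : ‖z‖ + s < L := by exact_mod_cast hL1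
  obtain ⟨g, hg, hgf⟩ := exists_continuous_eq_on_shell (f := f) (l := l) (L := L)
    (hf.mono fun u hu => ⟨hl1.trans_le hu.1, (EReal.coe_le_coe_iff.2 hu.2).trans_lt hL2⟩)
  have hl0 : 0 < l := hr.trans_lt hl1
  have hco : ∀ (Q : Cn n → ℂ) (ρ : ℝ), l ≤ ρ → ρ ≤ L → sphCoeff g Q ρ = sphCoeff f Q ρ := by
    intro Q ρ h5 h6
    refine integral_congr_ae (Filter.Eventually.of_forall fun ω => ?_)
    have : ‖ρ • (ω : Cn n)‖ = ρ := by simp [norm_smul, abs_of_pos (hl0.trans_le h5)]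
    simp only []
    rw [hgf _ (by rwa [this]) (by rwa [this])]
  have hsph : ∀ σ ∈ Set.Ioo (‖z‖ + l) (L - ‖z‖), ∀ ω : Metric.sphere (0 : Cn n) 1,
      l ≤ ‖z - σ • (ω : Cn n)‖ ∧ ‖z - σ • (ω : Cn n)‖ ≤ L := by
    intro σ hσ ω
    have hσ0 : 0 < σ := by linarith [hσ.1, norm_nonneg z]
    have h5 := norm_sub_smul_sphere_ge z hσ0 ω
    have h6 := norm_sub_smul_sphere_le z hσ0 ω
    exact ⟨by linarith [hσ.1], by linarith [hσ.2]⟩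
  have hs' : s ∈ Set.Ioo (‖z‖ + l) (L - ‖z‖) := ⟨by linarith, by linarith⟩
  have key := twist_eq_zero_of_components hn hpol hP hg (κ := 1 / 4) (z := z) (α := ‖z‖ + l)
    (β := L - ‖z‖) (by linarith) (by
      intro a b j σ hσ
      obtain ⟨v, hv, hvf⟩ := h a b j
      rw [← twist_radial_eq_zero hn (z := z) (s := σ) (by linarith [hσ.1]) (hpol a b j) hv]
      refine integral_congr_ae (Filter.Eventually.of_forall fun ω => ?_)
      obtain ⟨h5, h6⟩ := hsph σ hσ ω
      simp only [harmComponent]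
      rw [← hvf _ (hl1.trans_le h5) ((EReal.coe_le_coe_iff.2 h6).trans_lt hL2), sphCoeffTilde,
        sphCoeffTilde, hco _ _ h5 h6]) s hs'
  rw [twistedMean_eq_twist f hs z, ← key]
  refine integral_congr_ae (Filter.Eventually.of_forall fun ω => ?_)
  simp only []
  rw [hgf _ (hsph s hs' ω).1 (hsph s hs' ω).2]

end radial

/-! ### Weighted primitives of the radial functions -/

section primitive

variable {n : ℕ}

lemma radialSpace_neg_swap (κ : ℝ) (a b : ℕ) : radialSpace n (-κ) b a = radialSpace n κ a b := by
  rw [radialSpace, radialSpace, neg_neg, Set.union_comm, add_right_comm]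

lemma radialModel_mem_left {κ : ℝ} {a b : ℕ} {k : ℤ} (h1 : (n + b : ℤ) ≤ k) (h2 : k < n + a + b) :
    radialModel κ k ∈ radialSpace n κ a b :=
  Submodule.subset_span (Or.inl ⟨k, ⟨h1, h2⟩, rfl⟩)

lemma radialModel_mem_right {κ : ℝ} {a b : ℕ} {k : ℤ} (h1 : (n + a : ℤ) ≤ k) (h2 : k < n + a + b) :
    radialModel (-κ) k ∈ radialSpace n κ a b :=
  Submodule.subset_span (Or.inr ⟨k, ⟨h1, h2⟩, rfl⟩)

lemma conj_mem_radialSpace {κ : ℝ} {a b : ℕ} {v : ℝ → ℂ} (hv : v ∈ radialSpace n κ a b) :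
    (fun ρ => (starRingEnd ℂ) (v ρ)) ∈ radialSpace n κ a b := by
  induction hv using Submodule.span_induction with
  | mem v h =>
    have hc : (fun ρ => (starRingEnd ℂ) (v ρ)) = v := by
      rcases h with ⟨k, -, rfl⟩ | ⟨k, -, rfl⟩ <;> ext ρ <;> simp only [radialModel, Complex.conj_ofReal]
    rw [hc]
    exact Submodule.subset_span h
  | zero =>
    have h0 : (fun ρ => (starRingEnd ℂ) ((0 : ℝ → ℂ) ρ)) = 0 := by ext ρ; simp
    rw [h0]
    exact Submodule.zero_mem _
  | add f g _ _ hf hg => simpa using! Submodule.add_mem _ hf hg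
  | smul c f _ hf => simpa using! Submodule.smul_mem _ ((starRingEnd ℂ) c) hf

lemma hasDerivAt_exp_sq (κ ρ : ℝ) : HasDerivAt (fun ρ : ℝ => Complex.exp (-κ * (ρ : ℂ) ^ 2))
    (-2 * κ * ρ * Complex.exp (-κ * (ρ : ℂ) ^ 2)) ρ := by
  have h1 : HasDerivAt (fun ρ : ℝ => (ρ : ℂ)) 1 ρ := Complex.ofRealCLM.hasDerivAt
  have h2 : HasDerivAt (fun ρ : ℝ => Complex.exp (-κ * (ρ : ℂ) ^ 2)) _ ρ :=
    ((h1.pow 2).const_mul (-κ : ℂ)).cexp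
  refine h2.congr_deriv ?_
  simp only [Pi.pow_apply]
  push_cast
  ring

lemma hasDerivAt_radialModel (κ : ℝ) (k : ℤ) {ρ : ℝ} (hρ : 0 < ρ) :
    HasDerivAt (radialModel κ k)
      (2 * κ * ρ * radialModel κ k ρ - 2 * k * (ρ : ℂ)⁻¹ * radialModel κ k ρ) ρ := by
  have hρ' : (ρ : ℂ) ≠ 0 := by exact_mod_cast hρ.ne'
  have h1 : HasDerivAt (fun ρ : ℝ => (ρ : ℂ)) 1 ρ := Complex.ofRealCLM.hasDerivAt
  have h2 : HasDerivAt (fun ρ : ℝ => (ρ : ℂ) ^ (-2 * k)) _ ρ :=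
    (hasDerivAt_zpow (-2 * k) (ρ : ℂ) (Or.inl hρ')).comp ρ h1
  have h3 := hasDerivAt_exp_sq (-κ) ρ
  have h4 : HasDerivAt (fun ρ : ℝ => Complex.exp (-(-κ : ℝ) * (ρ : ℂ) ^ 2) * (ρ : ℂ) ^ (-2 * k)) _ ρ :=
    h3.mul h2
  have he : radialModel κ k = fun ρ : ℝ => Complex.exp (-(-κ : ℝ) * (ρ : ℂ) ^ 2) *
      (ρ : ℂ) ^ (-2 * k) := by
    ext ρ
    rw [radialModel]
    push_cast
    rw [neg_neg, ← zpow_natCast, ← zpow_mul]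
    norm_num
  rw [he]
  refine h4.congr_deriv ?_
  rw [zpow_sub_one₀ hρ']
  push_cast
  ring

/-- The operator `v ↦ e^{-κρ²} ρ^{2m} v`. -/
noncomputable def radialWeight (κ : ℝ) (m : ℕ) (v : ℝ → ℂ) (ρ : ℝ) : ℂ :=
  Complex.exp (-κ * (ρ : ℂ) ^ 2) * (ρ : ℂ) ^ (2 * m) * v ρ

lemma hasDerivAt_radialWeight {κ : ℝ} {m : ℕ} {v : ℝ → ℂ} {v' : ℂ} {ρ : ℝ} (hρ : 0 < ρ)
    (hv : HasDerivAt v v' ρ) : HasDerivAt (radialWeight κ m v)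
      (radialWeight κ m (fun _ => v' + (2 * m * (ρ : ℂ)⁻¹ - 2 * κ * ρ) * v ρ) ρ) ρ := by
  have hρ' : (ρ : ℂ) ≠ 0 := by exact_mod_cast hρ.ne'
  have h1 : HasDerivAt (fun ρ : ℝ => (ρ : ℂ)) 1 ρ := Complex.ofRealCLM.hasDerivAt
  have h2 := ((hasDerivAt_exp_sq κ ρ).mul (h1.pow (2 * m))).mul hv
  refine h2.congr_deriv ?_
  simp only [radialWeight, Pi.pow_apply, Pi.mul_apply]
  rcases m with _ | m
  · simp; ring
  · rw [show 2 * (m + 1) - 1 = 2 * m + 1 by omega, show 2 * (m + 1) = 2 * m + 1 + 1 by ring,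
      pow_succ (ρ : ℂ) (2 * m + 1)]
    push_cast
    field_simp
    ring

/-- `w` is a primitive of `v` for the weight `e^{-κρ²} ρ^{2m}`. -/
def IsRadialPrimitive (κ : ℝ) (m : ℕ) (v w : ℝ → ℂ) : Prop :=
  ∀ ρ : ℝ, 0 < ρ → HasDerivAt (radialWeight κ m w)
    (Complex.exp (-κ * (ρ : ℂ) ^ 2) * (ρ : ℂ) ^ (2 * m) * (ρ : ℂ)⁻¹ * v ρ) ρ

lemma IsRadialPrimitive.add {κ : ℝ} {m : ℕ} {v w v' w' : ℝ → ℂ} (h : IsRadialPrimitive κ m v w)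
    (h' : IsRadialPrimitive κ m v' w') : IsRadialPrimitive κ m (v + v') (w + w') := by
  intro ρ hρ
  have h1 := (h ρ hρ).add (h' ρ hρ)
  have h2 : radialWeight κ m (w + w') = radialWeight κ m w + radialWeight κ m w' := by
    ext ρ; simp only [radialWeight, Pi.add_apply]; ring
  rw [h2]
  refine h1.congr_deriv ?_
  simp only [Pi.add_apply]
  ring

lemma IsRadialPrimitive.smul {κ : ℝ} {m : ℕ} {v w : ℝ → ℂ} (h : IsRadialPrimitive κ m v w)
    (c : ℂ) : IsRadialPrimitive κ m (c • v) (c • w) := by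
  intro ρ hρ
  have h1 := (h ρ hρ).const_mul c
  have h2 : radialWeight κ m (c • w) = fun ρ => c * radialWeight κ m w ρ := by
    ext ρ; simp only [radialWeight, Pi.smul_apply, smul_eq_mul]; ring
  rw [h2]
  refine h1.congr_deriv ?_
  simp only [Pi.smul_apply, smul_eq_mul]
  ring

lemma isRadialPrimitive_zero (κ : ℝ) (m : ℕ) : IsRadialPrimitive κ m 0 0 := by
  intro ρ _
  have h2 : radialWeight κ m 0 = fun _ => 0 := by ext ρ; simp [radialWeight]
  rw [h2]
  simpa using hasDerivAt_const ρ (0 : ℂ)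

lemma radialModel_pred (κ : ℝ) (k : ℤ) {ρ : ℝ} (hρ : 0 < ρ) :
    radialModel κ (k - 1) ρ = (ρ : ℂ) ^ 2 * radialModel κ k ρ := by
  have h : (ρ ^ 2) ^ (-(k - 1)) = (ρ ^ 2) ^ (-k) * ρ ^ 2 := by
    rw [neg_sub, sub_eq_add_neg, add_comm, zpow_add_one₀ (pow_pos hρ 2).ne']
  rw [radialModel, radialModel, h]
  push_cast
  ring

/-- The exponentials cancel, leaving the derivative of the pure power `ρ^{2(m-k)}`. -/
lemma isRadialPrimitive_radialModel_left (κ : ℝ) (m : ℕ) (k : ℤ) :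
    IsRadialPrimitive κ m ((2 * ((m : ℂ) - k)) • radialModel κ k) (radialModel κ k) := by
  intro ρ hρ
  refine (hasDerivAt_radialWeight hρ (hasDerivAt_radialModel κ k hρ)).congr_deriv ?_
  simp only [radialWeight, Pi.smul_apply, smul_eq_mul]
  ring

lemma isRadialPrimitive_radialModel_right (κ : ℝ) (m : ℕ) (k : ℤ) :
    IsRadialPrimitive κ m ((-4 * κ : ℂ) • radialModel (-κ) (k - 1) +
      (2 * ((m : ℂ) - k)) • radialModel (-κ) k) (radialModel (-κ) k) := by
  intro ρ hρ
  have hρ' : (ρ : ℂ) ≠ 0 := by exact_mod_cast hρ.ne'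
  refine (hasDerivAt_radialWeight hρ (hasDerivAt_radialModel (-κ) k hρ)).congr_deriv ?_
  simp only [radialWeight, Pi.smul_apply, Pi.add_apply, smul_eq_mul, radialModel_pred _ k hρ]
  push_cast
  field_simp
  ring

/-- For `e^{κρ²}` one integrates a power; no logarithm arises because `k < n+a+b`. For `e^{-κρ²}`
the formula for the derivative of `radialModel (-κ) k` is solved for its `k-1` term, recursively in
`k`, which requires `κ ≠ 0`. -/
lemma exists_isRadialPrimitive {κ : ℝ} (hκ : κ ≠ 0) {a b : ℕ} {v : ℝ → ℂ}
    (hv : v ∈ radialSpace n κ a b) :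
    ∃ w ∈ radialSpace n κ (a + 1) b, IsRadialPrimitive κ (n + a + b) v w := by
  have hκ' : (κ : ℂ) ≠ 0 := by exact_mod_cast hκ
  -- The recursion starts at exponent `n+a+b-1`: for `k = m = n+a+b` the coefficient `2(m-k)` is
  -- zero, so a single term remains.
  have hright : ∀ i : ℕ, i < b → ∃ w ∈ radialSpace n κ (a + 1) b,
      IsRadialPrimitive κ (n + a + b) (radialModel (-κ) ((n : ℤ) + a + b - 1 - i)) w := by
    intro i
    induction i with
    | zero =>
      intro hi
      refine ⟨(-4 * κ : ℂ)⁻¹ • radialModel (-κ) (n + a + b), Submodule.smul_mem _ _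
        (radialModel_mem_right (by push_cast; omega) (by push_cast; omega)), ?_⟩
      convert (isRadialPrimitive_radialModel_right κ (n + a + b) (n + a + b)).smul (-4 * κ : ℂ)⁻¹
        using 1
      push_cast
      rw [sub_self, mul_zero, zero_smul, add_zero, smul_smul, inv_mul_cancel₀ (by simp [hκ']),
        one_smul, sub_zero]
    | succ i ih =>
      intro hi
      obtain ⟨w, hw, hw'⟩ := ih (by omega)
      have h1 := isRadialPrimitive_radialModel_right κ (n + a + b) ((n : ℤ) + a + b - 1 - i)
      refine ⟨(-4 * κ : ℂ)⁻¹ • (radialModel (-κ) ((n : ℤ) + a + b - 1 - i) +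
        (-(2 * (i + 1)) : ℂ) • w), Submodule.smul_mem _ _ (Submodule.add_mem _
        (radialModel_mem_right (by push_cast; omega) (by push_cast; omega))
        (Submodule.smul_mem _ _ hw)), ?_⟩
      convert (h1.add (hw'.smul (-(2 * (i + 1)) : ℂ))).smul (-4 * κ : ℂ)⁻¹ using 1
      have e1 : (2 * (((n + a + b : ℕ) : ℂ) - (((n : ℤ) + a + b - 1 - i : ℤ) : ℂ))) =
        2 * (i + 1) := by push_cast; ring
      have e2 : (n : ℤ) + a + b - 1 - (i + 1 : ℕ) = (n : ℤ) + a + b - 1 - i - 1 := by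
        push_cast; ring
      rw [e1, e2, neg_smul, add_neg_cancel_right, smul_smul,
        inv_mul_cancel₀ (by simp [hκ']), one_smul]
  induction hv using Submodule.span_induction with
  | mem v h =>
    rcases h with ⟨k, ⟨h1, h2⟩, rfl⟩ | ⟨k, ⟨h1, h2⟩, rfl⟩
    · have hne : (2 * (((n + a + b : ℕ) : ℂ) - k)) ≠ 0 := by
        have : ((((n + a + b : ℕ) : ℤ) - k : ℤ) : ℂ) ≠ 0 := by
          rw [Int.cast_ne_zero]; push_cast; omega
        push_cast at this ⊢
        exact mul_ne_zero two_ne_zero this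
      refine ⟨(2 * (((n + a + b : ℕ) : ℂ) - k))⁻¹ • radialModel κ k, Submodule.smul_mem _ _
        (radialModel_mem_left h1 (by push_cast; omega)), ?_⟩
      convert (isRadialPrimitive_radialModel_left κ (n + a + b) k).smul
        (2 * (((n + a + b : ℕ) : ℂ) - k))⁻¹ using 1
      rw [smul_smul, inv_mul_cancel₀ hne, one_smul]
    · obtain ⟨i, hi⟩ : ∃ i : ℕ, k = (n : ℤ) + a + b - 1 - i :=
        ⟨((n : ℤ) + a + b - 1 - k).toNat, by omega⟩
      rw [hi]
      exact hright i (by omega)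
  | zero => exact ⟨0, Submodule.zero_mem _, isRadialPrimitive_zero _ _⟩
  | add f g _ _ hf hg =>
    obtain ⟨w, hw, h⟩ := hf
    obtain ⟨w', hw', h'⟩ := hg
    exact ⟨w + w', Submodule.add_mem _ hw hw', h.add h'⟩
  | smul c f _ hf =>
    obtain ⟨w, hw, h⟩ := hf
    exact ⟨c • w, Submodule.smul_mem _ c hw, h.smul c⟩

/-- Two weighted primitives differ by a constant on the interval, and dividing a constant by the
weight gives a multiple of `radialModel κ m`. -/
lemma exists_eq_of_isRadialPrimitive {κ : ℝ} {m : ℕ} {v w u : ℝ → ℂ} {l L : ℝ} (hl : 0 ≤ l)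
    (hw : IsRadialPrimitive κ m v w)
    (hu : ∀ ρ ∈ Set.Ioo l L, HasDerivAt (radialWeight κ m u)
      (Complex.exp (-κ * (ρ : ℂ) ^ 2) * (ρ : ℂ) ^ (2 * m) * (ρ : ℂ)⁻¹ * v ρ) ρ) :
    ∃ c : ℂ, ∀ ρ ∈ Set.Ioo l L, u ρ = (w + c • radialModel κ m) ρ := by
  have hd : ∀ ρ ∈ Set.Ioo l L,
      HasDerivAt (fun ρ => radialWeight κ m u ρ - radialWeight κ m w ρ) 0 ρ := by
    intro ρ hρ
    simpa using (hu ρ hρ).fun_sub (hw ρ (hl.trans_lt hρ.1))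
  obtain ⟨c, hc⟩ := isOpen_Ioo.exists_is_const_of_deriv_eq_zero (𝕜 := ℝ)
    (convex_Ioo l L).isPreconnected
    (fun ρ hρ => (hd ρ hρ).differentiableAt.differentiableWithinAt)
    (fun ρ hρ => (hd ρ hρ).deriv)
  refine ⟨c, fun ρ hρ => ?_⟩
  have h1 := hc ρ hρ
  have hρ0 : 0 < ρ := hl.trans_lt hρ.1
  have hρ' : (ρ : ℂ) ≠ 0 := by exact_mod_cast hρ0.ne'
  have h2 : Complex.exp (-κ * (ρ : ℂ) ^ 2) * (ρ : ℂ) ^ (2 * m) * radialModel κ m ρ = 1 := by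
    rw [radialModel]
    push_cast
    rw [zpow_neg, zpow_natCast, ← pow_mul, neg_mul, Complex.exp_neg]
    field_simp
  have h3 : Complex.exp (-κ * (ρ : ℂ) ^ 2) * (ρ : ℂ) ^ (2 * m) ≠ 0 :=
    mul_ne_zero (Complex.exp_ne_zero _) (pow_ne_zero _ hρ')
  simp only [radialWeight] at h1
  simp only [Pi.add_apply, Pi.smul_apply, smul_eq_mul]
  refine mul_left_cancel₀ h3 ?_
  linear_combination h1 - c * h2

end primitive

/-! ### Induction on the bidegree -/

section twistclass

variable {n : ℕ}

/-- A class of functions with vanishing spherical means over the spheres centred at the origin that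
is closed under the left-invariant vector fields of the twisted structure. -/
structure IsTwistClass (κ : ℝ) (I : Set ℝ) (𝓒 : Set (Cn n → ℂ)) : Prop where
  contDiff : ∀ F ∈ 𝓒, ContDiff ℝ 1 F
  wirt_eq : ∀ F ∈ 𝓒, ∀ j, ∃ G ∈ 𝓒, ∀ u, wirt F j u = G u + κ * (starRingEnd ℂ) (u j) * F u
  wirt_conj_eq : ∀ F ∈ 𝓒, ∀ j, ∃ G ∈ 𝓒, ∀ u, wirt (fun u => (starRingEnd ℂ) (F u)) j u =
    (starRingEnd ℂ) (G u) - κ * (starRingEnd ℂ) (u j) * (starRingEnd ℂ) (F u)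
  mean : ∀ F ∈ 𝓒, ∀ s ∈ I, ∫ ω : Metric.sphere (0 : Cn n) 1, F (s • (ω : Cn n))
    ∂(unitSphereMeasure n) = 0

/-- All coefficients of type `(a, b)` of the functions in `𝓒` are of the form given by
`radialSpace`. -/
def HasRadialCoeffs (κ : ℝ) (I : Set ℝ) (𝓒 : Set (Cn n → ℂ)) (a b : ℕ) : Prop :=
  ∀ F ∈ 𝓒, ∀ p : MvPolynomial (Fin n ⊕ Fin n) ℂ, IsHarm a b p →
    ∃ v ∈ radialSpace n κ a b, ∀ ρ ∈ I, sphCoeffTilde a b F (evalBi p) ρ = v ρ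

/-- The conjugates of the functions in `𝓒`. -/
def conjClass (𝓒 : Set (Cn n → ℂ)) : Set (Cn n → ℂ) :=
  (fun F u => (starRingEnd ℂ) (F u)) '' 𝓒

lemma IsTwistClass.conj {κ : ℝ} {I : Set ℝ} {𝓒 : Set (Cn n → ℂ)} (h : IsTwistClass κ I 𝓒) :
    IsTwistClass (-κ) I (conjClass 𝓒) := by
  refine ⟨?_, ?_, ?_, ?_⟩
  · rintro _ ⟨F, hF, rfl⟩
    exact Complex.conjCLE.contDiff.comp (h.contDiff F hF)
  · rintro _ ⟨F, hF, rfl⟩ j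
    obtain ⟨G, hG, hGe⟩ := h.wirt_conj_eq F hF j
    refine ⟨_, ⟨G, hG, rfl⟩, fun u => ?_⟩
    rw [hGe]
    push_cast
    ring
  · rintro _ ⟨F, hF, rfl⟩ j
    obtain ⟨G, hG, hGe⟩ := h.wirt_eq F hF j
    refine ⟨_, ⟨G, hG, rfl⟩, fun u => ?_⟩
    simp only [Complex.conj_conj]
    rw [hGe]
    push_cast
    ring
  · rintro _ ⟨F, hF, rfl⟩ s hs
    simp only []
    rw [integral_conj, h.mean F hF s hs, map_zero]

lemma sphCoeffTilde_conj (a b : ℕ) (F Q : Cn n → ℂ) (ρ : ℝ) :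
    sphCoeffTilde b a (fun u => (starRingEnd ℂ) (F u)) (fun u => (starRingEnd ℂ) (Q u)) ρ =
      (starRingEnd ℂ) (sphCoeffTilde a b F Q ρ) := by
  simp only [sphCoeffTilde, sphCoeff, ← map_mul, integral_conj, add_comm]
  rw [map_mul, Complex.conj_ofReal]

lemma HasRadialCoeffs.of_conj {κ : ℝ} {I : Set ℝ} {𝓒 : Set (Cn n → ℂ)} {a b : ℕ}
    (h : HasRadialCoeffs (-κ) I (conjClass 𝓒) b a) : HasRadialCoeffs κ I 𝓒 a b := by
  intro F hF p hp
  obtain ⟨q, hq, hqe⟩ := hp.exists_conj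
  obtain ⟨v, hv, hve⟩ := h _ ⟨F, hF, rfl⟩ q hq
  rw [radialSpace_neg_swap] at hv
  refine ⟨_, conj_mem_radialSpace hv, fun ρ hρ => ?_⟩
  rw [← hve ρ hρ, show evalBi q = fun u => (starRingEnd ℂ) (evalBi p u) from funext hqe,
    sphCoeffTilde_conj, Complex.conj_conj]

/-- A polynomial of bidegree `(0, 0)` is constant, so its coefficient is a multiple of the mean. -/
lemma IsTwistClass.hasRadialCoeffs_zero {κ : ℝ} {I : Set ℝ} {𝓒 : Set (Cn n → ℂ)}
    (h : IsTwistClass κ I 𝓒) : HasRadialCoeffs κ I 𝓒 0 0 := by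
  intro F hF p hp
  refine ⟨0, Submodule.zero_mem _, fun ρ hρ => ?_⟩
  have hc : ∀ u : Cn n, evalBi p u = evalBi p 0 := fun u => by
    have := hp.toIsBihom.eval_smul 0 u
    simpa using this.symm
  rw [sphCoeffTilde, sphCoeff]
  simp only [fun ω : Metric.sphere (0 : Cn n) 1 => hc (ω : Cn n)]
  rw [integral_mul_const, h.mean F hF ρ hρ, zero_mul, mul_zero, Pi.zero_apply]

lemma pow_mul_sphCoeffTilde (a b : ℕ) (F Q : Cn n → ℂ) {ρ : ℝ} (hρ : 0 < ρ) :
    (ρ : ℂ) ^ (a + b) * sphCoeffTilde a b F Q ρ = sphCoeff F Q ρ := by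
  have : (ρ : ℂ) ≠ 0 := by exact_mod_cast hρ.ne'
  have h2 : (ρ : ℂ) ^ (a + b) * ((ρ ^ (-((a : ℤ) + b)) : ℝ) : ℂ) = 1 := by
    push_cast
    rw [← zpow_natCast, ← zpow_add₀ this]
    simp
  rw [sphCoeffTilde, ← mul_assoc, h2, one_mul]

/-- Apply the divergence theorem to `F · conj(∂_j p)` and sum over `j`. Euler's identity turns the
flux into `a+1` times the coefficient of `F` along `p`. On the other side, `∂_j F = G_j + κ ū_j F`
contributes the coefficients of `G_j` and a `κ`-term, while derivatives of `conj(∂_j p)` sum to zero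
by harmonicity. The factor `e^{-κρ²}` absorbs the `κ`-term. -/
lemma IsTwistClass.hasDerivAt_radialWeight (hn : 1 ≤ n) {κ : ℝ} {I : Set ℝ} {𝓒 : Set (Cn n → ℂ)}
    (h : IsTwistClass κ I 𝓒) {a b : ℕ} {p : MvPolynomial (Fin n ⊕ Fin n) ℂ}
    (hp : IsHarm (a + 1) b p) {F : Cn n → ℂ} (hF : F ∈ 𝓒) {G : Fin n → Cn n → ℂ}
    (hG : ∀ j, G j ∈ 𝓒) (hGe : ∀ j u, wirt F j u = G j u + κ * (starRingEnd ℂ) (u j) * F u)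
    {ρ : ℝ} (hρ : 0 < ρ) :
    HasDerivAt (radialWeight κ (n + a + b) (sphCoeffTilde (a + 1) b F (evalBi p)))
      (Complex.exp (-κ * (ρ : ℂ) ^ 2) * (ρ : ℂ) ^ (2 * (n + a + b)) * (ρ : ℂ)⁻¹ *
        (2 / (a + 1) * ∑ j, sphCoeffTilde a b (G j)
          (evalBi (MvPolynomial.pderiv (Sum.inl j) p)) ρ)) ρ := by
  set P : Fin n → MvPolynomial (Fin n ⊕ Fin n) ℂ := fun j => MvPolynomial.pderiv (Sum.inl j) p
    with hPdef
  have hPb : ∀ j, IsBihom a b (P j) := fun j => hp.toIsBihom.pderiv_inl j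
  have ha : (a : ℂ) + 1 ≠ 0 := by exact_mod_cast Nat.succ_ne_zero a
  have hFd := h.contDiff F hF
  have hFc := hFd.continuous
  have heuler : ∀ u : Cn n, ∑ j, u j * evalBi (P j) u = (a + 1) * evalBi p u := by
    intro u
    have h1 := congrArg (fun q => evalBi q u) hp.toIsBihom.euler_left
    simp only [evalBi_sum, evalBi_mul, evalBi_smul, evalBi_X, bicoords_inl] at h1
    rw [h1]
    push_cast
    rfl
  have heuler' : ∀ u : Cn n, ∑ j, (starRingEnd ℂ) (u j) * (starRingEnd ℂ) (evalBi (P j) u) =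
      (a + 1) * (starRingEnd ℂ) (evalBi p u) := by
    intro u
    have h1 := congrArg (starRingEnd ℂ) (heuler u)
    simpa [map_sum] using h1
  have hlap : ∀ u : Cn n, ∑ j, evalBi (MvPolynomial.pderiv (Sum.inr j) (P j)) u = 0 := by
    intro u
    rw [← evalBi_sum, ← evalBi_zero u]
    congr 1
    rw [← hp.lap, polyLap]
    exact Finset.sum_congr rfl fun j _ => pderiv_pderiv_comm _ _ _
  have hcd : ∀ j, ContDiff ℝ 1 fun u => F u * (starRingEnd ℂ) (evalBi (P j) u) := fun j =>
    hFd.mul ((contDiff_conj_evalBi (P j)).of_le le_top)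
  have hPc : ∀ j, Continuous fun u : Cn n => (starRingEnd ℂ) (evalBi (P j) u) := fun j =>
    (contDiff_conj_evalBi (P j)).continuous
  have hpc : Continuous fun u : Cn n => (starRingEnd ℂ) (evalBi p u) :=
    (contDiff_conj_evalBi p).continuous
  have hsum := HasDerivAt.fun_sum (u := Finset.univ)
    fun j _ => hasDerivAt_sphere_wirt hn (hcd j) j hρ
  have hlhs : ∀ σ : ℝ, 0 < σ → ∑ j, (σ : ℂ) ^ (2 * n - 1) *
      ∫ ω, F (σ • (ω : Cn n)) * (starRingEnd ℂ) (evalBi (P j) (σ • (ω : Cn n))) *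
        (starRingEnd ℂ) ((ω : Cn n) j) ∂(unitSphereMeasure n) =
      (a + 1) * ((σ : ℂ) ^ (2 * (n + a + b)) * sphCoeffTilde (a + 1) b F (evalBi p) σ) := by
    intro σ hσ
    rw [← Finset.mul_sum, ← integral_finsetSum]
    · have e1 : ∀ ω : Metric.sphere (0 : Cn n) 1, ∑ j, F (σ • (ω : Cn n)) *
          (starRingEnd ℂ) (evalBi (P j) (σ • (ω : Cn n))) * (starRingEnd ℂ) ((ω : Cn n) j) =
          (σ : ℂ) ^ (a + b) * (a + 1) *
            (F (σ • (ω : Cn n)) * (starRingEnd ℂ) (evalBi p (ω : Cn n))) := by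
        intro ω
        have h1 := heuler' (ω : Cn n)
        simp only [(hPb _).eval_smul, map_mul, map_pow, Complex.conj_ofReal]
        rw [mul_assoc, mul_left_comm _ (F _), ← h1, Finset.mul_sum, Finset.mul_sum]
        exact Finset.sum_congr rfl fun j _ => by ring
      simp only [e1]
      rw [integral_const_mul, ← sphCoeff, ← pow_mul_sphCoeffTilde (a + 1) b F _ hσ]
      have e2 : (σ : ℂ) ^ (2 * n - 1) * (σ : ℂ) ^ (a + b) * (σ : ℂ) ^ (a + 1 + b) =
          (σ : ℂ) ^ (2 * (n + a + b)) := by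
        rw [← pow_add, ← pow_add]
        congr 1
        omega
      rw [← e2]
      ring
    · intro j _
      refine integrable_sphere ?_
      have h1 : Continuous fun ω : Metric.sphere (0 : Cn n) 1 => σ • (ω : Cn n) := by fun_prop
      have h2 : Continuous fun ω : Metric.sphere (0 : Cn n) 1 => (starRingEnd ℂ) ((ω : Cn n) j) :=
        Complex.continuous_conj.comp (by fun_prop)
      exact ((hFc.comp h1).mul ((hPc j).comp h1)).mul h2
  have hrhs : ∑ j, 2 * (ρ : ℂ) ^ (2 * n - 1) *
      ∫ ω, wirt (fun u => F u * (starRingEnd ℂ) (evalBi (P j) u)) j (ρ • (ω : Cn n))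
        ∂(unitSphereMeasure n) =
      2 * (ρ : ℂ) ^ (2 * n - 1) * ((ρ : ℂ) ^ (2 * (a + b)) *
        ∑ j, sphCoeffTilde a b (G j) (evalBi (P j)) ρ +
        κ * (a + 1) * (ρ : ℂ) ^ (2 * (a + 1 + b)) * sphCoeffTilde (a + 1) b F (evalBi p) ρ) := by
    have e0 : ∀ (j : Fin n) (u : Cn n), wirt (fun u => F u * (starRingEnd ℂ) (evalBi (P j) u)) j u =
        G j u * (starRingEnd ℂ) (evalBi (P j) u) +
        κ * F u * ((starRingEnd ℂ) (u j) * (starRingEnd ℂ) (evalBi (P j) u)) +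
        F u * (starRingEnd ℂ) (evalBi (MvPolynomial.pderiv (Sum.inr j) (P j)) u) := by
      intro j u
      rw [wirt_mul (hFd.differentiable (by simp) u) (hasFDerivAt_conj_evalBi _ _).differentiableAt,
        wirt_conj_evalBi, hGe]
      ring
    have hsm : Continuous fun ω : Metric.sphere (0 : Cn n) 1 => ρ • (ω : Cn n) := by fun_prop
    have hiG : ∀ j, Integrable (fun ω : Metric.sphere (0 : Cn n) 1 => G j (ρ • (ω : Cn n)) *
        (starRingEnd ℂ) (evalBi (P j) (ω : Cn n))) (unitSphereMeasure n) := fun j =>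
      integrable_sphere (((h.contDiff _ (hG j)).continuous.comp hsm).mul
        ((hPc j).comp continuous_subtype_val))
    have hiF : Integrable (fun ω : Metric.sphere (0 : Cn n) 1 => F (ρ • (ω : Cn n)) *
        (starRingEnd ℂ) (evalBi p (ω : Cn n))) (unitSphereMeasure n) :=
      integrable_sphere ((hFc.comp hsm).mul (hpc.comp continuous_subtype_val))
    rw [← Finset.mul_sum, ← integral_finsetSum]
    · congr 1
      have e1 : ∀ ω : Metric.sphere (0 : Cn n) 1, ∑ j,
          wirt (fun u => F u * (starRingEnd ℂ) (evalBi (P j) u)) j (ρ • (ω : Cn n)) =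
          (∑ j, (ρ : ℂ) ^ (a + b) * (G j (ρ • (ω : Cn n)) *
            (starRingEnd ℂ) (evalBi (P j) (ω : Cn n)))) +
          κ * (a + 1) * (ρ : ℂ) ^ (a + 1 + b) *
            (F (ρ • (ω : Cn n)) * (starRingEnd ℂ) (evalBi p (ω : Cn n))) := by
        intro ω
        simp only [e0]
        rw [Finset.sum_add_distrib, Finset.sum_add_distrib, ← Finset.mul_sum, ← Finset.mul_sum,
          heuler', ← map_sum, hlap, map_zero, mul_zero, add_zero, hp.toIsBihom.eval_smul, map_mul,
          map_pow, Complex.conj_ofReal]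
        congr 1
        · refine Finset.sum_congr rfl fun j _ => ?_
          rw [(hPb j).eval_smul, map_mul, map_pow, Complex.conj_ofReal]
          ring
        · ring
      simp only [e1]
      rw [integral_add (integrable_finsetSum _ fun j _ => (hiG j).const_mul _) (hiF.const_mul _),
        integral_finsetSum _ fun j _ => (hiG j).const_mul _, integral_const_mul]
      simp only [integral_const_mul]
      rw [← Finset.mul_sum, ← sphCoeff, ← pow_mul_sphCoeffTilde (a + 1) b F _ hρ]
      have e3 : ∀ j, ∫ ω, G j (ρ • (ω : Cn n)) * (starRingEnd ℂ) (evalBi (P j) (ω : Cn n))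
          ∂(unitSphereMeasure n) =
          (ρ : ℂ) ^ (a + b) * sphCoeffTilde a b (G j) (evalBi (P j)) ρ := fun j =>
        (pow_mul_sphCoeffTilde a b (G j) _ hρ).symm
      simp only [e3, ← Finset.mul_sum]
      ring
    · intro j _
      refine integrable_sphere ?_
      have h1 := (hcd j).continuous_fderiv (by simp)
      have h2 : ∀ v : Cn n, Continuous fun ω : Metric.sphere (0 : Cn n) 1 =>
          fderiv ℝ (fun u => F u * (starRingEnd ℂ) (evalBi (P j) u)) (ρ • (ω : Cn n)) v := fun v =>
        (h1.comp hsm).clm_apply continuous_const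
      exact continuous_const.mul ((h2 _).sub (continuous_const.mul (h2 _)))
  have hE : HasDerivAt (fun σ : ℝ => (a + 1) * ((σ : ℂ) ^ (2 * (n + a + b)) *
      sphCoeffTilde (a + 1) b F (evalBi p) σ)) _ ρ :=
    (hsum.congr_of_eventuallyEq (by
      filter_upwards [Ioi_mem_nhds hρ] with σ hσ using (hlhs σ hσ).symm))
  have hW := (hasDerivAt_exp_sq κ ρ).mul (hE.const_mul ((a : ℂ) + 1)⁻¹)
  refine (hW.congr_of_eventuallyEq (Filter.Eventually.of_forall fun σ => ?_)).congr_deriv ?_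
  · simp only [radialWeight, Pi.mul_apply]
    field_simp
  · rw [hrhs]
    have hρ' : (ρ : ℂ) ≠ 0 := by exact_mod_cast hρ.ne'
    have e4 : (ρ : ℂ) ^ (2 * n - 1) * (ρ : ℂ) ^ (2 * (a + b)) =
        (ρ : ℂ) ^ (2 * (n + a + b)) * (ρ : ℂ)⁻¹ := by
      rw [eq_mul_inv_iff_mul_eq₀ hρ', ← pow_add, ← pow_succ]
      congr 1
      omega
    have e5 : (ρ : ℂ) ^ (2 * n - 1) * (ρ : ℂ) ^ (2 * (a + 1 + b)) =
        (ρ : ℂ) ^ (2 * (n + a + b)) * ρ := by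
      rw [← pow_add, ← pow_succ]
      congr 1
      omega
    set S := ∑ j, sphCoeffTilde a b (G j) (evalBi (P j)) ρ
    set T := sphCoeffTilde (a + 1) b F (evalBi p) ρ
    set Ex := Complex.exp (-κ * (ρ : ℂ) ^ 2)
    have e6 : 2 * (ρ : ℂ) ^ (2 * n - 1) * ((ρ : ℂ) ^ (2 * (a + b)) * S +
        κ * (a + 1) * (ρ : ℂ) ^ (2 * (a + 1 + b)) * T) =
        2 * ((ρ : ℂ) ^ (2 * (n + a + b)) * (ρ : ℂ)⁻¹) * S +
        2 * κ * (a + 1) * ((ρ : ℂ) ^ (2 * (n + a + b)) * ρ) * T := by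
      rw [← e4, ← e5]
      ring
    rw [e6]
    field_simp
    ring

/-- Integrating the first-order equation gives an element of the space for `(a+1, b)`. The constant
of integration contributes `radialModel κ (n+a+b)`, the new top exponent for `e^{κρ²}`. -/
lemma IsTwistClass.hasRadialCoeffs_succ (hn : 1 ≤ n) {κ : ℝ} (hκ : κ ≠ 0) {l L : ℝ} (hl : 0 ≤ l)
    {𝓒 : Set (Cn n → ℂ)} (h : IsTwistClass κ (Set.Ioo l L) 𝓒) {a b : ℕ}
    (hab : HasRadialCoeffs κ (Set.Ioo l L) 𝓒 a b) :
    HasRadialCoeffs κ (Set.Ioo l L) 𝓒 (a + 1) b := by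
  intro F hF p hp
  choose G hG hGe using h.wirt_eq F hF
  choose v hv hve using fun j => hab (G j) (hG j) _ (hp.pderiv_inl j)
  have hsum : (2 / (a + 1) : ℂ) • ∑ j, v j ∈ radialSpace n κ a b :=
    Submodule.smul_mem _ _ (Submodule.sum_mem _ fun j _ => hv j)
  obtain ⟨w, hw, hw'⟩ := exists_isRadialPrimitive hκ hsum
  obtain ⟨c, hc⟩ := exists_eq_of_isRadialPrimitive hl hw'
    (u := sphCoeffTilde (a + 1) b F (evalBi p)) (by
      intro ρ hρ
      refine (h.hasDerivAt_radialWeight hn hp hF hG hGe (hl.trans_lt hρ.1)).congr_deriv ?_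
      simp only [hve _ ρ hρ, Pi.smul_apply, Finset.sum_apply, smul_eq_mul])
  refine ⟨_, Submodule.add_mem _ hw (Submodule.smul_mem _ c
    (radialModel_mem_left (by push_cast; omega) (by push_cast; omega))), hc⟩

lemma IsTwistClass.hasRadialCoeffs (hn : 1 ≤ n) {κ : ℝ} (hκ : κ ≠ 0) {l L : ℝ} (hl : 0 ≤ l)
    {𝓒 : Set (Cn n → ℂ)} (h : IsTwistClass κ (Set.Ioo l L) 𝓒) (a b : ℕ) :
    HasRadialCoeffs κ (Set.Ioo l L) 𝓒 a b := by
  -- The step raises only the first index. Applied to the conjugate class it reaches all `(b, 0)`,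
  -- that is, all `(0, b)` for `𝓒` itself.
  have h0 : ∀ b, HasRadialCoeffs (-κ) (Set.Ioo l L) (conjClass 𝓒) b 0 := by
    intro b
    induction b with
    | zero => exact h.conj.hasRadialCoeffs_zero
    | succ b ih => exact h.conj.hasRadialCoeffs_succ hn (neg_ne_zero.2 hκ) hl ih
  induction a with
  | zero => exact (h0 b).of_conj
  | succ a ih => exact h.hasRadialCoeffs_succ hn hκ hl ih

end twistclass

/-! ### Smoothing by twisted convolution -/

section twistedconvolution

variable {n : ℕ}

lemma contDiff_symp {m : WithTop ℕ∞} : ContDiff ℝ m fun x : Cn n × Cn n => symp x.1 x.2 := by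
  unfold symp
  refine Complex.imCLM.contDiff.comp (ContDiff.sum fun j _ => ContDiff.mul ?_ ?_)
  · fun_prop
  · exact Complex.conjCLE.contDiff.comp (by fun_prop)

lemma symp_add_right (z u w : Cn n) : symp z (u + w) = symp z u + symp z w := by
  have h := symp_sub_right z (u + w) w
  rw [add_sub_cancel_right] at h
  linarith

/-- Smooth functions vanishing outside the closed ball of radius `δ`. -/
structure IsTestFn (δ : ℝ) (φ : Cn n → ℂ) : Prop where
  contDiff : ContDiff ℝ (⊤ : ℕ∞) φ
  eq_zero : ∀ a, δ < ‖a‖ → φ a = 0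

/-- The right twisted derivative of a test function. -/
noncomputable def twistDeriv (κ : ℝ) (ζ : Cn n) (φ : Cn n → ℂ) (a : Cn n) : ℂ :=
  -fderiv ℝ φ a ζ - 2 * Complex.I * κ * (symp a ζ : ℂ) * φ a

/-- The kernel of the twisted convolution with `φ`. -/
noncomputable def twistKernel (κ : ℝ) (φ : Cn n → ℂ) (u v : Cn n) : ℂ :=
  φ (v - u) * Complex.exp (-(2 * Complex.I * κ * (symp v u : ℂ)))

/-- The twisted convolution of `f` with `φ`. -/
noncomputable def twistConv (κ : ℝ) (f φ : Cn n → ℂ) (u : Cn n) : ℂ :=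
  ∫ v, twistKernel κ φ u v * f v

lemma IsTestFn.twistDeriv {δ : ℝ} {φ : Cn n → ℂ} (h : IsTestFn δ φ) (κ : ℝ) (ζ : Cn n) :
    IsTestFn δ (twistDeriv κ ζ φ) := by
  refine ⟨?_, fun a ha => ?_⟩
  · have h1 : ContDiff ℝ (⊤ : ℕ∞) fun a => fderiv ℝ φ a ζ :=
      (h.contDiff.fderiv_right (by simp)).clm_apply contDiff_const
    have h2 : ContDiff ℝ (⊤ : ℕ∞) fun a : Cn n => ((symp a ζ : ℝ) : ℂ) :=
      Complex.ofRealCLM.contDiff.comp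
        (contDiff_symp.comp (contDiff_id.prodMk contDiff_const))
    exact h1.neg.sub ((contDiff_const.mul h2).mul h.contDiff)
  · have h1 : φ =ᶠ[nhds a] fun _ => 0 := by
      filter_upwards [continuous_norm.continuousAt.eventually (Ioi_mem_nhds ha)] with b hb
        using h.eq_zero b hb
    rw [_root_.twistDeriv, h1.fderiv_eq, h.eq_zero a ha]
    simp

lemma IsTestFn.lincomb {δ : ℝ} {φ ψ : Cn n → ℂ} (hφ : IsTestFn δ φ) (hψ : IsTestFn δ ψ) (c d : ℂ) :
    IsTestFn δ fun a => c * φ a + d * ψ a :=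
  ⟨(contDiff_const.mul hφ.contDiff).add (contDiff_const.mul hψ.contDiff), fun a ha => by
    rw [hφ.eq_zero a ha, hψ.eq_zero a ha, mul_zero, mul_zero, add_zero]⟩

lemma continuous_twistKernel {κ : ℝ} {φ : Cn n → ℂ} (hφ : Continuous φ) :
    Continuous fun x : Cn n × Cn n => twistKernel κ φ x.1 x.2 := by
  have h2 : Continuous fun x : Cn n × Cn n => symp x.2 x.1 :=
    continuous_symp.comp (continuous_snd.prodMk continuous_fst)
  unfold twistKernel
  fun_prop

lemma integrable_twistKernel_mul (κ : ℝ) {f φ : Cn n → ℂ} (hf : Continuous f)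
    (hfc : HasCompactSupport f) (hφ : Continuous φ) (u : Cn n) :
    Integrable fun v => twistKernel κ φ u v * f v :=
  (((continuous_twistKernel hφ).comp (continuous_const.prodMk continuous_id)).mul
    hf).integrable_of_hasCompactSupport hfc.mul_left

lemma twistConv_lincomb (κ : ℝ) {f φ ψ : Cn n → ℂ} (hf : Continuous f)
    (hfc : HasCompactSupport f) (hφ : Continuous φ) (hψ : Continuous ψ) (c d : ℂ) (u : Cn n) :
    twistConv κ f (fun a => c * φ a + d * ψ a) u =
      c * twistConv κ f φ u + d * twistConv κ f ψ u := by
  simp only [twistConv]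
  rw [← integral_const_mul, ← integral_const_mul, ← integral_add
    ((integrable_twistKernel_mul κ hf hfc hφ u).const_mul c)
    ((integrable_twistKernel_mul κ hf hfc hψ u).const_mul d)]
  refine integral_congr_ae (Filter.Eventually.of_forall fun v => ?_)
  simp only [twistKernel]
  ring

/-- Since `symp u u = 0`, the phase depends on `v - u` and `u` only. The integral is therefore an
ordinary convolution with a smooth kernel depending on a parameter, taken on the diagonal. -/
lemma contDiff_twistConv (κ : ℝ) {δ : ℝ} {f φ : Cn n → ℂ} (hf : Continuous f)
    (hφ : IsTestFn δ φ) : ContDiff ℝ (⊤ : ℕ∞) (twistConv κ f φ) := by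
  let g : Cn n → Cn n → ℂ := fun u y => φ (-y) * Complex.exp (-(2 * Complex.I * κ *
    (symp (-y) u : ℂ)))
  have hg : ContDiff ℝ (⊤ : ℕ∞) (Function.HasUncurry.uncurry g) := by
    have h1 : ContDiff ℝ (⊤ : ℕ∞) fun x : Cn n × Cn n => ((symp (-x.2) x.1 : ℝ) : ℂ) :=
      Complex.ofRealCLM.contDiff.comp
        (contDiff_symp.comp (contDiff_snd.neg.prodMk contDiff_fst))
    exact (hφ.contDiff.comp contDiff_snd.neg).mul (contDiff_const.mul h1).neg.cexp
  have h := contDiffOn_convolution_right_with_param (ContinuousLinearMap.mul ℝ ℂ)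
    (μ := (volume : Measure (Cn n))) (f := f) (g := g) (s := Set.univ)
    (k := Metric.closedBall 0 δ) (n := ⊤) isOpen_univ (isCompact_closedBall _ _)
    (fun u y _ hy => by
      have : δ < ‖-y‖ := by simpa using hy
      simp only [g]
      rw [hφ.eq_zero _ this, zero_mul])
    hf.locallyIntegrable hg.contDiffOn
  rw [Set.univ_prod_univ, contDiffOn_univ] at h
  have h2 := h.comp (contDiff_id.prodMk contDiff_id : ContDiff ℝ (⊤ : ℕ∞) fun u : Cn n => (u, u))
  convert h2 using 1
  ext u
  simp only [twistConv, Function.comp_apply, convolution_def, ContinuousLinearMap.mul_apply', g]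
  refine integral_congr_ae (Filter.Eventually.of_forall fun v => ?_)
  simp only [twistKernel, neg_sub]
  have : symp (v - u) u = symp v u := by
    have := symp_add_left (v - u) u u
    rw [sub_add_cancel, symp_self] at this
    linarith
  rw [id, this, mul_comm (f v)]

/-- With `w = u + tζ`, split `symp v ζ` into `symp (v - w) ζ` and `symp w ζ`. The first part is a
function of `v - w` and joins the derivative of `φ`; the second does not involve `v` and can leave
the integral. -/
lemma hasDerivAt_twistKernel (κ : ℝ) {φ : Cn n → ℂ} (hφ : Differentiable ℝ φ) (u ζ v : Cn n)
    (t : ℝ) : HasDerivAt (fun t : ℝ => twistKernel κ φ (u + t • ζ) v)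
      (twistKernel κ (twistDeriv κ ζ φ) (u + t • ζ) v -
        2 * Complex.I * κ * (symp (u + t • ζ) ζ : ℂ) * twistKernel κ φ (u + t • ζ) v) t := by
  have hw : HasDerivAt (fun t : ℝ => v - (u + t • ζ)) (-ζ) t := by
    have h1 : HasDerivAt (fun t : ℝ => t • ζ) ζ t := by
      simpa using (hasDerivAt_id t).smul_const ζ
    exact (h1.const_add u).const_sub v
  have h1 := (hφ (v - (u + t • ζ))).hasFDerivAt.comp_hasDerivAt t hw
  have hsy : HasDerivAt (fun t : ℝ => symp v (u + t • ζ)) (symp v ζ) t := by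
    have : (fun t : ℝ => symp v (u + t • ζ)) = fun t => symp v u + t * symp v ζ := by
      ext t
      rw [symp_add_right, symp_smul_right]
    rw [this]
    simpa using ((hasDerivAt_id t).mul_const (symp v ζ)).const_add (symp v u)
  have h2 := ((hsy.ofReal_comp.const_mul (2 * Complex.I * (κ : ℂ))).neg).cexp
  refine (h1.mul h2).congr_deriv ?_
  have h3 : symp v ζ = symp (v - (u + t • ζ)) ζ + symp (u + t • ζ) ζ := by
    rw [← symp_add_left, sub_add_cancel]
  simp only [twistKernel, twistDeriv, map_neg, Function.comp_apply]
  rw [h3]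
  push_cast
  simp only [Pi.neg_apply]
  ring

lemma hasDerivAt_twistConv (κ : ℝ) {δ : ℝ} {f φ : Cn n → ℂ} (hf : Continuous f)
    (hfc : HasCompactSupport f) (hφ : IsTestFn δ φ) (u ζ : Cn n) :
    HasDerivAt (fun t : ℝ => twistConv κ f φ (u + t • ζ))
      (twistConv κ f (twistDeriv κ ζ φ) u -
        2 * Complex.I * κ * (symp u ζ : ℂ) * twistConv κ f φ u) 0 := by
  have hφc := hφ.contDiff.continuous
  have hφc' := (hφ.twistDeriv κ ζ).contDiff.continuous
  set K' : ℝ → Cn n → ℂ := fun t v => twistKernel κ (twistDeriv κ ζ φ) (u + t • ζ) v -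
    2 * Complex.I * κ * (symp (u + t • ζ) ζ : ℂ) * twistKernel κ φ (u + t • ζ) v with hK'
  have hline : Continuous fun x : ℝ × Cn n => (u + x.1 • ζ, x.2) := by fun_prop
  have hK'c : Continuous (Function.uncurry K') := by
    have h1 : Continuous fun x : ℝ × Cn n => symp (u + x.1 • ζ) ζ :=
      continuous_symp.comp (by fun_prop : Continuous fun x : ℝ × Cn n => (u + x.1 • ζ, ζ))
    exact ((continuous_twistKernel hφc').comp hline).sub ((continuous_const.mul
      (Complex.continuous_ofReal.comp h1)).mul ((continuous_twistKernel hφc).comp hline))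
  obtain ⟨C, hC⟩ := ((isCompact_closedBall (0 : ℝ) 1).prod
    hfc.isCompact).exists_bound_of_continuousOn hK'c.continuousOn
  have hfi := hf.integrable_of_hasCompactSupport hfc (μ := volume)
  have h := (hasDerivAt_integral_of_dominated_loc_of_deriv_le (μ := (volume : Measure (Cn n)))
    (F := fun t v => twistKernel κ φ (u + t • ζ) v * f v) (F' := fun t v => K' t v * f v)
    (x₀ := (0 : ℝ)) (bound := fun v => C * ‖f v‖)
    (Metric.closedBall_mem_nhds (0 : ℝ) zero_lt_one)
    (Filter.Eventually.of_forall fun t =>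
      (integrable_twistKernel_mul κ hf hfc hφc (u + t • ζ)).aestronglyMeasurable)
    (integrable_twistKernel_mul κ hf hfc hφc _)
    ((hK'c.comp (continuous_const.prodMk continuous_id)).mul hf).aestronglyMeasurable
    (Filter.Eventually.of_forall fun v t ht => by
      by_cases hv : v ∈ tsupport f
      · rw [norm_mul]
        exact mul_le_mul_of_nonneg_right (hC (t, v) ⟨ht, hv⟩) (norm_nonneg _)
      · rw [image_eq_zero_of_notMem_tsupport hv, mul_zero, norm_zero, mul_zero])
    (hfi.norm.const_mul C)
    (Filter.Eventually.of_forall fun v t _ =>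
      (hasDerivAt_twistKernel κ (hφ.contDiff.differentiable (by simp)) u ζ v t).mul_const (f v))).2
  refine h.congr_deriv ?_
  simp only [hK', zero_smul, add_zero, twistConv]
  rw [← integral_const_mul, ← integral_sub (integrable_twistKernel_mul κ hf hfc hφc' u)
    ((integrable_twistKernel_mul κ hf hfc hφc u).const_mul _)]
  refine integral_congr_ae (Filter.Eventually.of_forall fun v => ?_)
  simp only []
  ring

lemma fderiv_twistConv (κ : ℝ) {δ : ℝ} {f φ : Cn n → ℂ} (hf : Continuous f)
    (hfc : HasCompactSupport f) (hφ : IsTestFn δ φ) (u ζ : Cn n) :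
    fderiv ℝ (twistConv κ f φ) u ζ = twistConv κ f (twistDeriv κ ζ φ) u -
        2 * Complex.I * κ * (symp u ζ : ℂ) * twistConv κ f φ u := by
  have h1 : HasDerivAt (fun t : ℝ => u + t • ζ) ζ 0 := by
    simpa using ((hasDerivAt_id (0 : ℝ)).smul_const ζ).const_add u
  have h2 : HasFDerivAt (twistConv κ f φ) (fderiv ℝ (twistConv κ f φ) u) (u + (0 : ℝ) • ζ) := by
    rw [zero_smul, add_zero]
    exact ((contDiff_twistConv κ hf hφ).differentiable (by simp) u).hasFDerivAt
  have h3 := h2.comp_hasDerivAt (0 : ℝ) h1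
  have h4 := hasDerivAt_twistConv κ hf hfc hφ u ζ
  rw [show (fun t : ℝ => twistConv κ f φ (u + t • ζ)) =
    twistConv κ f φ ∘ fun t : ℝ => u + t • ζ from rfl] at h4
  exact h3.unique h4

lemma symp_single (u : Cn n) (j : Fin n) (c : ℂ) :
    symp u (PiLp.single 2 j c) = (u j * (starRingEnd ℂ) c).im := by
  rw [symp, Finset.sum_eq_single j]
  · simp
  · intro i _ hi; simp [hi]
  · simp

/-- Substituting `v = a + u` and exchanging integrals shows the smoothed coefficient as a
`φ`-average, over centres `a`, of twisted integrals of `f` over spheres about `a`. -/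
lemma sphCoeff_twistConv (κ : ℝ) {δ : ℝ} {f φ : Cn n → ℂ} (hf : Continuous f)
    (hφ : IsTestFn δ φ) {Q : Cn n → ℂ} (hQ : Continuous Q) (ρ : ℝ) :
    sphCoeff (twistConv κ f φ) Q ρ = ∫ a, φ a * ∫ ω : Metric.sphere (0 : Cn n) 1,
      Complex.exp (-(2 * Complex.I * κ * (ρ * symp a ω : ℂ))) * f (a + ρ • (ω : Cn n)) *
        (starRingEnd ℂ) (Q ω) ∂(unitSphereMeasure n) := by
  have h1 : ∀ u, twistConv κ f φ u =
      ∫ a, φ a * (Complex.exp (-(2 * Complex.I * κ * (symp a u : ℂ))) * f (a + u)) := by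
    intro u
    rw [twistConv, ← integral_add_right_eq_self _ u]
    refine integral_congr_ae (Filter.Eventually.of_forall fun a => ?_)
    simp only [twistKernel, add_sub_cancel_right, symp_add_left, symp_self, add_zero]
    ring
  rw [sphCoeff]
  simp only [h1, ← integral_mul_const, ← integral_const_mul]
  rw [integral_integral_swap_of_hasCompactSupport]
  · refine integral_congr_ae (Filter.Eventually.of_forall fun a => ?_)
    simp only []
    refine integral_congr_ae (Filter.Eventually.of_forall fun ω => ?_)
    simp only [symp_smul_right]
    push_cast
    ring
  · have h2 : Continuous fun x : Metric.sphere (0 : Cn n) 1 × Cn n => symp x.2 (ρ • (x.1 : Cn n)) :=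
      continuous_symp.comp (by fun_prop :
        Continuous fun x : Metric.sphere (0 : Cn n) 1 × Cn n => (x.2, ρ • (x.1 : Cn n)))
    have h3 : Continuous fun x : Metric.sphere (0 : Cn n) 1 × Cn n => (starRingEnd ℂ) (Q x.1) :=
      Complex.continuous_conj.comp (hQ.comp (continuous_subtype_val.comp continuous_fst))
    have h4 := hφ.contDiff.continuous
    refine Continuous.mul ?_ h3
    fun_prop
  · refine HasCompactSupport.intro (isCompact_univ.prod (isCompact_closedBall (0 : Cn n) δ)) ?_
    rintro ⟨ω, a⟩ hx
    have : δ < ‖a‖ := by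
      by_contra hc
      exact hx ⟨trivial, by simpa using hc⟩
    simp only [Function.uncurry_apply_pair, hφ.eq_zero a this, zero_mul]

lemma isTwistClass_twistConv (κ : ℝ) {δ : ℝ} {I : Set ℝ} {f : Cn n → ℂ} (hf : Continuous f)
    (hfc : HasCompactSupport f) (h : ∀ a, ‖a‖ ≤ δ → ∀ s ∈ I, twist κ f a s = 0) :
    IsTwistClass κ I (twistConv κ f '' {φ | IsTestFn δ φ}) := by
  have him : ∀ u : Cn n, ∀ j, ((symp u (PiLp.single 2 j 1) : ℝ) : ℂ) -
      Complex.I * (symp u (PiLp.single 2 j Complex.I) : ℝ) = Complex.I * (starRingEnd ℂ) (u j) := by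
    intro u j
    rw [symp_single, symp_single]
    apply Complex.ext <;> simp
  have him' : ∀ u : Cn n, ∀ j, ((symp u (PiLp.single 2 j 1) : ℝ) : ℂ) +
      Complex.I * (symp u (PiLp.single 2 j Complex.I) : ℝ) = -Complex.I * u j := by
    intro u j
    rw [symp_single, symp_single]
    apply Complex.ext <;> simp
  refine ⟨?_, ?_, ?_, ?_⟩
  · rintro _ ⟨φ, hφ, rfl⟩
    exact (contDiff_twistConv κ hf hφ).of_le (by exact_mod_cast le_top)
  · rintro _ ⟨φ, hφ, rfl⟩ j
    have h1 := IsTestFn.twistDeriv hφ κ (PiLp.single 2 j 1)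
    have h2 := IsTestFn.twistDeriv hφ κ (PiLp.single 2 j Complex.I)
    -- The twisted counterpart of `∂_j`: half of the twisted derivative along `e_j` minus `i` times
    -- that along `i e_j`.
    refine ⟨_, ⟨_, h1.lincomb h2 (1 / 2) (-Complex.I / 2), rfl⟩, fun u => ?_⟩
    rw [twistConv_lincomb κ hf hfc h1.contDiff.continuous h2.contDiff.continuous, wirt,
      fderiv_twistConv κ hf hfc hφ, fderiv_twistConv κ hf hfc hφ]
    linear_combination (-Complex.I * κ * twistConv κ f φ u) * him u j -
      κ * (starRingEnd ℂ) (u j) * twistConv κ f φ u * Complex.I_sq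
  · rintro _ ⟨φ, hφ, rfl⟩ j
    have h1 := IsTestFn.twistDeriv hφ κ (PiLp.single 2 j 1)
    have h2 := IsTestFn.twistDeriv hφ κ (PiLp.single 2 j Complex.I)
    refine ⟨_, ⟨_, h1.lincomb h2 (1 / 2) (Complex.I / 2), rfl⟩, fun u => ?_⟩
    have h3 : HasFDerivAt (fun u => (starRingEnd ℂ) (twistConv κ f φ u))
        ((Complex.conjCLE : ℂ →L[ℝ] ℂ).comp (fderiv ℝ (twistConv κ f φ) u)) u :=
      (Complex.conjCLE : ℂ →L[ℝ] ℂ).hasFDerivAt.comp u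
        ((contDiff_twistConv κ hf hφ).differentiable (by simp) u).hasFDerivAt
    rw [wirt, h3.fderiv]
    simp only [ContinuousLinearMap.comp_apply, ContinuousLinearEquiv.coe_coe,
      Complex.conjCLE_apply]
    rw [twistConv_lincomb κ hf hfc h1.contDiff.continuous h2.contDiff.continuous,
      fderiv_twistConv κ hf hfc hφ, fderiv_twistConv κ hf hfc hφ]
    have h4 := congrArg (starRingEnd ℂ) (him' u j)
    simp only [map_add, map_sub, map_mul, map_neg, Complex.conj_I, Complex.conj_ofReal, map_div₀,
      map_ofNat, map_one] at h4 ⊢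
    linear_combination (Complex.I * κ * (starRingEnd ℂ) (twistConv κ f φ u)) * h4 +
      κ * (starRingEnd ℂ) (u j) * (starRingEnd ℂ) (twistConv κ f φ u) * Complex.I_sq
  · rintro _ ⟨φ, hφ, rfl⟩ s hs
    have h1 := sphCoeff_twistConv κ hf hφ (Q := fun _ => 1) continuous_const s
    simp only [sphCoeff, map_one, mul_one] at h1
    rw [h1]
    refine integral_eq_zero_of_ae (Filter.Eventually.of_forall fun a => ?_)
    by_cases ha : ‖a‖ ≤ δ
    · have h2 := h a ha s hs
      -- `twist` integrates over `a - sω`, the convolution over `a + sω`; the antipodal map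
      -- reconciles them.
      rw [twist, ← integral_neg_sphere] at h2
      refine Eq.trans (congrArg (φ a * ·) ?_) (mul_zero (φ a))
      refine Eq.trans ?_ h2
      refine integral_congr_ae (Filter.Eventually.of_forall fun ω => ?_)
      have h3 : symp a (-(ω : Cn n)) = -symp a ω := by
        simpa using symp_smul_right (-1) a (ω : Cn n)
      simp only [coe_neg_sphere, h3, smul_neg, sub_neg_eq_add]
      push_cast
      rw [mul_comm]
      ring_nf
    · simp only [hφ.eq_zero a (not_le.1 ha), zero_mul, Pi.zero_apply]

end twistedconvolution

/-! ### Necessity: limits and exhaustion -/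

section necessity

variable {n : ℕ}

/-- The restrictions to `S` form a finite-dimensional subspace, closed in the topology of pointwise
convergence. An arbitrary filter is allowed, since both sequences and the directed set of finite
sets of radii occur. -/
lemma exists_mem_radialSpace_of_tendsto {ι : Type*} {F : Filter ι} [F.NeBot] {κ : ℝ} {a b : ℕ}
    {v : ι → ℝ → ℂ} (hv : ∀ k, v k ∈ radialSpace n κ a b) {S : Set ℝ} {c : ℝ → ℂ}
    (h : ∀ ρ ∈ S, Filter.Tendsto (fun k => v k ρ) F (nhds (c ρ))) :
    ∃ w ∈ radialSpace n κ a b, ∀ ρ ∈ S, c ρ = w ρ := by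
  let res : (ℝ → ℂ) →ₗ[ℂ] (S → ℂ) := LinearMap.funLeft ℂ ℂ (Subtype.val : S → ℝ)
  have : FiniteDimensional ℂ (radialSpace n κ a b) :=
    FiniteDimensional.span_of_finite ℂ
      (((Set.finite_Ico _ _).image _).union ((Set.finite_Ico _ _).image _))
  have hcl : IsClosed (((radialSpace n κ a b).map res : Submodule ℂ (S → ℂ)) : Set (S → ℂ)) :=
    Submodule.closed_of_finiteDimensional _
  have hmem : res c ∈ (radialSpace n κ a b).map res :=
    hcl.mem_of_tendsto (f := fun k => res (v k)) (b := F)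
      (tendsto_pi_nhds.2 fun ρ => h ρ ρ.2)
      (Filter.Eventually.of_forall fun k => ⟨v k, hv k, rfl⟩)
  obtain ⟨w, hw, hwe⟩ := hmem
  exact ⟨w, hw, fun ρ hρ => (congrFun hwe ⟨ρ, hρ⟩).symm⟩

/-- A bump function on `ℂⁿ` supported in the ball of radius `δ / (k + 1)`. -/
noncomputable def shrinkingBump (n : ℕ) {δ : ℝ} (hδ : 0 < δ) (k : ℕ) : ContDiffBump (0 : Cn n) where
  rIn := δ / (k + 1) / 2
  rOut := δ / (k + 1)
  rIn_pos := by positivity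
  rIn_lt_rOut := half_lt_self (by positivity)

lemma isTestFn_shrinkingBump {δ : ℝ} (hδ : 0 < δ) (k : ℕ) :
    IsTestFn δ fun a : Cn n => (((shrinkingBump n hδ k).normed volume a : ℝ) : ℂ) := by
  refine ⟨Complex.ofRealCLM.contDiff.comp (ContDiffBump.contDiff_normed _), fun a ha => ?_⟩
  have : a ∉ Function.support ((shrinkingBump n hδ k).normed volume) := by
    rw [ContDiffBump.support_normed_eq, mem_ball_zero_iff, not_lt]
    refine le_trans ?_ ha.le
    exact div_le_self hδ.le (by linarith [Nat.cast_nonneg (α := ℝ) k])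
  rw [Function.notMem_support.1 this, Complex.ofReal_zero]

lemma tendsto_integral_shrinkingBump {δ : ℝ} (hδ : 0 < δ) {Φ : Cn n → ℂ} (hΦ : Continuous Φ) :
    Filter.Tendsto (fun k => ∫ a, (((shrinkingBump n hδ k).normed volume a : ℝ) : ℂ) * Φ a)
      Filter.atTop (nhds (Φ 0)) := by
  have hr : Filter.Tendsto (fun k => (shrinkingBump n hδ k).rOut) Filter.atTop (nhds 0) :=
    tendsto_const_nhds.div_atTop (Filter.tendsto_atTop_add_const_right _ _
      tendsto_natCast_atTop_atTop)
  have h := ContDiffBump.convolution_tendsto_right_of_continuous (μ := (volume : Measure (Cn n))) hr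
    (hΦ.comp continuous_neg) 0
  simpa [convolution_def] using h

/-- The convolutions of `f` with test functions supported in the `δ`-ball form a twist class.
Shrinking the support recovers the coefficient of `f` as a pointwise limit. -/
lemma sphCoeffTilde_mem_of_compactSupport (hn : 1 ≤ n) {κ : ℝ} (hκ : κ ≠ 0) {l L : ℝ} (hl : 0 ≤ l)
    {δ : ℝ} (hδ : 0 < δ) {f : Cn n → ℂ} (hf : Continuous f) (hfc : HasCompactSupport f)
    (h : ∀ a, ‖a‖ ≤ δ → ∀ s ∈ Set.Ioo l L, twist κ f a s = 0) {a b : ℕ}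
    {p : MvPolynomial (Fin n ⊕ Fin n) ℂ} (hp : IsHarm a b p) :
    ∃ v ∈ radialSpace n κ a b, ∀ ρ ∈ Set.Ioo l L, sphCoeffTilde a b f (evalBi p) ρ = v ρ := by
  have hT := (isTwistClass_twistConv κ hf hfc h).hasRadialCoeffs hn hκ hl a b
  choose v hv hve using fun k => hT _ ⟨_, isTestFn_shrinkingBump hδ k, rfl⟩ p hp
  refine exists_mem_radialSpace_of_tendsto (F := Filter.atTop) hv fun ρ hρ => ?_
  have e : ∀ k, v k ρ = sphCoeffTilde a b (twistConv κ f fun a : Cn n =>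
      (((shrinkingBump n hδ k).normed volume a : ℝ) : ℂ)) (evalBi p) ρ := fun k => (hve k ρ hρ).symm
  simp only [e, sphCoeffTilde]
  refine Filter.Tendsto.const_mul _ ?_
  simp only [fun k => sphCoeff_twistConv κ hf (isTestFn_shrinkingBump hδ k) (continuous_evalBi p) ρ]
  have hΦ : Continuous fun a : Cn n => ∫ ω : Metric.sphere (0 : Cn n) 1,
      Complex.exp (-(2 * Complex.I * κ * (ρ * symp a ω : ℂ))) * f (a + ρ • (ω : Cn n)) *
        (starRingEnd ℂ) (evalBi p ω) ∂(unitSphereMeasure n) := by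
    refine continuous_integral_sphere ?_
    have h2 : Continuous fun x : Cn n × Metric.sphere (0 : Cn n) 1 => symp x.1 x.2 :=
      continuous_symp.comp (by fun_prop :
        Continuous fun x : Cn n × Metric.sphere (0 : Cn n) 1 => (x.1, (x.2 : Cn n)))
    have h3 : Continuous fun x : Cn n × Metric.sphere (0 : Cn n) 1 =>
        (starRingEnd ℂ) (evalBi p x.2) :=
      Complex.continuous_conj.comp ((continuous_evalBi p).comp
        (continuous_subtype_val.comp continuous_snd))
    refine Continuous.mul ?_ h3
    fun_prop
  convert tendsto_integral_shrinkingBump hδ hΦ using 2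
  rw [sphCoeff]
  have h0 : ∀ ω : Cn n, symp 0 ω = 0 := fun ω => by simp [symp]
  simp [h0]

lemma exists_compactSupport_eq_on_shell {f : Cn n → ℂ} {l L : ℝ}
    (hf : ContinuousOn f {u | l ≤ ‖u‖ ∧ ‖u‖ ≤ L}) :
    ∃ g : Cn n → ℂ, Continuous g ∧ HasCompactSupport g ∧
      ∀ u, l ≤ ‖u‖ → ‖u‖ ≤ L → g u = f u := by
  obtain ⟨g, hg, hgf⟩ := exists_continuous_eq_on_shell hf
  refine ⟨fun u => ((max 0 (min 1 (L + 1 - ‖u‖)) : ℝ) : ℂ) * g u, by fun_prop,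
    HasCompactSupport.intro (isCompact_closedBall (0 : Cn n) (L + 1)) fun u hu => ?_,
    fun u h1 h2 => ?_⟩
  · have hu' : L + 1 < ‖u‖ := by simpa using hu
    rw [max_eq_left ((min_le_right _ _).trans (by linarith)), Complex.ofReal_zero, zero_mul]
  · simp only []
    rw [min_eq_left (by linarith), max_eq_right zero_le_one, Complex.ofReal_one, one_mul,
      hgf u h1 h2]

lemma sphCoeffTilde_mem_on_Ioo (hn : 1 ≤ n) {r : ℝ} {R : EReal} (hr : 0 ≤ r) {f : Cn n → ℂ}
    (hf : f ∈ ZAnn n r R) {l L : ℝ} (hl : r < l) (hL : (L : EReal) < R) {a b : ℕ}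
    {p : MvPolynomial (Fin n ⊕ Fin n) ℂ} (hp : IsHarm a b p) :
    ∃ v ∈ radialSpace n (1 / 4) a b, ∀ ρ ∈ Set.Ioo l L,
      sphCoeffTilde a b f (evalBi p) ρ = v ρ := by
  obtain ⟨l', hl1, hl2⟩ := exists_between hl
  obtain ⟨L', hL1, hL2⟩ := EReal.lt_iff_exists_real_btwn.1 hL
  have hL1' : L < L' := by exact_mod_cast hL1
  obtain ⟨g, hg, hgc, hgf⟩ := exists_compactSupport_eq_on_shell (f := f) (l := l') (L := L')
    (hf.1.mono fun u hu => ⟨hl1.trans_le hu.1, (EReal.coe_le_coe_iff.2 hu.2).trans_lt hL2⟩)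
  -- Spheres of radius in `(l, L)` with centre within `δ` of the origin stay in the shell `[l',
  -- L']`, where the extension agrees with `f`, and enclose the ball of radius `r`.
  set δ := min (l - l') (L' - L)
  have hδ : 0 < δ := lt_min (by linarith) (by linarith)
  have hδ1 : δ ≤ l - l' := min_le_left _ _
  have hδ2 : δ ≤ L' - L := min_le_right _ _
  have hl0 : 0 < l := hr.trans_lt hl
  obtain ⟨v, hv, hve⟩ := sphCoeffTilde_mem_of_compactSupport hn (κ := 1 / 4) (by norm_num) hl0.le hδ
    (L := L) hg hgc (by
      intro a ha s hs
      have hs0 : 0 < s := hl0.trans hs.1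
      have h1 : twist (1 / 4) g a s = twist (1 / 4) f a s := by
        refine integral_congr_ae (Filter.Eventually.of_forall fun ω => ?_)
        have h2 := norm_sub_smul_sphere_ge a hs0 ω
        have h3 := norm_sub_smul_sphere_le a hs0 ω
        simp only []
        rw [hgf _ (by linarith [hs.1]) (by linarith [hs.2])]
      rw [h1, ← twistedMean_eq_twist f hs0]
      refine hf.2 a s hs0 (fun u hu => ?_) (fun u hu => ?_)
      · rw [mem_sphere_iff_norm] at hu
        have h2 : ‖u‖ ≤ ‖u - a‖ + ‖a‖ := by simpa using norm_add_le (u - a) a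
        have h3 : ‖u - a‖ ≤ ‖u‖ + ‖a‖ := norm_sub_le u a
        refine ⟨by linarith [hs.1], lt_of_le_of_lt (EReal.coe_le_coe_iff.2 ?_) hL2⟩
        linarith [hs.2]
      · rw [mem_closedBall_zero_iff] at hu
        rw [mem_closedBall_iff_norm]
        have h3 : ‖u - a‖ ≤ ‖u‖ + ‖a‖ := norm_sub_le u a
        linarith [hs.1]) hp
  refine ⟨v, hv, fun ρ hρ => ?_⟩
  rw [← hve ρ hρ, sphCoeffTilde, sphCoeffTilde]
  congr 1
  refine integral_congr_ae (Filter.Eventually.of_forall fun ω => ?_)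
  have : ‖ρ • (ω : Cn n)‖ = ρ := by simp [norm_smul, abs_of_pos (hl0.trans hρ.1)]
  simp only []
  rw [hgf _ (by rw [this]; linarith [hρ.1]) (by rw [this]; linarith [hρ.2])]

lemma sphCoeffTilde_mem_of_mem_ZAnn (hn : 1 ≤ n) {r : ℝ} {R : EReal} (hr : 0 ≤ r) {f : Cn n → ℂ}
    (hf : f ∈ ZAnn n r R) {a b : ℕ} {p : MvPolynomial (Fin n ⊕ Fin n) ℂ} (hp : IsHarm a b p) :
    ∃ v ∈ radialSpace n (1 / 4) a b, ∀ ρ : ℝ, r < ρ → (ρ : EReal) < R →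
      sphCoeffTilde a b f (evalBi p) ρ = v ρ := by
  let S : Set ℝ := {ρ | r < ρ ∧ (ρ : EReal) < R}
  -- Finitely many radii lie in one compact subinterval. The functions found for different finite
  -- sets need not agree, so a limit along finite sets of radii yields a single one.
  have key : ∀ s : Finset S, ∃ v ∈ radialSpace n (1 / 4) a b, ∀ ρ ∈ s,
      sphCoeffTilde a b f (evalBi p) ρ = v ρ := by
    intro s
    rcases s.eq_empty_or_nonempty with rfl | hs
    · exact ⟨0, Submodule.zero_mem _, fun ρ hρ => absurd hρ (Finset.notMem_empty ρ)⟩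
    · obtain ⟨m, -, hm⟩ := s.exists_min_image id hs
      obtain ⟨M, -, hM⟩ := s.exists_max_image id hs
      obtain ⟨l, hl1, hl2⟩ := exists_between m.2.1
      obtain ⟨L, hL1, hL2⟩ := EReal.lt_iff_exists_real_btwn.1 M.2.2
      obtain ⟨v, hv, hve⟩ := sphCoeffTilde_mem_on_Ioo hn hr hf hl1 hL2 hp
      refine ⟨v, hv, fun ρ hρ => hve ρ ⟨hl2.trans_le (hm ρ hρ), ?_⟩⟩
      exact lt_of_le_of_lt (hM ρ hρ : (ρ : ℝ) ≤ M) (by exact_mod_cast hL1)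
  choose v hv hve using key
  obtain ⟨w, hw, hwe⟩ := exists_mem_radialSpace_of_tendsto (F := Filter.atTop) hv (S := S)
    (c := sphCoeffTilde a b f (evalBi p)) (by
      intro ρ hρ
      refine tendsto_const_nhds.congr' ?_
      filter_upwards [Filter.eventually_ge_atTop {(⟨ρ, hρ⟩ : S)}] with s hs
      exact hve s ⟨ρ, hρ⟩ (hs (Finset.mem_singleton_self _)))
  exact ⟨w, hw, fun ρ h1 h2 => hwe ρ ⟨h1, h2⟩⟩

end necessity

/-! ### The explicit form of the coefficients -/

section radialsums

variable {n : ℕ}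

lemma radialModel_eq (κ : ℝ) (k : ℤ) (ρ : ℝ) :
    radialModel κ k ρ = ((Real.exp (κ * ρ ^ 2) * ρ ^ (-2 * k) : ℝ) : ℂ) := by
  rw [radialModel, ← zpow_natCast ρ 2, ← zpow_mul]
  norm_num

/-- The substitution `k = a+b+n-i` turns `n+b ≤ k < n+a+b` into `1 ≤ i ≤ a`, and likewise `n+a ≤ k <
n+a+b` into `1 ≤ i ≤ b`. -/
lemma mem_radialSpace_iff {κ : ℝ} {a b : ℕ} {v : ℝ → ℂ} : v ∈ radialSpace n κ a b ↔
    ∃ c d : ℕ → ℂ, v = ∑ i ∈ Finset.Icc 1 a, c i • radialModel κ ((a : ℤ) + b + n - i) +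
      ∑ k ∈ Finset.Icc 1 b, d k • radialModel (-κ) ((a : ℤ) + b + n - k) := by
  classical
  constructor
  · intro hv
    induction hv using Submodule.span_induction with
    | mem v h =>
      rcases h with ⟨k, ⟨h1, h2⟩, rfl⟩ | ⟨k, ⟨h1, h2⟩, rfl⟩
      · obtain ⟨i, rfl⟩ : ∃ i : ℕ, k = (a : ℤ) + b + n - i :=
          ⟨((a : ℤ) + b + n - k).toNat, by omega⟩
        refine ⟨Pi.single i 1, 0, ?_⟩
        rw [Finset.sum_eq_single i]
        · simp
        · intro j _ hj; simp [hj]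
        · intro hi; exact absurd (Finset.mem_Icc.2 ⟨by omega, by omega⟩) hi
      · obtain ⟨i, rfl⟩ : ∃ i : ℕ, k = (a : ℤ) + b + n - i :=
          ⟨((a : ℤ) + b + n - k).toNat, by omega⟩
        refine ⟨0, Pi.single i 1, ?_⟩
        rw [Finset.sum_eq_single (s := Finset.Icc 1 b) i]
        · simp
        · intro j _ hj; simp [hj]
        · intro hi; exact absurd (Finset.mem_Icc.2 ⟨by omega, by omega⟩) hi
    | zero => exact ⟨0, 0, by simp⟩
    | add f g _ _ hf hg =>
      obtain ⟨c, d, rfl⟩ := hf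
      obtain ⟨c', d', rfl⟩ := hg
      refine ⟨c + c', d + d', ?_⟩
      simp only [Pi.add_apply, add_smul, Finset.sum_add_distrib]
      abel
    | smul e f _ hf =>
      obtain ⟨c, d, rfl⟩ := hf
      refine ⟨e • c, e • d, ?_⟩
      simp only [Pi.smul_apply, smul_add, Finset.smul_sum, smul_assoc]
  · rintro ⟨c, d, rfl⟩
    refine Submodule.add_mem _ (Submodule.sum_mem _ fun i hi => Submodule.smul_mem _ _ ?_)
      (Submodule.sum_mem _ fun i hi => Submodule.smul_mem _ _ ?_)
    · obtain ⟨h1, h2⟩ := Finset.mem_Icc.1 hi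
      exact radialModel_mem_left (by omega) (by omega)
    · obtain ⟨h1, h2⟩ := Finset.mem_Icc.1 hi
      exact radialModel_mem_right (by omega) (by omega)

lemma exists_mem_radialSpace_iff {a b : ℕ} {S : Set ℝ} {A : ℝ → ℂ} :
    (∃ v ∈ radialSpace n (1 / 4) a b, ∀ ρ ∈ S, A ρ = v ρ) ↔ ∃ c d : ℕ → ℂ, ∀ ρ ∈ S, A ρ =
      ∑ i ∈ Finset.Icc 1 a, c i *
        ((Real.exp (ρ ^ 2 / 4) * ρ ^ (-2 * ((a : ℤ) + b + n - i)) : ℝ) : ℂ) +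
      ∑ k ∈ Finset.Icc 1 b, d k *
        ((Real.exp (-(ρ ^ 2 / 4)) * ρ ^ (-2 * ((a : ℤ) + b + n - k)) : ℝ) : ℂ) := by
  have e1 : ∀ ρ : ℝ, 1 / 4 * ρ ^ 2 = ρ ^ 2 / 4 := fun ρ => by ring
  have e2 : ∀ ρ : ℝ, -(1 / 4) * ρ ^ 2 = -(ρ ^ 2 / 4) := fun ρ => by ring
  constructor
  · rintro ⟨v, hv, h⟩
    obtain ⟨c, d, rfl⟩ := mem_radialSpace_iff.1 hv
    refine ⟨c, d, fun ρ hρ => ?_⟩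
    rw [h ρ hρ]
    simp only [Pi.add_apply, Finset.sum_apply, Pi.smul_apply, smul_eq_mul, radialModel_eq, e1, e2]
  · rintro ⟨c, d, h⟩
    refine ⟨_, mem_radialSpace_iff.2 ⟨c, d, rfl⟩, fun ρ hρ => ?_⟩
    rw [h ρ hρ]
    simp only [Pi.add_apply, Finset.sum_apply, Pi.smul_apply, smul_eq_mul, radialModel_eq, e1, e2]

end radialsums

/-- The uniform version of the theorem: the separate cases arise when one or both sums are empty. -/
lemma mem_ZAnn_iff (n : ℕ) (hn : 1 ≤ n) (r : ℝ) (R : EReal) (hr : 0 ≤ r)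
    (P : ∀ p q : ℕ, Fin (dimHarmonics n p q) → Cn n → ℂ)
    (hP : ∀ p q : ℕ, IsOrthonormalHarmonicBasis n p q (P p q))
    (f : Cn n → ℂ) (hf : ContinuousOn f (Ann n r R)) :
    f ∈ ZAnn n r R ↔ ∀ (a b : ℕ) (j : Fin (dimHarmonics n a b)), ∃ c d : ℕ → ℂ,
      ∀ ρ ∈ {ρ : ℝ | r < ρ ∧ (ρ : EReal) < R}, sphCoeffTilde a b f (P a b j) ρ =
      ∑ i ∈ Finset.Icc 1 a, c i *
        ((Real.exp (ρ ^ 2 / 4) * ρ ^ (-2 * ((a : ℤ) + b + n - i)) : ℝ) : ℂ) +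
      ∑ k ∈ Finset.Icc 1 b, d k *
        ((Real.exp (-(ρ ^ 2 / 4)) * ρ ^ (-2 * ((a : ℤ) + b + n - k)) : ℝ) : ℂ) := by
  have hmem : ∀ a b j, ∃ p, IsHarm a b p ∧ evalBi p = P a b j := fun a b j =>
    mem_solidHarmonics_iff.1 ((hP a b).1 ▸ Submodule.subset_span ⟨j, rfl⟩)
  choose pol hpol hpe using hmem
  obtain rfl : P = fun a b j => evalBi (pol a b j) := by
    funext a b j
    exact (hpe a b j).symm
  simp only [← exists_mem_radialSpace_iff]
  constructor
  · intro h a b j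
    obtain ⟨v, hv, hve⟩ := sphCoeffTilde_mem_of_mem_ZAnn hn hr h (hpol a b j)
    exact ⟨v, hv, fun ρ hρ => hve ρ hρ.1 hρ.2⟩
  · intro h
    refine mem_ZAnn_of_radialSpace hn hpol hP hr hf fun a b j => ?_
    obtain ⟨v, hv, hve⟩ := h a b j
    exact ⟨v, hv, fun ρ h1 h2 => hve ρ ⟨h1, h2⟩⟩

theorem theorem1p1 (n : ℕ) (hn : 1 ≤ n) (r : ℝ) (R : EReal) (hr : 0 ≤ r) (hrR : (r : EReal) < R)
    (P : ∀ p q : ℕ, Fin (dimHarmonics n p q) → Cn n → ℂ)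
    (hP : ∀ p q : ℕ, IsOrthonormalHarmonicBasis n p q (P p q))
    (f : Cn n → ℂ) (hf : ContinuousOn f (Ann n r R)) :
    f ∈ ZAnn n r R ↔
      (∀ (j : Fin (dimHarmonics n 0 0)) (ρ : ℝ), r < ρ → (ρ : EReal) < R →
        sphCoeffTilde 0 0 f (P 0 0 j) ρ = 0) ∧
      (∀ p q : ℕ, 1 ≤ p → 1 ≤ q → ∀ j : Fin (dimHarmonics n p q), ∃ c d : ℕ → ℂ,
        ∀ ρ : ℝ, r < ρ → (ρ : EReal) < R →
          sphCoeffTilde p q f (P p q j) ρ =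
            ∑ i ∈ Finset.Icc 1 p, c i *
              ((Real.exp (ρ ^ 2 / 4) * ρ ^ (-2 * ((p : ℤ) + q + n - i)) : ℝ) : ℂ) +
            ∑ k ∈ Finset.Icc 1 q, d k *
              ((Real.exp (-(ρ ^ 2 / 4)) * ρ ^ (-2 * ((p : ℤ) + q + n - k)) : ℝ) : ℂ)) ∧
      (∀ p : ℕ, 1 ≤ p → ∀ j : Fin (dimHarmonics n p 0), ∃ c : ℕ → ℂ,
        ∀ ρ : ℝ, r < ρ → (ρ : EReal) < R →
          sphCoeffTilde p 0 f (P p 0 j) ρ =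
            ∑ i ∈ Finset.Icc 1 p, c i *
              ((Real.exp (ρ ^ 2 / 4) * ρ ^ (-2 * ((p : ℤ) + n - i)) : ℝ) : ℂ)) ∧
      (∀ q : ℕ, 1 ≤ q → ∀ j : Fin (dimHarmonics n 0 q), ∃ d : ℕ → ℂ,
        ∀ ρ : ℝ, r < ρ → (ρ : EReal) < R →
          sphCoeffTilde 0 q f (P 0 q j) ρ =
            ∑ k ∈ Finset.Icc 1 q, d k *
              ((Real.exp (-(ρ ^ 2 / 4)) * ρ ^ (-2 * ((q : ℤ) + n - k)) : ℝ) : ℂ)) := by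
  rw [mem_ZAnn_iff n hn r R hr P hP f hf]
  constructor
  · intro h
    refine ⟨fun j ρ h1 h2 => ?_, fun p q _ _ j => ?_, fun p _ j => ?_, fun q _ j => ?_⟩
    · obtain ⟨c, d, hcd⟩ := h 0 0 j
      simpa using hcd ρ ⟨h1, h2⟩
    · obtain ⟨c, d, hcd⟩ := h p q j
      exact ⟨c, d, fun ρ h1 h2 => hcd ρ ⟨h1, h2⟩⟩
    · obtain ⟨c, d, hcd⟩ := h p 0 j
      exact ⟨c, fun ρ h1 h2 => by simpa using hcd ρ ⟨h1, h2⟩⟩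
    · obtain ⟨c, d, hcd⟩ := h 0 q j
      exact ⟨d, fun ρ h1 h2 => by simpa using hcd ρ ⟨h1, h2⟩⟩
  · rintro ⟨h00, hpq, hp0, h0q⟩ a b j
    -- Where an index is zero the corresponding sum is empty, so its coefficients are arbitrary and
    -- taken to be `0`.
    rcases Nat.eq_zero_or_pos a with rfl | ha <;> rcases Nat.eq_zero_or_pos b with rfl | hb
    · exact ⟨0, 0, fun ρ hρ => by simpa using h00 j ρ hρ.1 hρ.2⟩
    · obtain ⟨d, hd⟩ := h0q b hb j
      exact ⟨0, d, fun ρ hρ => by simpa using hd ρ hρ.1 hρ.2⟩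
    · obtain ⟨c, hc⟩ := hp0 a ha j
      exact ⟨c, 0, fun ρ hρ => by simpa using hc ρ hρ.1 hρ.2⟩
    · obtain ⟨c, d, hcd⟩ := hpq a b ha hb j
      exact ⟨c, d, fun ρ hρ => hcd ρ hρ.1 hρ.2⟩
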